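/- **Setting.** Let $\Sigma$ be a valid signature of the Edinburgh Logical Framework LF (kinds $K::=\mathsf{type}\mid\Pi x{:}A.K$, families $A::=a\mid\Pi x{:}A.B\mid A\,M$, objects $M::=c\mid x\mid\lambda x{:}A.M\mid M\,N$, with the usual typing rules and with $\beta\eta$-conversion $\equiv$ as equality), and let $a:\Pi\Gamma^I.\Pi\Gamma^O.\mathsf{type}$ be a type family of $\Sigma$, where the parameters in $\Gamma^I=x_1{:}A'_1,\dots,x_k{:}A'_k$ are inputs and those in $\Gamma^O$ are outputs. Let $c:A\leftarrow A_1\leftarrow\cdots\leftarrow A_m$ be a clause for $a$ in $\Sigma$, i.e. a constant of $\Sigma$ with type $\Pi\Gamma_v.\,A_m\to\cdots\to A_1\to A$ in canonical form, where $A=a\,M_1\cdots M_n$, $A_i=a\,M_{i1}\cdots M_{in}$, and $\Gamma_v$ declares exactly the variables that occur in $A,A_1,\dots,A_m$ or on which the types of such variables depend. Write $\sigma^I_c=(M_1/x_1,\dots,M_k/x_k)$, $\sigma^I_i=(M_{i1}/x_1,\dots,M_{ik}/x_k)$, and let $\sigma^O_c$ be the output arguments $M_{k+1},\dots,M_n$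 of the head. Below, a context "of the variables occurring in" some terms also contains the variables on which their types depend. **M2.** Formulas are $\forall\Gamma_1.\exists\Gamma_2.\top$, sequents are $\Gamma;\Delta\vdash F$. The rules (proof terms record them) are: $\forall L$: if $\forall\Gamma_1.F_1\in\Delta$ and $\Gamma\vdash\sigma:\Gamma_1$, pass to $\Gamma;\Delta,F_1[\sigma]\vdash F$; $\exists L$: if $\exists\Gamma_1.\top\in\Delta$, pass to $\Gamma,\Gamma_1;\Delta\vdash F$ with fresh variables; $\forall R$: from $\Gamma,\Gamma_1;\Delta\vdash F$ infer $\Gamma;\Delta\vdash\forall\Gamma_1.F$; $\exists R$: from $\Gamma\vdash\sigma:\Gamma_1$ infer $\Gamma;\Delta\vdash\exists\Gamma_1.\top$; case: if $\Gamma_1,x{:}A_x,\Gamma_2$ is a valid permutation of $\Gamma$ (types being identified up to $\equiv$), $A_x$ is atomic and depends on all variables of $\Gamma_1$, and for every object constant $d:\Pi\Gamma_d.A_d$ of $\Sigma$ the unification problem $(A_x=A_d,\ x=d\,\Gamma_d)$ over $(\Gamma_1,x{:}A_x,\Gamma_d)$ either has no solution or has a most general unifier $\Gamma'\vdash\sigma:(\Gamma_1,x{:}A_x,\Gamma_d)$,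 pass to the sequents $\Gamma',\Gamma_2[\sigma];\Delta[\sigma]\vdash F[\sigma]$, one for each $d$ of the second kind. (There is also a recursion rule, which the proofs below do not use.) **Checks.** *Mode consistency:* let $V_0$ be the set of the variables that occur in the input arguments of $A$ and have a strict occurrence in $A$, and let $V_i$ be $V_{i-1}$ together with the variables that occur in the output arguments of $A_i$ and have a strict occurrence in $A_i$ (an occurrence is strict if it is not in an argument of a free variable and its arguments are distinct bound variables). Then for $1\le i\le m$ the variables in the input arguments of $A_i$ are in $V_{i-1}$, and the variables in the output arguments of $A$ are in $V_m$. *Output coverage checking:* let $\Gamma_{c_0}$ be the context of the variables occurring in the input arguments of $A$, and $\Gamma_{c_i}=\Gamma_{c_{i-1}},\Gamma_i',D_i{:}A_i$, where $\Gamma_i'$ consists of the variables occurring in the output arguments of $A_i$ that are not in $\Gamma_{c_{i-1}}$, and $D_i$ is fresh. For every $i$ the goal $$\Gamma_{c_{i-1}},\Gamma^O[\sigma^I_i]\vdash a\,\sigma^I_i\,\Gamma^O:\mathsf{type}$$ is covered by the pattern $\Gamma_{c_{i-1}},\Gamma_i'\vdash A_i:\mathsf{type}$. That is, finitely many output splittings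 reduce the goal to subgoals $\Gamma\vdash A':\mathsf{type}$ each of which is immediately covered: some type-preserving bijective renaming of the variables of $\Gamma$ to those of the pattern, which fixes $\Gamma_{c_{i-1}}$, turns $A'$ into $A_i$ up to $\equiv$. An output splitting chooses a variable $x$ of atomic type $A_x$ that is not in $\Gamma_{c_{i-1}}$, and presents the context as a valid permutation $\Gamma_1,x{:}A_x,\Gamma_2$ where $A_x$ depends on all variables of $\Gamma_1$ (types again up to $\equiv$). It is applicable if for every object constant $d:\Pi\Gamma_d.A_d$ of $\Sigma$ the problem $(A_x=A_d,\ x=d\,\Gamma_d)$ either has no solution or has a most general unifier $\sigma$ that instantiates no variable of $\Gamma_1,\Gamma_2$, with $\Gamma_1,\Gamma_d'\vdash\sigma:(\Gamma_1,x{:}A_x,\Gamma_d)$; the subgoals are $\Gamma_1,\Gamma_d',\Gamma_2[\sigma]\vdash A'[\sigma]:\mathsf{type}$, one for each $d$ of the second kind. **Algorithm.** Given successful runs of output coverage checking for all premises, it constructs an M2 proof as follows. For $i=1,\dots,m$: apply $\forall L$ with $\sigma^I_i$ to the assumption $\forall\Gamma^I.\exists\Gamma^O.\exists D{:}a\,\Gamma^I\,\Gamma^O.\top$;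 apply $\exists L$ to the new assumption, which introduces $\Gamma^O[\sigma^I_i]$ and $D_i$; apply the case rule once for each output splitting, on the same variable and with the same most general unifiers; and continue, in each immediately covered subgoal, with the proof generated from the remaining premises $A_{i+1},\dots,A_m$, renamed by the inverse of the renaming of the immediate coverage. After the last premise apply $\exists R$ with the substitution $(\sigma^O_c,\ (c\,\Gamma_v\,D_m\cdots D_1)/D)$. **Lemma.** Assume that $c$ is mode consistent and that output coverage checking succeeds for all premises of $c$. Let $G$ be the input coverage pattern $\Gamma_{c_0}\vdash a\,\sigma^I_c:\Pi\Gamma^O[\sigma^I_c].\mathsf{type}$ of $c$ and let $S$ be the sequent related to it, $$\Gamma_{c_0};\ \forall\Gamma^I.\exists\Gamma^O.\exists D{:}a\,\Gamma^I\,\Gamma^O.\top\ \vdash\ \exists\Gamma^O[\sigma^I_c].\exists D{:}a\,\sigma^I_c\,\Gamma^O.\top .$$ Then, for all successful runs of output coverage checking for the premises of $c$, the proof that the algorithm constructs from $c$ and these runs is a valid M2 proof of $S$. -/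

import Mathlib

/-! Part 1. The syntax of LF.
Free variables carry names (natural numbers); bound variables are de Bruijn indices. -/

namespace TwelfM2

/-- The three syntactic categories of LF: kinds, type families, objects. -/
inductive Cat
  | kind | fam | obj

/-- A variable: a bound variable (de Bruijn index) or a free variable (name). -/
inductive Var
  | b (i : ℕ)
  | f (x : ℕ)

/-- `K ::= type | Πx:A.K`, `A ::= a | Πx:A.B | A M`, `M ::= c | x | λx:A.M | M N`. -/
inductive Exp : Cat → Type
  | type : Exp .kind
  | kpi (A : Exp .fam) (K : Exp .kind) : Exp .kind
  | tcon (a : ℕ) : Exp .fam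
  | tpi (A B : Exp .fam) : Exp .fam
  | tapp (A : Exp .fam) (M : Exp .obj) : Exp .fam
  | ocon (c : ℕ) : Exp .obj
  | var (v : Var) : Exp .obj
  | lam (A : Exp .fam) (M : Exp .obj) : Exp .obj
  | app (M N : Exp .obj) : Exp .obj

abbrev Kind := Exp .kind
abbrev Fam := Exp .fam
abbrev Obj := Exp .obj

/-- A telescope `x₁:A₁,…,xₙ:Aₙ` of bound variables, outermost first: the `j`-th entry lives under
`j` binders. -/
abbrev Tele := List Fam

/-- An LF context of named variables, from left to right. -/
abbrev Ctx := List (ℕ × Fam)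

/-- The free variable with name `x`. -/
abbrev fvar (x : ℕ) : Obj := .var (.f x)

/-- The bound variable with index `i`. -/
abbrev bvar (i : ℕ) : Obj := .var (.b i)

/-- Shifting the bound variables by `n`. -/
def Var.shift (n : ℕ) : Var → Var
  | .b i => .b (i + n)
  | .f x => .f x

/-- A variable renaming under a binder. -/
def Var.up (r : Var → Var) : Var → Var
  | .b 0 => .b 0
  | .b (i + 1) => (r (.b i)).shift 1
  | .f x => (r (.f x)).shift 1

/-- Renaming of variables (bound and free). -/
def Exp.ren : {k : Cat} → (Var → Var) → Exp k → Exp k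
  | _, _, .type => .type
  | _, r, .kpi A K => .kpi (A.ren r) (K.ren (Var.up r))
  | _, _, .tcon a => .tcon a
  | _, r, .tpi A B => .tpi (A.ren r) (B.ren (Var.up r))
  | _, r, .tapp A M => .tapp (A.ren r) (M.ren r)
  | _, _, .ocon c => .ocon c
  | _, r, .var v => .var (r v)
  | _, r, .lam A M => .lam (A.ren r) (M.ren (Var.up r))
  | _, r, .app M N => .app (M.ren r) (N.ren r)

/-- Weakening under `n` binders. -/
def Exp.lift {k : Cat} (n : ℕ) (e : Exp k) : Exp k := e.ren (Var.shift n)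

/-- A simultaneous substitution under a binder. -/
def upSub (θ : Var → Obj) : Var → Obj
  | .b 0 => bvar 0
  | .b (i + 1) => (θ (.b i)).lift 1
  | .f x => (θ (.f x)).lift 1

/-- Capture avoiding simultaneous substitution for all variables. -/
def Exp.sub : {k : Cat} → (Var → Obj) → Exp k → Exp k
  | _, _, .type => .type
  | _, θ, .kpi A K => .kpi (A.sub θ) (K.sub (upSub θ))
  | _, _, .tcon a => .tcon a
  | _, θ, .tpi A B => .tpi (A.sub θ) (B.sub (upSub θ))
  | _, θ, .tapp A M => .tapp (A.sub θ) (M.sub θ)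
  | _, _, .ocon c => .ocon c
  | _, θ, .var v => θ v
  | _, θ, .lam A M => .lam (A.sub θ) (M.sub (upSub θ))
  | _, θ, .app M N => .app (M.sub θ) (N.sub θ)

/-- The substitution that replaces the innermost `Ms.length` bound variables by the objects `Ms`;
the last object of the list is for the innermost binder. -/
def env (Ms : List Obj) : Var → Obj
  | .b i => (Ms.reverse[i]?).getD (bvar (i - Ms.length))
  | .f x => fvar x

/-- Replacing the innermost bound variables by `Ms`; `e.inst [N]` is `e[N/x]` for a body `e`. -/
def Exp.inst {k : Cat} (Ms : List Obj) (e : Exp k) : Exp k := e.sub (env Ms)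

/-- A substitution for free variables. -/
abbrev Subst := ℕ → Obj

/-- A substitution for free variables, seen as one for all variables. -/
def Subst.toVar (σ : Subst) : Var → Obj
  | .b i => bvar i
  | .f x => σ x

/-- `e[σ]`. -/
def Exp.nsub {k : Cat} (σ : Subst) (e : Exp k) : Exp k := e.sub σ.toVar

/-- Renaming of free variables along a permutation of the names. -/
def Exp.rename {k : Cat} (π : Equiv.Perm ℕ) (e : Exp k) : Exp k := e.nsub (fun x => fvar (π x))

/-- The names of the free variables of an expression. -/
def Exp.fv : {k : Cat} → Exp k → Finset ℕ
  | _, .type => ∅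
  | _, .kpi A K => A.fv ∪ K.fv
  | _, .tcon _ => ∅
  | _, .tpi A B => A.fv ∪ B.fv
  | _, .tapp A M => A.fv ∪ M.fv
  | _, .ocon _ => ∅
  | _, .var (.b _) => ∅
  | _, .var (.f x) => {x}
  | _, .lam A M => A.fv ∪ M.fv
  | _, .app M N => M.fv ∪ N.fv

/-- The free variables of a list of objects. -/
def fvs (Ms : List Obj) : Finset ℕ := Ms.foldr (fun M X => M.fv ∪ X) ∅

/-- `A M₁ … Mₙ`. -/
def tapps (A : Fam) (Ms : List Obj) : Fam := Ms.foldl .tapp A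

/-- `M N₁ … Nₙ`. -/
def apps (M : Obj) (Ns : List Obj) : Obj := Ns.foldl .app M

/-- `ΠT.K`. -/
def kpis (T : Tele) (K : Kind) : Kind := T.foldr .kpi K

/-- `ΠT.B`. -/
def tpis (T : Tele) (B : Fam) : Fam := T.foldr .tpi B

/-- `A → B`. -/
def arrow (A B : Fam) : Fam := .tpi A (B.lift 1)

/-- The telescope `T` of a type `ΠT.A` with `A` atomic. -/
def Exp.tele : {k : Cat} → Exp k → Tele
  | _, .tpi A B => A :: B.tele
  | _, _ => []

/-- The atomic type `A` of a type `ΠT.A`. -/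
def targetOf : (k : Cat) → Exp k → Exp k
  | _, .tpi _ B => targetOf .fam B
  | _, e => e

/-- The atomic target of a type. -/
def Exp.target (A : Fam) : Fam := targetOf .fam A

/-- `T[θ]` for a telescope `T`. -/
def teleSub (θ : Var → Obj) : Tele → Tele
  | [] => []
  | A :: T => A.sub θ :: teleSub (upSub θ) T

/-- `T[Ms]`: the innermost bound variables on which the telescope `T` depends are replaced. -/
def teleInst (Ms : List Obj) (T : Tele) : Tele := teleSub (env Ms) T

/-- The context that a telescope becomes when its variables get the names `xs`. -/
def openTele : List ℕ → Tele → Ctx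
  | x :: xs, A :: T => (x, A) :: openTele xs (teleInst [fvar x] T)
  | _, _ => []

/-- The variables bound by a telescope of length `n`, as seen from below it. -/
def bvars (n : ℕ) : List Obj := ((List.range n).map bvar).reverse

/-- The names declared in a context. -/
def dom (Γ : Ctx) : List ℕ := Γ.map Prod.fst

/-- `Γ[σ]`. -/
def Ctx.nsub (σ : Subst) (Γ : Ctx) : Ctx := Γ.map fun p => (p.1, p.2.nsub σ)

/-! Part 2. Typing. -/

/-- Conversion `≡` (βη), on each of the three categories. -/
inductive Conv : {k : Cat} → Exp k → Exp k → Prop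
  | refl {k : Cat} (e : Exp k) : Conv e e
  | symm {k : Cat} {e e' : Exp k} : Conv e e' → Conv e' e
  | trans {k : Cat} {e e' e'' : Exp k} : Conv e e' → Conv e' e'' → Conv e e''
  | beta (A : Fam) (M N : Obj) : Conv (.app (.lam A M) N) (M.inst [N])
  | eta (A : Fam) (M : Obj) : Conv (.lam A (.app (M.lift 1) (bvar 0))) M
  | kpi {A A' : Fam} {K K' : Kind} : Conv A A' → Conv K K' → Conv (.kpi A K) (.kpi A' K')
  | tpi {A A' B B' : Fam} : Conv A A' → Conv B B' → Conv (.tpi A B) (.tpi A' B')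
  | tapp {A A' : Fam} {M M' : Obj} : Conv A A' → Conv M M' → Conv (.tapp A M) (.tapp A' M')
  | lam {A A' : Fam} {M M' : Obj} : Conv A A' → Conv M M' → Conv (.lam A M) (.lam A' M')
  | app {M M' N N' : Obj} : Conv M M' → Conv N N' → Conv (.app M N) (.app M' N')

/-- A declaration `a : K` or `c : A` of a signature. -/
inductive Decl
  | fam (a : ℕ) (K : Kind)
  | obj (c : ℕ) (A : Fam)

/-- An LF signature, the latest declaration first. -/
abbrev Sig := List Decl

/-- The declarations of object constants in a signature. -/
def Sig.objs (S : Sig) : List (ℕ × Fam) :=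
  S.filterMap fun d => match d with
    | .fam _ _ => none
    | .obj c A => some (c, A)

/-- The judgments of LF. The context of a judgment consists of a context `Γ` of named variables
followed by the list `Ψ` of the types of the bound variables in scope, the innermost first. -/
inductive Judg
  | ctx (Γ : Ctx) (Ψ : List Fam)
  | kind (Γ : Ctx) (Ψ : List Fam) (K : Kind)
  | fam (Γ : Ctx) (Ψ : List Fam) (A : Fam) (K : Kind)
  | obj (Γ : Ctx) (Ψ : List Fam) (M : Obj) (A : Fam)

/-- Derivability of the LF judgments over the signature `S`. -/
inductive LF (S : Sig) : Judg → Prop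
  | ctx_nil : LF S (.ctx [] [])
  | ctx_snoc {Γ : Ctx} {x : ℕ} {A : Fam} :
      LF S (.ctx Γ []) → x ∉ dom Γ → LF S (.fam Γ [] A .type) → LF S (.ctx (Γ ++ [(x, A)]) [])
  | ctx_bind {Γ : Ctx} {Ψ : List Fam} {A : Fam} :
      LF S (.ctx Γ Ψ) → LF S (.fam Γ Ψ A .type) → LF S (.ctx Γ (A :: Ψ))
  | kind_type {Γ : Ctx} {Ψ : List Fam} : LF S (.ctx Γ Ψ) → LF S (.kind Γ Ψ .type)
  | kind_pi {Γ : Ctx} {Ψ : List Fam} {A : Fam} {K : Kind} :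
      LF S (.kind Γ (A :: Ψ) K) → LF S (.kind Γ Ψ (.kpi A K))
  | fam_con {Γ : Ctx} {Ψ : List Fam} {a : ℕ} {K : Kind} :
      Decl.fam a K ∈ S → LF S (.ctx Γ Ψ) → LF S (.fam Γ Ψ (.tcon a) K)
  | fam_pi {Γ : Ctx} {Ψ : List Fam} {A B : Fam} :
      LF S (.fam Γ (A :: Ψ) B .type) → LF S (.fam Γ Ψ (.tpi A B) .type)
  | fam_app {Γ : Ctx} {Ψ : List Fam} {A B : Fam} {K : Kind} {M : Obj} :
      LF S (.fam Γ Ψ A (.kpi B K)) → LF S (.obj Γ Ψ M B) →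
      LF S (.fam Γ Ψ (.tapp A M) (K.inst [M]))
  | fam_conv {Γ : Ctx} {Ψ : List Fam} {A : Fam} {K K' : Kind} :
      LF S (.fam Γ Ψ A K) → LF S (.kind Γ Ψ K') → Conv K K' → LF S (.fam Γ Ψ A K')
  | obj_con {Γ : Ctx} {Ψ : List Fam} {c : ℕ} {A : Fam} :
      Decl.obj c A ∈ S → LF S (.ctx Γ Ψ) → LF S (.obj Γ Ψ (.ocon c) A)
  | obj_fvar {Γ : Ctx} {Ψ : List Fam} {x : ℕ} {A : Fam} :
      (x, A) ∈ Γ → LF S (.ctx Γ Ψ) → LF S (.obj Γ Ψ (fvar x) A)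
  | obj_bvar {Γ : Ctx} {Ψ : List Fam} {i : ℕ} {A : Fam} :
      Ψ[i]? = some A → LF S (.ctx Γ Ψ) → LF S (.obj Γ Ψ (bvar i) (A.lift (i + 1)))
  | obj_lam {Γ : Ctx} {Ψ : List Fam} {A B : Fam} {M : Obj} :
      LF S (.obj Γ (A :: Ψ) M B) → LF S (.obj Γ Ψ (.lam A M) (.tpi A B))
  | obj_app {Γ : Ctx} {Ψ : List Fam} {A B : Fam} {M N : Obj} :
      LF S (.obj Γ Ψ M (.tpi A B)) → LF S (.obj Γ Ψ N A) →
      LF S (.obj Γ Ψ (.app M N) (B.inst [N]))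
  | obj_conv {Γ : Ctx} {Ψ : List Fam} {M : Obj} {A A' : Fam} :
      LF S (.obj Γ Ψ M A) → LF S (.fam Γ Ψ A' .type) → Conv A A' → LF S (.obj Γ Ψ M A')

/-- `Γ` is a valid context. -/
def CtxValid (S : Sig) (Γ : Ctx) : Prop := LF S (.ctx Γ [])

/-- Valid signatures. -/
inductive Sig.Valid : Sig → Prop
  | nil : Sig.Valid []
  | fam {S : Sig} {a : ℕ} {K : Kind} : Sig.Valid S → (∀ K', Decl.fam a K' ∉ S) →
      LF S (.kind [] [] K) → Sig.Valid (.fam a K :: S)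
  | obj {S : Sig} {c : ℕ} {A : Fam} : Sig.Valid S → (∀ A', Decl.obj c A' ∉ S) →
      LF S (.fam [] [] A .type) → Sig.Valid (.obj c A :: S)

/-- `Γ ⊢ Ms : T`: the list `Ms` is a substitution for the variables of the telescope `T`. -/
inductive TeleSubst (S : Sig) (Γ : Ctx) : List Obj → Tele → Prop
  | nil : CtxValid S Γ → TeleSubst S Γ [] []
  | cons {M : Obj} {Ms : List Obj} {A : Fam} {T : Tele} :
      LF S (.obj Γ [] M A) → TeleSubst S Γ Ms (teleInst [M] T) → TeleSubst S Γ (M :: Ms) (A :: T)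

/-- `Γ ⊢ σ : Γ'`: the substitution `σ` maps the variables of `Γ'` to objects over `Γ`. -/
def CtxSubst (S : Sig) (Γ : Ctx) (σ : Subst) (Γ' : Ctx) : Prop :=
  CtxValid S Γ ∧ ∀ y B, (y, B) ∈ Γ' → LF S (.obj Γ [] (σ y) (B.nsub σ))

/-- `Γ'` is a valid permutation of `Γ`, where types are identified up to conversion. -/
def CtxPerm (S : Sig) (Γ Γ' : Ctx) : Prop :=
  CtxValid S Γ' ∧ ∃ Γ'' : Ctx, Γ.Perm Γ'' ∧
    List.Forall₂ (fun p q => p.1 = q.1 ∧ Conv p.2 q.2) Γ'' Γ'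

/-- Simple types, the shapes of types with the dependencies erased. -/
inductive STy
  | base
  | arr (τ υ : STy)

/-- The shape of a kind or of a type (objects get a dummy value). -/
def Exp.erase : {k : Cat} → Exp k → STy
  | _, .type => .base
  | _, .kpi A K => .arr A.erase K.erase
  | _, .tcon _ => .base
  | _, .tpi A B => .arr A.erase B.erase
  | _, .tapp A _ => A.erase
  | _, _ => .base

/-- The two parts of the definition of canonical forms: neutral forms (a head applied to canonical
arguments) and canonical forms. -/
inductive NForm
  | neutral | canonical

/-- Canonical (β-normal, η-long) forms of closed families and objects under binders whose types
have the shapes `Ψ`; the last argument is the shape of the kind or type. -/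
inductive Canon (S : Sig) : NForm → List STy → {k : Cat} → Exp k → STy → Prop
  | tcon {Ψ : List STy} {a : ℕ} {K : Kind} : Decl.fam a K ∈ S →
      Canon S .neutral Ψ (Exp.tcon a) K.erase
  | tapp {Ψ : List STy} {A : Fam} {M : Obj} {τ υ : STy} :
      Canon S .neutral Ψ A (.arr τ υ) → Canon S .canonical Ψ M τ →
      Canon S .neutral Ψ (Exp.tapp A M) υ
  | ocon {Ψ : List STy} {c : ℕ} {A : Fam} : Decl.obj c A ∈ S →
      Canon S .neutral Ψ (Exp.ocon c) A.erase
  | bvar {Ψ : List STy} {i : ℕ} {τ : STy} : Ψ[i]? = some τ → Canon S .neutral Ψ (bvar i) τ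
  | app {Ψ : List STy} {M N : Obj} {τ υ : STy} :
      Canon S .neutral Ψ M (.arr τ υ) → Canon S .canonical Ψ N τ →
      Canon S .neutral Ψ (Exp.app M N) υ
  | atom {Ψ : List STy} {k : Cat} {e : Exp k} :
      Canon S .neutral Ψ e .base → Canon S .canonical Ψ e .base
  | tpi {Ψ : List STy} {A B : Fam} : Canon S .canonical Ψ A .base →
      Canon S .canonical (A.erase :: Ψ) B .base → Canon S .canonical Ψ (Exp.tpi A B) .base
  | lam {Ψ : List STy} {A : Fam} {M : Obj} {τ : STy} : Canon S .canonical Ψ A .base →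
      Canon S .canonical (A.erase :: Ψ) M τ →
      Canon S .canonical Ψ (Exp.lam A M) (.arr A.erase τ)

/-! Part 3. Unification and dependence. -/

/-- The atomic type `A` depends directly on `y`: `y` cannot be eliminated from `A` by conversion
(it occurs in the canonical form of `A`). -/
def Essential (y : ℕ) (A : Fam) : Prop := ∀ B : Fam, Conv A B → y ∈ B.fv

/-- `A` depends on the variable `y` of `Γ`, directly or through the types of variables. -/
inductive DependsOn (Γ : Ctx) (A : Fam) : ℕ → Prop
  | direct {y : ℕ} : Essential y A → DependsOn Γ A y
  | trans {z y : ℕ} {B : Fam} : DependsOn Γ A z → (z, B) ∈ Γ → Essential y B → DependsOn Γ A y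

/-- The unification problem `A_x = A_c, x = c Γ_c` for a variable `x : A_x` over `Γ₁` and a constant
`c : ΠΓ_c.A_c` given as `d`, where the variables of `Γ_c` are named `zs`: the substitution `θ` into
the context `Γ'` is a solution. -/
def Unifier (S : Sig) (Γ₁ : Ctx) (x : ℕ) (Ax : Fam) (d : ℕ × Fam) (zs : List ℕ)
    (Γ' : Ctx) (θ : Subst) : Prop :=
  CtxSubst S Γ' θ (Γ₁ ++ (x, Ax) :: openTele zs d.2.tele) ∧
  Conv (Ax.nsub θ) ((d.2.target.inst (zs.map fvar)).nsub θ) ∧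
  Conv (θ x) ((apps (.ocon d.1) (zs.map fvar)).nsub θ)

/-- `Γ' ⊢ σ : (Γ₁, x:A_x, Γ_c)` is a most general unifier of this problem. -/
def IsMGU (S : Sig) (Γ₁ : Ctx) (x : ℕ) (Ax : Fam) (d : ℕ × Fam) (zs : List ℕ)
    (Γ' : Ctx) (σ : Subst) : Prop :=
  Unifier S Γ₁ x Ax d zs Γ' σ ∧
  (∀ y, y ∉ dom Γ₁ → y ≠ x → y ∉ zs → σ y = fvar y) ∧
  ∀ Γ'' θ, Unifier S Γ₁ x Ax d zs Γ'' θ →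
    ∃ γ : Subst, CtxSubst S Γ'' γ Γ' ∧
      ∀ y ∈ dom (Γ₁ ++ (x, Ax) :: openTele zs d.2.tele), Conv (θ y) ((σ y).nsub γ)

/-- The names `zs` are a renaming apart of the binders of the type `B` from the names in `L`. -/
def FreshFor (zs : List ℕ) (B : Fam) (L : List ℕ) : Prop :=
  zs.length = B.tele.length ∧ zs.Nodup ∧ zs.Disjoint L

/-- The unification problem for `x : A_x` and the constant `d` has no solution. -/
def NotUnifiable (S : Sig) (Γ₁ : Ctx) (x : ℕ) (Ax : Fam) (d : ℕ × Fam) : Prop :=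
  ∀ zs Γ' θ, FreshFor zs d.2 (x :: dom Γ₁) → ¬ Unifier S Γ₁ x Ax d zs Γ' θ

/-! Part 4. The logic M2. -/

/-- The formula `∀all.∃ex.⊤`; the telescope `ex` lives under the binders `all`. -/
structure Formula where
  all : Tele
  ex : Tele

/-- `F[σ]`. -/
def Formula.nsub (σ : Subst) (F : Formula) : Formula where
  all := teleSub σ.toVar F.all
  ex := teleSub (upSub^[F.all.length] σ.toVar) F.ex

/-- The sequent `Γ; Δ ⊢ F`. -/
structure Sequent where
  ctx : Ctx
  hyps : List Formula
  goal : Formula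

/-- The two kinds of proof expressions: proof terms and lists of cases. -/
inductive PSort
  | term | cases

/-- The proof terms of M2 without recursion. An assumption is referred to by its position in the
list `Δ`. -/
inductive Pf : PSort → Type
  /-- `let y = h σ in P` -/
  | letApp (h : ℕ) (σ : List Obj) (P : Pf .term) : Pf .term
  /-- `split h as Γ in P`, where `xs` are the names of the variables of `Γ` -/
  | split (h : ℕ) (xs : List ℕ) (P : Pf .term) : Pf .term
  /-- `λΓ.P`, where `xs` are the names of the variables of `Γ` -/
  | intro (xs : List ℕ) (P : Pf .term) : Pf .term
  /-- `⟨σ⟩` -/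
  | ret (σ : List Obj) : Pf .term
  /-- `case x of Ω` -/
  | case (x : ℕ) (Ω : Pf .cases) : Pf .term
  /-- the empty list of cases -/
  | nil : Pf .cases
  /-- `Ω, (Γ'; Γ₂[σ] . (c zs)[σ] ↦ P)` -/
  | alt (Ω : Pf .cases) (c : ℕ) (zs : List ℕ) (Γ' : Ctx) (σ : Subst) (P : Pf .term) : Pf .cases

/-- The judgments of M2: `Γ; Δ ⊢ P ∈ F`, and `Γ₁, x:A_x, Γ₂; Δ ⊢_Σ Ω ∈ F` for a list `ds` of
constants of the signature that are still to be considered. -/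
inductive M2Judg
  | seq (P : Pf .term) (Q : Sequent)
  | cases (Γ₁ : Ctx) (x : ℕ) (Ax : Fam) (Γ₂ : Ctx) (Δ : List Formula) (ds : List (ℕ × Fam))
      (Ω : Pf .cases) (F : Formula)

/-- Derivability in M2 (without the recursion rule) over the signature `S`. -/
inductive M2 (S : Sig) : M2Judg → Prop
  | all_left {Γ : Ctx} {Δ : List Formula} {F F₁ : Formula} {h : ℕ} {σ : List Obj} {P : Pf .term} :
      Δ[h]? = some F₁ → TeleSubst S Γ σ F₁.all →
      M2 S (.seq P ⟨Γ, Δ ++ [⟨[], teleInst σ F₁.ex⟩], F⟩) →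
      M2 S (.seq (.letApp h σ P) ⟨Γ, Δ, F⟩)
  | ex_left {Γ : Ctx} {Δ : List Formula} {F : Formula} {T : Tele} {h : ℕ} {xs : List ℕ}
      {P : Pf .term} :
      Δ[h]? = some ⟨[], T⟩ → xs.length = T.length → xs.Nodup → xs.Disjoint (dom Γ) →
      M2 S (.seq P ⟨Γ ++ openTele xs T, Δ, F⟩) →
      M2 S (.seq (.split h xs P) ⟨Γ, Δ, F⟩)
  | all_right {Γ : Ctx} {Δ : List Formula} {F : Formula} {xs : List ℕ} {P : Pf .term} :
      xs.length = F.all.length → xs.Nodup → xs.Disjoint (dom Γ) →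
      M2 S (.seq P ⟨Γ ++ openTele xs F.all, Δ, ⟨[], teleInst (xs.map fvar) F.ex⟩⟩) →
      M2 S (.seq (.intro xs P) ⟨Γ, Δ, F⟩)
  | ex_right {Γ : Ctx} {Δ : List Formula} {T : Tele} {σ : List Obj} :
      TeleSubst S Γ σ T → M2 S (.seq (.ret σ) ⟨Γ, Δ, ⟨[], T⟩⟩)
  | case {Γ Γ₁ Γ₂ : Ctx} {x : ℕ} {Ax : Fam} {Δ : List Formula} {F : Formula} {Ω : Pf .cases} :
      CtxPerm S Γ (Γ₁ ++ (x, Ax) :: Γ₂) → Ax.tele = [] → (∀ y ∈ dom Γ₁, DependsOn Γ₁ Ax y) →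
      M2 S (.cases Γ₁ x Ax Γ₂ Δ S.objs Ω F) →
      M2 S (.seq (.case x Ω) ⟨Γ, Δ, F⟩)
  | sig_empty {Γ₁ Γ₂ : Ctx} {x : ℕ} {Ax : Fam} {Δ : List Formula} {F : Formula} :
      M2 S (.cases Γ₁ x Ax Γ₂ Δ [] .nil F)
  | sig_nonuni {Γ₁ Γ₂ : Ctx} {x : ℕ} {Ax : Fam} {Δ : List Formula} {F : Formula}
      {d : ℕ × Fam} {ds : List (ℕ × Fam)} {Ω : Pf .cases} :
      NotUnifiable S Γ₁ x Ax d →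
      M2 S (.cases Γ₁ x Ax Γ₂ Δ ds Ω F) →
      M2 S (.cases Γ₁ x Ax Γ₂ Δ (d :: ds) Ω F)
  | sig_uni {Γ₁ Γ₂ Γ' : Ctx} {x : ℕ} {Ax : Fam} {Δ : List Formula} {F : Formula}
      {d : ℕ × Fam} {ds : List (ℕ × Fam)} {Ω : Pf .cases} {zs : List ℕ} {σ : Subst}
      {P : Pf .term} :
      FreshFor zs d.2 (x :: dom Γ₁ ++ dom Γ₂) → IsMGU S Γ₁ x Ax d zs Γ' σ →
      (dom Γ').Disjoint (dom Γ₂) →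
      M2 S (.seq P ⟨Γ' ++ Γ₂.nsub σ, Δ.map (Formula.nsub σ), F.nsub σ⟩) →
      M2 S (.cases Γ₁ x Ax Γ₂ Δ ds Ω F) →
      M2 S (.cases Γ₁ x Ax Γ₂ Δ (d :: ds) (.alt Ω d.1 zs Γ' σ P) F)

/-- Renaming the variables in a proof along a permutation of the names. -/
def Pf.rename (π : Equiv.Perm ℕ) : {s : PSort} → Pf s → Pf s
  | _, .letApp h σ P => .letApp h (σ.map (Exp.rename π)) (P.rename π)
  | _, .split h xs P => .split h (xs.map π) (P.rename π)
  | _, .intro xs P => .intro (xs.map π) (P.rename π)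
  | _, .ret σ => .ret (σ.map (Exp.rename π))
  | _, .case x Ω => .case (π x) (Ω.rename π)
  | _, .nil => .nil
  | _, .alt Ω c zs Γ' σ P =>
      .alt (Ω.rename π) c (zs.map π) (Γ'.map fun p => (π p.1, p.2.rename π))
        (fun y => (σ (π.symm y)).rename π) (P.rename π)

/-! Part 5. Moded type families and clauses. -/

/-- A type family `a : ΠΓᴵ.ΠΓᴼ.type` with a well-defined mode, `inp = Γᴵ` and `out = Γᴼ`. -/
structure ModedFam where
  name : ℕ
  inp : Tele
  out : Tele

/-- The family is declared in the signature. -/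
def ModedFam.DeclaredIn (a : ModedFam) (S : Sig) : Prop :=
  Decl.fam a.name (kpis a.inp (kpis a.out .type)) ∈ S

/-- The formula `∀Γᴵ.∃Γᴼ.∃D:a Γᴵ Γᴼ.⊤`. -/
def ModedFam.formula (a : ModedFam) : Formula where
  all := a.inp
  ex := a.out ++ [tapps (.tcon a.name) (bvars (a.inp.length + a.out.length))]

/-- A clause `c : a M₁ … Mₙ ← a M₁₁ … M₁ₙ ← … ← a Mₘ₁ … Mₘₙ`: the constant, the telescope of the
(implicitly quantified) variables of the clause, the arguments of the head and those of the
premises `A₁, …, Aₘ`; the arguments live under the binders `vars`. -/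
structure Clause where
  con : ℕ
  vars : Tele
  head : List Obj
  prems : List (List Obj)

/-- The type `Πvars. Aₘ → ⋯ → A₁ → A` of the constant `c`. -/
def Clause.type (c : Clause) (a : ModedFam) : Fam :=
  tpis c.vars (c.prems.foldl (fun B p => arrow (tapps (.tcon a.name) p) B)
    (tapps (.tcon a.name) c.head))

/-- The names of the variables of the clause: the `j`-th variable gets the name `j`. -/
def Clause.varNames (c : Clause) : List ℕ := List.range c.vars.length

/-- The named context of all variables of the clause. -/
def Clause.ctx (c : Clause) : Ctx := openTele c.varNames c.vars

/-- The arguments of the head, over `c.ctx`. -/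
def Clause.headArgs (c : Clause) : List Obj :=
  c.head.map (Exp.inst (c.varNames.map fvar))

/-- The arguments of the premise `A_{i+1}`, over `c.ctx`. -/
def Clause.premArgs (c : Clause) (i : ℕ) : List Obj :=
  (c.prems.getD i []).map (Exp.inst (c.varNames.map fvar))

/-- The input arguments among the arguments of `a`. -/
def ModedFam.ins (a : ModedFam) (Ms : List Obj) : List Obj := Ms.take a.inp.length

/-- The output arguments among the arguments of `a`. -/
def ModedFam.outs (a : ModedFam) (Ms : List Obj) : List Obj := Ms.drop a.inp.length

/-- `a M₁ … Mₙ`. -/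
def ModedFam.atom (a : ModedFam) (Ms : List Obj) : Fam := tapps (.tcon a.name) Ms

/-- The set `X` of variables of `Γ` together with the variables that their types depend on. -/
def depClosure : Ctx → Finset ℕ → Finset ℕ
  | [], X => X
  | (x, A) :: Γ, X => if x ∈ depClosure Γ X then depClosure Γ X ∪ A.fv else depClosure Γ X

/-- `c` is a clause for `a` in `S`: the constant is declared with the type of the clause, in
canonical form, and the variables of the clause are those that occur in the head or in a premise,
together with those that their types depend on. -/
structure Clause.IsClauseFor (c : Clause) (a : ModedFam) (S : Sig) : Prop where
  declared : Decl.obj c.con (c.type a) ∈ S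
  canonical : Canon S .canonical [] (c.type a) .base
  vars_occur : ∀ x ∈ c.varNames, x ∈ depClosure c.ctx
    (fvs (c.headArgs ++ (List.range c.prems.length).flatMap c.premArgs))

/-! Part 6. Mode consistency. -/

/-- The head of the object is a free variable. -/
def freeHead : {k : Cat} → Exp k → Prop
  | _, .var (.f _) => True
  | _, .app M _ => freeHead M
  | _, _ => False

/-- The free variable `x` has a strict occurrence in `e`: one that is not in an argument of a free
variable and whose arguments are distinct bound variables (up to η-expansion). -/
inductive Strict (x : ℕ) : {k : Cat} → Exp k → Prop
  | occ {Ns : List Obj} {is : List ℕ} : is.Nodup →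
      List.Forall₂ (fun N i => Conv N (bvar i)) Ns is → Strict x (apps (fvar x) Ns)
  | fun_ {M N : Obj} : ¬ freeHead M → Strict x M → Strict x (Exp.app M N)
  | arg {M N : Obj} : ¬ freeHead M → Strict x N → Strict x (Exp.app M N)
  | dom {A : Fam} {M : Obj} : Strict x A → Strict x (Exp.lam A M)
  | body {A : Fam} {M : Obj} : Strict x M → Strict x (Exp.lam A M)
  | tfun {A : Fam} {M : Obj} : Strict x A → Strict x (Exp.tapp A M)
  | targ {A : Fam} {M : Obj} : Strict x M → Strict x (Exp.tapp A M)
  | tdom {A B : Fam} : Strict x A → Strict x (Exp.tpi A B)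
  | tcod {A B : Fam} : Strict x B → Strict x (Exp.tpi A B)

/-- The variables of the contexts `Γ₀, Γ₁, …` of mode checking: the input variables with a strict
occurrence in the head, and successively the output variables with a strict occurrence in the
premise `A_{i+1}`. -/
def Clause.modeVars (c : Clause) (a : ModedFam) : ℕ → Set ℕ
  | 0 => {x | x ∈ fvs (a.ins c.headArgs) ∧ Strict x (a.atom c.headArgs)}
  | i + 1 => c.modeVars a i ∪
      {x | x ∈ fvs (a.outs (c.premArgs i)) ∧ Strict x (a.atom (c.premArgs i))}

/-- The clause is mode consistent: every premise is input consistent relative to the variables known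
before it, and the head is output consistent relative to the variables known in the end. -/
def Clause.ModeConsistent (c : Clause) (a : ModedFam) : Prop :=
  (∀ i < c.prems.length, ∀ x ∈ fvs (a.ins (c.premArgs i)), x ∈ c.modeVars a i) ∧
  ∀ x ∈ fvs (a.outs c.headArgs), x ∈ c.modeVars a c.prems.length

/-! Part 7. Input coverage patterns and the sequents related to them. -/

/-- An input coverage goal or pattern `Γ ⊢ A : Πout.type`. -/
structure InGoal where
  ctx : Ctx
  fam : Fam
  out : Tele

/-- The context of the variables of the clause that occur in the input arguments of the head
(with those that their types depend on). -/
def Clause.inCtx (c : Clause) (a : ModedFam) : Ctx :=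
  c.ctx.filter fun p => p.1 ∈ depClosure c.ctx (fvs (a.ins c.headArgs))

/-- The input coverage pattern `Γᴵ_c ⊢ a σᴵ_c : ΠΓᴼ[σᴵ_c].type` derived from the clause. -/
def Clause.inputPattern (c : Clause) (a : ModedFam) : InGoal where
  ctx := c.inCtx a
  fam := a.atom (a.ins c.headArgs)
  out := teleInst (a.ins c.headArgs) a.out

/-- The relation between an input coverage goal `Γ ⊢ A : ΠΓᴼ.type` and the sequent
`Γ; IH ⊢ ∃Γᴼ.∃D:A Γᴼ.⊤`, where `IH` is the formula of the family `a`. -/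
def InRelated (a : ModedFam) (G : InGoal) (Q : Sequent) : Prop :=
  Q.ctx = G.ctx ∧ Q.hyps = [a.formula] ∧
    Q.goal = ⟨[], G.out ++ [tapps (G.fam.lift G.out.length) (bvars G.out.length)]⟩

/-! Part 8. Output coverage checking. -/

/-- The output coverage goal `Γ ⊢ A : type` is immediately covered by the output coverage pattern
`pΓ ⊢ pA : type`: the permutation `ρ` of the names renames the variables of the goal bijectively to
those of the pattern, respects their types, turns `A` into `pA`, and fixes the names in `I`. -/
def ImmCovered (S : Sig) (I : Finset ℕ) (pΓ : Ctx) (pA : Fam) (Γ : Ctx) (A : Fam)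
    (ρ : Equiv.Perm ℕ) : Prop :=
  (∀ y ∈ I, ρ y = y) ∧ ((dom Γ).map ρ).Perm (dom pΓ) ∧
    CtxSubst S pΓ (fun y => fvar (ρ y)) Γ ∧ Conv pA (A.rename ρ)

/-- What output coverage checking works on: a goal `Γ ⊢ A : type`, or the goal
`Γ₁, x:A_x, Γ₂ ⊢ A : type` that is being split on `x`, with the constants still to be considered. -/
inductive CovJudg
  | goal (Γ : Ctx) (A : Fam)
  | splitting (Γ₁ : Ctx) (x : ℕ) (Ax : Fam) (Γ₂ : Ctx) (A : Fam) (ds : List (ℕ × Fam))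

/-- The successful runs of output coverage checking with the pattern `pΓ ⊢ pA : type`. The set `I`
consists of the names of the input variables and of a reserved name. A goal is immediately covered,
or it is split on an output variable `x` of atomic type `A_x`: each constant `c : ΠΓ_c.A_c` of the
signature either does not unify with `x : A_x`, or there is a most general unifier that instantiates
no variable of the goal other than `x`; the corresponding subgoals have to be covered. -/
inductive OutCover (S : Sig) (I : Finset ℕ) (pΓ : Ctx) (pA : Fam) : CovJudg → Type
  | done {Γ : Ctx} {A : Fam} (ρ : Equiv.Perm ℕ) (h : ImmCovered S I pΓ pA Γ A ρ) :
      OutCover S I pΓ pA (.goal Γ A)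
  | split {Γ : Ctx} {A : Fam} (Γ₁ : Ctx) (x : ℕ) (Ax : Fam) (Γ₂ : Ctx)
      (perm : CtxPerm S Γ (Γ₁ ++ (x, Ax) :: Γ₂)) (output : x ∉ I) (atomic : Ax.tele = [])
      (dep : ∀ y ∈ dom Γ₁, DependsOn Γ₁ Ax y)
      (sub : OutCover S I pΓ pA (.splitting Γ₁ x Ax Γ₂ A S.objs)) :
      OutCover S I pΓ pA (.goal Γ A)
  | nil {Γ₁ : Ctx} {x : ℕ} {Ax : Fam} {Γ₂ : Ctx} {A : Fam} :
      OutCover S I pΓ pA (.splitting Γ₁ x Ax Γ₂ A [])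
  | skip {Γ₁ : Ctx} {x : ℕ} {Ax : Fam} {Γ₂ : Ctx} {A : Fam} {ds : List (ℕ × Fam)}
      (d : ℕ × Fam) (clash : NotUnifiable S Γ₁ x Ax d)
      (rest : OutCover S I pΓ pA (.splitting Γ₁ x Ax Γ₂ A ds)) :
      OutCover S I pΓ pA (.splitting Γ₁ x Ax Γ₂ A (d :: ds))
  | branch {Γ₁ : Ctx} {x : ℕ} {Ax : Fam} {Γ₂ : Ctx} {A : Fam} {ds : List (ℕ × Fam)}
      (d : ℕ × Fam) (zs : List ℕ) (Γc : Ctx) (σ : Subst)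
      (fresh : FreshFor zs d.2 (x :: dom Γ₁ ++ dom Γ₂ ++ I.toList))
      (freshc : (dom Γc).Disjoint (dom Γ₂ ++ I.toList))
      (mgu : IsMGU S Γ₁ x Ax d zs (Γ₁ ++ Γc) σ) (id_on : ∀ y ∈ dom Γ₁, σ y = fvar y)
      (sub : OutCover S I pΓ pA (.goal (Γ₁ ++ Γc ++ Γ₂.nsub σ) (A.nsub σ)))
      (rest : OutCover S I pΓ pA (.splitting Γ₁ x Ax Γ₂ A ds)) :
      OutCover S I pΓ pA (.splitting Γ₁ x Ax Γ₂ A (d :: ds))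

/-- The name of the variable `D_{i+1}`, which stands for a derivation of the premise `A_{i+1}`. -/
def Clause.derivName (c : Clause) (i : ℕ) : ℕ := c.vars.length + i

/-- The names that the variables of `Γᴼ` get when the inductive hypothesis is applied. -/
def Clause.outNames (c : Clause) (a : ModedFam) : List ℕ :=
  (List.range a.out.length).map fun j => c.vars.length + c.prems.length + j

/-- The context of the variables that occur in the output arguments of the premise `A_{i+1}` (with
those that their types depend on) and are not in `Γ`. -/
def Clause.newCtx (c : Clause) (a : ModedFam) (i : ℕ) (Γ : Ctx) : Ctx :=
  c.ctx.filter fun p => p.1 ∈ depClosure c.ctx (fvs (a.outs (c.premArgs i))) ∧ p.1 ∉ dom Γ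

/-- The contexts `Γ_{c_0}, …, Γ_{c_m}`: first the input variables of the head, then successively
the output variables of a premise `A_{i+1}` and the variable `D_{i+1} : A_{i+1}`. -/
def Clause.stepCtx (c : Clause) (a : ModedFam) : ℕ → Ctx
  | 0 => c.inCtx a
  | i + 1 => c.stepCtx a i ++ c.newCtx a i (c.stepCtx a i) ++
      [(c.derivName i, a.atom (c.premArgs i))]

/-- A successful run of output coverage checking for the premise `A_{i+1}`: the pattern is
`Γ_{c_i}, Γᴼ_{i+1} ⊢ A_{i+1} : type` and the goal is
`Γ_{c_i}, Γᴼ[σᴵ_{i+1}] ⊢ a σᴵ_{i+1} Γᴼ : type`. -/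
def Clause.PremCover (c : Clause) (a : ModedFam) (S : Sig) (i : ℕ) : Type :=
  OutCover S (insert (c.derivName i) (dom (c.stepCtx a i)).toFinset)
    (c.stepCtx a i ++ c.newCtx a i (c.stepCtx a i)) (a.atom (c.premArgs i))
    (.goal (c.stepCtx a i ++ openTele (c.outNames a) (teleInst (a.ins (c.premArgs i)) a.out))
      (a.atom (a.ins (c.premArgs i) ++ (c.outNames a).map fvar)))

/-- Output coverage checking succeeds for every premise of the clause. -/
def Clause.OutputCoverage (c : Clause) (a : ModedFam) (S : Sig) : Type :=
  (i : Fin c.prems.length) → c.PremCover a S i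

/-! Part 9. The translation of clauses into proofs. -/

/-- The sort of proof expressions that a judgment of output coverage checking is translated to. -/
def CovJudg.sort : CovJudg → PSort
  | .goal _ _ => .term
  | .splitting _ _ _ _ _ _ => .cases

/-- The translation of a run of output coverage checking: a splitting becomes a case analysis, and an
immediately covered subgoal gets the renamed proof `P`. -/
def OutCover.toPf {S : Sig} {I : Finset ℕ} {pΓ : Ctx} {pA : Fam} (P : Pf .term) :
    {J : CovJudg} → OutCover S I pΓ pA J → Pf J.sort
  | _, .done ρ _ => P.rename ρ.symm
  | _, .split _ x _ _ _ _ _ _ sub => .case x (sub.toPf P)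
  | _, .nil => .nil
  | _, .skip _ _ rest => rest.toPf P
  | _, .branch (Γ₁ := Γ₁) d zs Γc σ _ _ _ _ sub rest =>
      .alt (rest.toPf P) d.1 zs (Γ₁ ++ Γc) σ (sub.toPf P)

/-- The base step: the outputs of the head, and `c x₁ … x_N D_m … D₁` for the variable `D`. -/
def Clause.baseStep (c : Clause) (a : ModedFam) : Pf .term :=
  .ret (a.outs c.headArgs ++ [apps (.ocon c.con) (c.varNames.map fvar ++
    ((List.range c.prems.length).map fun i => fvar (c.derivName i)).reverse)])

/-- The proof generated after `i` of the premises, where `j` premises are left: an application of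
the inductive hypothesis (assumption `0`) to the inputs of the next premise, the introduction of its
outputs and derivation, the translated output coverage checking, and the proof for the rest. -/
def Clause.steps (c : Clause) (a : ModedFam) {S : Sig} (cov : c.OutputCoverage a S) :
    (j i : ℕ) → i + j = c.prems.length → Pf .term
  | 0, _, _ => c.baseStep a
  | j + 1, i, h =>
      .letApp 0 (a.ins (c.premArgs i)) (.split (i + 1) (c.outNames a ++ [c.derivName i])
        ((cov ⟨i, by omega⟩ : c.PremCover a S i).toPf (c.steps a cov j (i + 1) (by omega))))

/-- The proof that the algorithm generates from the clause and from successful runs of output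
coverage checking for its premises. -/
def Clause.translate (c : Clause) (a : ModedFam) {S : Sig} (cov : c.OutputCoverage a S) :
    Pf .term :=
  c.steps a cov c.prems.length 0 (Nat.zero_add _)

end TwelfM2

open TwelfM2

namespace TwelfM2

/-! Substitution calculus. -/

/-! The proof term is checked by induction on the number of premises still to be treated, over the
contexts Γ_{c_i} = `c.stepCtx a i`. The invariant `Clause.StepOk` says that Γ_{c_i} is valid, agrees
with the context of the clause on shared names, and declares every variable that mode checking
regards as known after i premises. Mode consistency and strengthening then type the inputs of the
next premise over Γ_{c_i}, so ∀L applies, and ∃L leaves the context of the output coverage goal,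
extended by the variable D for a derivation. After the last premise all clause variables are
declared and each D_i has literally the type A_i, so c Γ_v D_m … D_1 inhabits the head
(`Clause.baseStep_valid`).

The core is `OutCover.toPf_derives`: a run of output coverage checking, read as nested case
analyses, reduces the sequent of the goal to the sequent of the pattern. A unifier used in an output
splitting moves neither the input variables nor D. The assumptions and the goal formula depend on
input variables only (`Formula.FixedBy`), so they survive unchanged; only the type of D is
instantiated, exactly as the coverage goal is. At an immediately covered leaf, the proof for the
pattern fits up to a renaming of variables and a permutation of the context with types up to
conversion. Hence derivability in M2 has to be invariant under both: `M2.rename` transports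
unification problems and their most general unifiers along a permutation of the names, and
`M2.ctxInvariant` exchanges the context.

Underneath lies the metatheory of LF: substitution, inversion, regularity and strengthening. It
needs neither confluence nor normalization. Families and kinds contain no redexes at the top, so
injectivity of products is a direct induction on conversion (`Conv.sameShape`), and uniqueness of
classifiers is needed only for families. -/

theorem Var.shift_cases (v : Var) : v = .b 0 ∨ ∃ w : Var, v = w.shift 1 := by
  rcases v with (_ | i) | x
  · exact Or.inl rfl
  · exact Or.inr ⟨.b i, rfl⟩
  · exact Or.inr ⟨.f x, rfl⟩

@[simp] theorem Var.up_shift (r : Var → Var) (v : Var) : Var.up r (v.shift 1) = (r v).shift 1 := by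
  cases v <;> rfl

@[simp] theorem upSub_zero (θ : Var → Obj) : upSub θ (.b 0) = bvar 0 := rfl

@[simp] theorem upSub_shift (θ : Var → Obj) (v : Var) : upSub θ (v.shift 1) = (θ v).lift 1 := by
  cases v <;> rfl

/-- The extensionality principle behind the composition laws for operations under a binder: they are
checked on index 0 and on shifted variables, where `Var.up` and `upSub` compute. -/
theorem Var.funext_shift {α : Sort*} {g g' : Var → α} (h0 : g (.b 0) = g' (.b 0))
    (h1 : ∀ v : Var, g (v.shift 1) = g' (v.shift 1)) : g = g' := by
  funext v
  rcases v.shift_cases with rfl | ⟨w, rfl⟩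
  · exact h0
  · exact h1 w

theorem Var.up_comp (r s : Var → Var) : Var.up r ∘ Var.up s = Var.up (r ∘ s) :=
  Var.funext_shift rfl fun v => by simp

theorem Exp.ren_ren {k : Cat} (e : Exp k) (r s : Var → Var) :
    (e.ren s).ren r = e.ren (r ∘ s) := by
  induction e generalizing r s <;> simp_all [Exp.ren, Var.up_comp]

theorem upSub_comp_up (θ : Var → Obj) (r : Var → Var) : upSub θ ∘ Var.up r = upSub (θ ∘ r) :=
  Var.funext_shift rfl fun v => by simp

theorem Exp.sub_ren {k : Cat} (e : Exp k) (θ : Var → Obj) (r : Var → Var) :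
    (e.ren r).sub θ = e.sub (θ ∘ r) := by
  induction e generalizing r θ <;> simp_all [Exp.ren, Exp.sub, upSub_comp_up]

theorem Exp.lift_ren_up {k : Cat} (e : Exp k) (r : Var → Var) :
    (e.lift 1).ren (Var.up r) = (e.ren r).lift 1 := by
  simp only [Exp.lift, Exp.ren_ren]
  congr 1
  funext v
  simp

theorem upSub_ren (θ : Var → Obj) (r : Var → Var) :
    (fun v => (upSub θ v).ren (Var.up r)) = upSub (fun v => (θ v).ren r) :=
  Var.funext_shift rfl fun v => by simp [Exp.lift_ren_up]

theorem Exp.ren_sub {k : Cat} (e : Exp k) (θ : Var → Obj) (r : Var → Var) :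
    (e.sub θ).ren r = e.sub (fun v => (θ v).ren r) := by
  induction e generalizing r θ <;> simp_all [Exp.ren, Exp.sub, ← upSub_ren]

theorem Exp.lift_sub_upSub {k : Cat} (e : Exp k) (θ : Var → Obj) :
    (e.lift 1).sub (upSub θ) = (e.sub θ).lift 1 := by
  simp only [Exp.lift, Exp.sub_ren, Exp.ren_sub]
  congr 1
  funext v
  simp [Exp.lift]

theorem upSub_sub (θ η : Var → Obj) :
    (fun v => (upSub θ v).sub (upSub η)) = upSub (fun v => (θ v).sub η) :=
  Var.funext_shift rfl fun v => by simp [Exp.lift_sub_upSub]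

/-- Last of four composition laws. Under a binder, substitution lifts its values by a renaming, so
the law for two substitutions presupposes the mixed laws, and these presuppose the law for two
renamings. -/
theorem Exp.sub_sub {k : Cat} (e : Exp k) (θ η : Var → Obj) :
    (e.sub θ).sub η = e.sub (fun v => (θ v).sub η) := by
  induction e generalizing η θ <;> simp_all [Exp.sub, ← upSub_sub]

theorem upSub_var (r : Var → Var) : upSub (fun v => .var (r v)) = fun v => .var (Var.up r v) :=
  Var.funext_shift rfl fun v => by simp [Exp.lift, Exp.ren]

theorem Exp.ren_eq_sub {k : Cat} (e : Exp k) (r : Var → Var) :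
    e.ren r = e.sub (fun v => .var (r v)) := by
  induction e generalizing r <;> simp_all [Exp.ren, Exp.sub, upSub_var]

theorem upSub_id : upSub (fun v => .var v) = fun v => .var v :=
  Var.funext_shift rfl fun v => by simp [Exp.lift, Exp.ren]

@[simp] theorem Exp.sub_id {k : Cat} (e : Exp k) : e.sub (fun v => .var v) = e := by
  induction e <;> simp_all [Exp.sub, upSub_id]

theorem Var.shift_shift (n m : ℕ) (v : Var) : (v.shift m).shift n = v.shift (m + n) := by
  cases v <;> simp [Var.shift, Nat.add_assoc]

@[simp] theorem Exp.lift_lift {k : Cat} (e : Exp k) (n m : ℕ) :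
    (e.lift m).lift n = e.lift (m + n) := by
  simp only [Exp.lift, Exp.ren_ren]
  congr 1
  funext v
  simp [Var.shift_shift]

@[simp] theorem Exp.lift_zero {k : Cat} (e : Exp k) : e.lift 0 = e := by
  have : Var.shift 0 = fun v => v := by funext v; cases v <;> rfl
  rw [Exp.lift, Exp.ren_eq_sub, this, Exp.sub_id]

@[simp] theorem upSub_iterate_lt (θ : Var → Obj) {n i : ℕ} (h : i < n) :
    upSub^[n] θ (.b i) = bvar i := by
  induction n generalizing i with
  | zero => omega
  | succ n ih =>
    rw [Function.iterate_succ_apply']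
    cases i with
    | zero => rfl
    | succ i => simp [upSub, ih (Nat.lt_of_succ_lt_succ h), Exp.lift, Exp.ren, Var.shift]

@[simp] theorem upSub_iterate_shift (θ : Var → Obj) (n : ℕ) (v : Var) :
    upSub^[n] θ (v.shift n) = (θ v).lift n := by
  induction n with
  | zero => cases v <;> simp [Var.shift]
  | succ n ih =>
    rw [Function.iterate_succ_apply', ← Var.shift_shift, upSub_shift, ih, Exp.lift_lift]

theorem Var.lt_or_shift (n : ℕ) (v : Var) : (∃ i < n, v = .b i) ∨ ∃ w : Var, v = w.shift n := by
  rcases v with i | x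
  · rcases Nat.lt_or_ge i n with h | h
    · exact Or.inl ⟨i, h, rfl⟩
    · exact Or.inr ⟨.b (i - n), by simp [Var.shift, Nat.sub_add_cancel h]⟩
  · exact Or.inr ⟨.f x, rfl⟩

theorem Var.funext_iterate {α : Sort*} {g g' : Var → α} (n : ℕ) (h0 : ∀ i < n, g (.b i) = g' (.b i))
    (h1 : ∀ v : Var, g (v.shift n) = g' (v.shift n)) : g = g' := by
  funext v
  rcases v.lt_or_shift n with ⟨i, hi, rfl⟩ | ⟨w, rfl⟩
  · exact h0 i hi
  · exact h1 w

theorem env_lt (Ms : List Obj) {i : ℕ} (h : i < Ms.length) :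
    env Ms (.b i) = Ms[Ms.length - 1 - i] := by
  simp [env, h]

theorem env_shift (Ms : List Obj) (v : Var) : env Ms (v.shift Ms.length) = .var v := by
  cases v <;> simp [env, Var.shift]

@[simp] theorem Exp.lift_inst {k : Cat} (e : Exp k) (Ms : List Obj) :
    (e.lift Ms.length).inst Ms = e := by
  have : env Ms ∘ Var.shift Ms.length = fun v => .var v := by
    funext v; exact env_shift Ms v
  rw [Exp.lift, Exp.inst, Exp.sub_ren, this, Exp.sub_id]

/-- Substitution commutes with instantiation. -/
theorem Exp.inst_sub {k : Cat} (e : Exp k) (Ms : List Obj) (θ : Var → Obj) :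
    (e.inst Ms).sub θ = (e.sub (upSub^[Ms.length] θ)).inst (Ms.map (Exp.sub θ)) := by
  simp only [Exp.inst, Exp.sub_sub]
  congr 1
  refine Var.funext_iterate Ms.length (fun i hi => ?_) fun v => ?_
  · have hi' : i < (Ms.map (Exp.sub θ)).length := by simpa using hi
    simp only [env_lt _ hi, upSub_iterate_lt _ hi, Exp.sub, env_lt _ hi']
    simp
  · have := Exp.lift_inst (θ v) (Ms.map (Exp.sub θ))
    rw [List.length_map] at this
    simp only [env_shift, upSub_iterate_shift]
    exact this.symm

theorem Exp.inst_one_sub {k : Cat} (e : Exp k) (M : Obj) (θ : Var → Obj) :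
    (e.inst [M]).sub θ = (e.sub (upSub θ)).inst [M.sub θ] :=
  e.inst_sub [M] θ

/-- Instantiating an outer variable first and the inner ones afterwards. -/
theorem Exp.inst_append {k : Cat} (e : Exp k) (Ms Ns : List Obj) :
    (e.sub (upSub^[Ns.length] (env Ms))).inst Ns = e.inst (Ms ++ Ns) := by
  simp only [Exp.inst, Exp.sub_sub]
  congr 1
  refine Var.funext_iterate Ns.length (fun i hi => ?_) fun v => ?_
  · simp only [upSub_iterate_lt _ hi, Exp.sub]
    simp [env, List.getElem?_append_left, hi]
  · simp only [upSub_iterate_shift]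
    refine (Exp.lift_inst _ _).trans ?_
    cases v with
    | f x => rfl
    | b i =>
      simp only [env, Var.shift, List.reverse_append, List.length_append]
      rw [List.getElem?_append_right (by simp)]
      simp only [List.length_reverse, Nat.add_sub_cancel]
      congr 2
      omega

theorem Exp.inst_nil {k : Cat} (e : Exp k) : e.inst [] = e := by
  simpa using e.lift_inst []

theorem toVar_upSub_b (σ : Subst) (n i : ℕ) : upSub^[n] σ.toVar (.b i) = bvar i := by
  rcases Nat.lt_or_ge i n with h | h
  · exact upSub_iterate_lt _ h
  · have := upSub_iterate_shift σ.toVar n (.b (i - n))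
    simpa [Var.shift, Nat.sub_add_cancel h, Subst.toVar, Exp.lift, Exp.ren] using this

/-! Telescopes. -/

@[simp] theorem teleSub_length (θ : Var → Obj) (T : Tele) : (teleSub θ T).length = T.length := by
  induction T generalizing θ <;> simp_all [teleSub]

@[simp] theorem teleInst_length (Ms : List Obj) (T : Tele) :
    (teleInst Ms T).length = T.length := teleSub_length _ _

theorem teleSub_append (θ : Var → Obj) (T U : Tele) :
    teleSub θ (T ++ U) = teleSub θ T ++ teleSub (upSub^[T.length] θ) U := by
  induction T generalizing θ with
  | nil => rfl
  | cons A T ih => simp [teleSub, ih]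

theorem teleSub_teleSub (θ η : Var → Obj) (T : Tele) :
    teleSub η (teleSub θ T) = teleSub (fun v => (θ v).sub η) T := by
  induction T generalizing θ η with
  | nil => rfl
  | cons A T ih => simp [teleSub, Exp.sub_sub, ih, upSub_sub]

/-- `Exp.inst_sub` read off at a single variable. Telescopes need this pointwise form, because their
entries apply the same substitution under different numbers of binders. -/
theorem env_sub (Ms : List Obj) (θ : Var → Obj) :
    (fun v => (env Ms v).sub θ) =
      fun v => (upSub^[Ms.length] θ v).sub (env (Ms.map (Exp.sub θ))) := by
  funext v
  simpa [Exp.inst, Exp.sub_sub, Exp.sub] using (Exp.var v).inst_sub Ms θ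

theorem teleInst_teleSub (Ms : List Obj) (θ : Var → Obj) (T : Tele) :
    teleSub θ (teleInst Ms T) =
      teleInst (Ms.map (Exp.sub θ)) (teleSub (upSub^[Ms.length] θ) T) := by
  simp only [teleInst, teleSub_teleSub, env_sub]

theorem env_append (Ms Ns : List Obj) :
    (fun v => (upSub^[Ns.length] (env Ms) v).sub (env Ns)) = env (Ms ++ Ns) := by
  funext v
  simpa [Exp.inst, Exp.sub_sub, Exp.sub] using (Exp.var v).inst_append Ms Ns

theorem teleInst_append_inst (Ms Ns : List Obj) (T : Tele) :
    teleInst Ns (teleSub (upSub^[Ns.length] (env Ms)) T) = teleInst (Ms ++ Ns) T := by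
  simp only [teleInst, teleSub_teleSub, env_append]

theorem kpis_sub (θ : Var → Obj) (T : Tele) (K : Kind) :
    (kpis T K).sub θ = kpis (teleSub θ T) (K.sub (upSub^[T.length] θ)) := by
  induction T generalizing θ with
  | nil => rfl
  | cons A T ih => simp_all [kpis, teleSub, Exp.sub]

theorem tpis_sub (θ : Var → Obj) (T : Tele) (B : Fam) :
    (tpis T B).sub θ = tpis (teleSub θ T) (B.sub (upSub^[T.length] θ)) := by
  induction T generalizing θ with
  | nil => rfl
  | cons A T ih => simp_all [tpis, teleSub, Exp.sub]

theorem tapps_sub (θ : Var → Obj) (A : Fam) (Ms : List Obj) :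
    (tapps A Ms).sub θ = tapps (A.sub θ) (Ms.map (Exp.sub θ)) := by
  induction Ms generalizing A with
  | nil => rfl
  | cons M Ms ih => simpa [tapps, Exp.sub] using ih (A.tapp M)

theorem apps_sub (θ : Var → Obj) (M : Obj) (Ms : List Obj) :
    (apps M Ms).sub θ = apps (M.sub θ) (Ms.map (Exp.sub θ)) := by
  induction Ms generalizing M with
  | nil => rfl
  | cons N Ms ih => simpa [apps, Exp.sub] using ih (M.app N)

theorem tapps_append (A : Fam) (Ms Ns : List Obj) : tapps A (Ms ++ Ns) = tapps (tapps A Ms) Ns :=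
  List.foldl_append

theorem apps_append (A : Obj) (Ms Ns : List Obj) : apps A (Ms ++ Ns) = apps (apps A Ms) Ns :=
  List.foldl_append

theorem bvars_inst (Ms : List Obj) : (bvars Ms.length).map (Exp.inst Ms) = Ms := by
  refine List.ext_getElem (by simp [bvars]) fun i h1 h2 => ?_
  have h3 : i < Ms.length := h2
  simp only [bvars, List.map_reverse, List.getElem_map, List.getElem_reverse, List.getElem_range,
    List.length_map, List.length_range, Exp.inst, Exp.sub]
  rw [env_lt _ (by omega)]
  congr 1
  omega

theorem dom_openTele (xs : List ℕ) (T : Tele) (h : xs.length = T.length) :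
    dom (openTele xs T) = xs := by
  induction xs generalizing T with
  | nil => cases T <;> simp_all [openTele, dom]
  | cons x xs ih =>
    cases T with
    | nil => simp at h
    | cons A T => simpa [openTele, dom] using ih (teleInst [fvar x] T) (by simpa using h)

@[simp] theorem teleInst_nil (T : Tele) : teleInst [] T = T := by
  have : env [] = fun v => .var v := by funext v; cases v <;> simp [env]
  rw [teleInst, this]
  clear this
  induction T with
  | nil => rfl
  | cons A T ih => simp [teleSub, upSub_id, ih]

theorem openTele_append (xs ys : List ℕ) (T U : Tele) (h : xs.length = T.length) :
    openTele (xs ++ ys) (T ++ U) = openTele xs T ++ openTele ys (teleInst (xs.map fvar) U) := by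
  induction xs generalizing T U with
  | nil =>
    cases T with
    | nil => simp [openTele]
    | cons A T => simp at h
  | cons x xs ih =>
    cases T with
    | nil => simp at h
    | cons A T =>
      have h' : xs.length = T.length := by simpa using h
      -- Naming the first variable and then the others instantiates `U` twice; both instantiations
      -- merge into one.
      have := teleInst_append_inst [fvar x] (xs.map fvar) U
      simp only [List.length_map, h'] at this
      simp only [List.cons_append, openTele, List.map_cons, List.cons.injEq, true_and]
      rw [teleInst, teleSub_append]
      refine (ih _ _ (by simpa using h')).trans ?_
      simp only [teleInst] at this ⊢
      rw [this]
      rfl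

/-! Free variables and loose bound variables. -/

/-- All loose bound variables of the expression have an index less than `n`. -/
def Exp.lc : {k : Cat} → ℕ → Exp k → Prop
  | _, _, .type => True
  | _, n, .kpi A K => A.lc n ∧ K.lc (n + 1)
  | _, _, .tcon _ => True
  | _, n, .tpi A B => A.lc n ∧ B.lc (n + 1)
  | _, n, .tapp A M => A.lc n ∧ M.lc n
  | _, _, .ocon _ => True
  | _, n, .var (.b i) => i < n
  | _, _, .var (.f _) => True
  | _, n, .lam A M => A.lc n ∧ M.lc (n + 1)
  | _, n, .app M N => M.lc n ∧ N.lc n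

theorem upSub_congr {θ θ' : Var → Obj} {n : ℕ} {X : Finset ℕ}
    (hb : ∀ i < n, θ (.b i) = θ' (.b i)) (hf : ∀ x ∈ X, θ (.f x) = θ' (.f x)) :
    (∀ i < n + 1, upSub θ (.b i) = upSub θ' (.b i)) ∧
      ∀ x ∈ X, upSub θ (.f x) = upSub θ' (.f x) := by
  constructor
  · intro i hi
    cases i with
    | zero => rfl
    | succ i => simp [upSub, hb i (by omega)]
  · intro x hx
    simp [upSub, hf x hx]

/-- Only the values at variables that can actually occur matter: loose indices below the bound and
the free names. -/
theorem Exp.sub_congr {k : Cat} {e : Exp k} {θ θ' : Var → Obj} {n : ℕ} (he : e.lc n)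
    (hb : ∀ i < n, θ (.b i) = θ' (.b i)) (hf : ∀ x ∈ e.fv, θ (.f x) = θ' (.f x)) :
    e.sub θ = e.sub θ' := by
  induction e generalizing n θ θ' with
  | type => rfl
  | tcon => rfl
  | ocon => rfl
  | var v =>
    cases v with
    | b i => exact hb i he
    | f x => exact hf x (by simp [Exp.fv])
  | tapp A M ihA ihM =>
    simp only [Exp.fv, Finset.mem_union] at hf
    simp only [Exp.sub]
    rw [ihA he.1 hb fun x hx => hf x (Or.inl hx), ihM he.2 hb fun x hx => hf x (Or.inr hx)]
  | app A M ihA ihM =>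
    simp only [Exp.fv, Finset.mem_union] at hf
    simp only [Exp.sub]
    rw [ihA he.1 hb fun x hx => hf x (Or.inl hx), ihM he.2 hb fun x hx => hf x (Or.inr hx)]
  | kpi A K ihA ihK =>
    simp only [Exp.fv, Finset.mem_union] at hf
    have h := upSub_congr hb fun x hx => hf x (Or.inr hx)
    simp only [Exp.sub]
    rw [ihA he.1 hb fun x hx => hf x (Or.inl hx), ihK he.2 h.1 h.2]
  | tpi A K ihA ihK =>
    simp only [Exp.fv, Finset.mem_union] at hf
    have h := upSub_congr hb fun x hx => hf x (Or.inr hx)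
    simp only [Exp.sub]
    rw [ihA he.1 hb fun x hx => hf x (Or.inl hx), ihK he.2 h.1 h.2]
  | lam A K ihA ihK =>
    simp only [Exp.fv, Finset.mem_union] at hf
    have h := upSub_congr hb fun x hx => hf x (Or.inr hx)
    simp only [Exp.sub]
    rw [ihA he.1 hb fun x hx => hf x (Or.inl hx), ihK he.2 h.1 h.2]

theorem Exp.sub_eq_self {k : Cat} {e : Exp k} {θ : Var → Obj} {n : ℕ} (he : e.lc n)
    (hb : ∀ i < n, θ (.b i) = bvar i) (hf : ∀ x ∈ e.fv, θ (.f x) = fvar x) : e.sub θ = e := by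
  have := Exp.sub_congr (θ' := fun v => .var v) he hb hf
  rwa [Exp.sub_id] at this

theorem Exp.lc.mono {k : Cat} {e : Exp k} {n m : ℕ} (h : e.lc n) (hnm : n ≤ m) : e.lc m := by
  induction e generalizing n m with
  | type => trivial
  | tcon => trivial
  | ocon => trivial
  | var v =>
    cases v with
    | b i => exact lt_of_lt_of_le h hnm
    | f x => trivial
  | tapp A M ihA ihM => exact ⟨ihA h.1 hnm, ihM h.2 hnm⟩
  | app A M ihA ihM => exact ⟨ihA h.1 hnm, ihM h.2 hnm⟩
  | kpi A K ihA ihK => exact ⟨ihA h.1 hnm, ihK h.2 (by omega)⟩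
  | tpi A K ihA ihK => exact ⟨ihA h.1 hnm, ihK h.2 (by omega)⟩
  | lam A K ihA ihK => exact ⟨ihA h.1 hnm, ihK h.2 (by omega)⟩

/-- Makes the congruence lemma applicable to arbitrary raw expressions when the substitution fixes
all indices anyway. -/
theorem Exp.exists_lc {k : Cat} (e : Exp k) : ∃ n, e.lc n := by
  induction e with
  | type => exact ⟨0, trivial⟩
  | tcon => exact ⟨0, trivial⟩
  | ocon => exact ⟨0, trivial⟩
  | var v =>
    cases v with
    | b i => exact ⟨i + 1, Nat.lt_succ_self i⟩
    | f x => exact ⟨0, trivial⟩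
  | tapp A M ihA ihM | app A M ihA ihM =>
    obtain ⟨n, hn⟩ := ihA
    obtain ⟨m, hm⟩ := ihM
    exact ⟨max n m, hn.mono (le_max_left _ _), hm.mono (le_max_right _ _)⟩
  | kpi A M ihA ihM | tpi A M ihA ihM | lam A M ihA ihM =>
    obtain ⟨n, hn⟩ := ihA
    obtain ⟨m, hm⟩ := ihM
    exact ⟨max n m, hn.mono (le_max_left _ _),
      hm.mono ((le_max_right n m).trans (Nat.le_succ _))⟩

theorem Exp.ren_eq_self {k : Cat} {e : Exp k} {r : Var → Var} (he : e.lc 0)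
    (hf : ∀ x ∈ e.fv, r (.f x) = .f x) : e.ren r = e := by
  rw [Exp.ren_eq_sub]
  exact Exp.sub_eq_self he (by simp) fun x hx => by simp [hf x hx]

theorem Exp.lift_eq_self {k : Cat} {e : Exp k} (he : e.lc 0) (n : ℕ) : e.lift n = e :=
  Exp.ren_eq_self he fun _ _ => rfl

theorem Exp.fv_ren_shift {k : Cat} (e : Exp k) (r : Var → Var) (hb : ∀ i, ∃ j, r (.b i) = .b j)
    (hf : ∀ x, r (.f x) = .f x) : (e.ren r).fv = e.fv := by
  have hup : ∀ r : Var → Var, (∀ i, ∃ j, r (.b i) = .b j) → (∀ x, r (.f x) = .f x) →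
      (∀ i, ∃ j, Var.up r (.b i) = .b j) ∧ ∀ x, Var.up r (.f x) = .f x := by
    intro r hb hf
    constructor
    · rintro (_ | i)
      · exact ⟨0, rfl⟩
      · obtain ⟨j, hj⟩ := hb i
        exact ⟨j + 1, by simp [Var.up, hj, Var.shift]⟩
    · intro x
      simp [Var.up, hf, Var.shift]
  induction e generalizing r with
  | type => rfl
  | tcon => rfl
  | ocon => rfl
  | var v =>
    cases v with
    | b i => obtain ⟨j, hj⟩ := hb i; simp [Exp.ren, Exp.fv, hj]
    | f x => simp [Exp.ren, Exp.fv, hf]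
  | tapp A M ihA ihM => simp only [Exp.ren, Exp.fv, ihA r hb hf, ihM r hb hf]
  | app A M ihA ihM => simp only [Exp.ren, Exp.fv, ihA r hb hf, ihM r hb hf]
  | kpi A K ihA ihK =>
    simp only [Exp.ren, Exp.fv, ihA r hb hf, ihK _ (hup r hb hf).1 (hup r hb hf).2]
  | tpi A K ihA ihK =>
    simp only [Exp.ren, Exp.fv, ihA r hb hf, ihK _ (hup r hb hf).1 (hup r hb hf).2]
  | lam A K ihA ihK =>
    simp only [Exp.ren, Exp.fv, ihA r hb hf, ihK _ (hup r hb hf).1 (hup r hb hf).2]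

@[simp] theorem Exp.fv_lift {k : Cat} (e : Exp k) (n : ℕ) : (e.lift n).fv = e.fv :=
  e.fv_ren_shift _ (fun i => ⟨i + n, rfl⟩) fun _ => rfl

/-- A free variable whose image contains `y` contributes `y` to the free variables. -/
theorem Exp.mem_fv_sub {k : Cat} {e : Exp k} {θ : Var → Obj} {x y : ℕ} (hx : x ∈ e.fv)
    (hy : y ∈ (θ (.f x)).fv) : y ∈ (e.sub θ).fv := by
  have hup : ∀ θ : Var → Obj, y ∈ (θ (.f x)).fv → y ∈ (upSub θ (.f x)).fv := by
    intro θ h; simpa [upSub] using h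
  induction e generalizing θ with
  | type => simp [Exp.fv] at hx
  | tcon => simp [Exp.fv] at hx
  | ocon => simp [Exp.fv] at hx
  | var v =>
    cases v with
    | b i => simp [Exp.fv] at hx
    | f z => simp only [Exp.fv, Finset.mem_singleton] at hx; subst hx; exact hy
  | tapp A M ihA ihM | app A M ihA ihM =>
    simp only [Exp.fv, Finset.mem_union, Exp.sub] at hx ⊢
    exact hx.imp (fun h => ihA h hy) fun h => ihM h hy
  | kpi A M ihA ihM | tpi A M ihA ihM | lam A M ihA ihM =>
    simp only [Exp.fv, Finset.mem_union, Exp.sub] at hx ⊢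
    exact hx.imp (fun h => ihA h hy) fun h => ihM h (hup _ hy)

theorem mem_fvs {Ms : List Obj} {x : ℕ} : x ∈ fvs Ms ↔ ∃ M ∈ Ms, x ∈ M.fv := by
  induction Ms with
  | nil => simp [fvs]
  | cons M Ms ih => simpa [fvs] using or_congr Iff.rfl ih

theorem fv_tapps (A : Fam) (Ms : List Obj) : (tapps A Ms).fv = A.fv ∪ fvs Ms := by
  induction Ms generalizing A with
  | nil => simp [tapps, fvs]
  | cons M Ms ih =>
    refine (ih (A.tapp M)).trans ?_
    simp [Exp.fv, fvs]

/-! Conversion. -/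

theorem Conv.sub {k : Cat} {e e' : Exp k} (h : Conv e e') (θ : Var → Obj) :
    Conv (e.sub θ) (e'.sub θ) := by
  induction h generalizing θ with
  | refl e => exact .refl _
  | symm _ ih => exact (ih θ).symm
  | trans _ _ ih1 ih2 => exact (ih1 θ).trans (ih2 θ)
  | beta A M N =>
    rw [Exp.inst_one_sub]
    exact .beta _ _ _
  | eta A M =>
    simp only [Exp.sub, Exp.lift_sub_upSub, upSub_zero]
    exact .eta _ _
  | kpi _ _ ih1 ih2 => exact .kpi (ih1 θ) (ih2 _)
  | tpi _ _ ih1 ih2 => exact .tpi (ih1 θ) (ih2 _)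
  | tapp _ _ ih1 ih2 => exact .tapp (ih1 θ) (ih2 _)
  | lam _ _ ih1 ih2 => exact .lam (ih1 θ) (ih2 _)
  | app _ _ ih1 ih2 => exact .app (ih1 θ) (ih2 _)

/-- Families and kinds are convertible only if they have the same top constructor and convertible
components. -/
def SameShape : {k : Cat} → Exp k → Exp k → Prop
  | _, .type, .type => True
  | _, .kpi A K, .kpi A' K' => Conv A A' ∧ Conv K K'
  | _, .tcon a, .tcon a' => a = a'
  | _, .tpi A K, .tpi A' K' => Conv A A' ∧ Conv K K'
  | _, .tapp A K, .tapp A' K' => Conv A A' ∧ Conv K K'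
  | .obj, _, _ => True
  | _, _, _ => False

theorem SameShape.refl {k : Cat} (e : Exp k) : SameShape e e := by
  cases e <;> simp [SameShape, Conv.refl]

theorem SameShape.symm {k : Cat} {e e' : Exp k} (h : SameShape e e') : SameShape e' e := by
  cases e <;> cases e' <;> simp_all [SameShape] <;> exact ⟨h.1.symm, h.2.symm⟩

theorem SameShape.trans {k : Cat} {e e' e'' : Exp k} (h : SameShape e e') (h' : SameShape e' e'') :
    SameShape e e'' := by
  cases e <;> cases e' <;> cases e'' <;> simp_all [SameShape] <;>
    exact ⟨h.1.trans h'.1, h.2.trans h'.2⟩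

/-- β and η are rules on objects only, where the shape relation is trivially true; on families and
kinds every rule is a congruence or an equivalence rule. This yields injectivity and disjointness of
the constructors there without a Church–Rosser theorem. -/
theorem Conv.sameShape {k : Cat} {e e' : Exp k} (h : Conv e e') : SameShape e e' := by
  induction h with
  | refl e => exact .refl e
  | symm _ ih => exact ih.symm
  | trans _ _ ih1 ih2 => exact ih1.trans ih2
  | beta A M N => cases M.inst [N] <;> trivial
  | eta A M => cases M <;> trivial
  | kpi h1 h2 => exact ⟨h1, h2⟩
  | tpi h1 h2 => exact ⟨h1, h2⟩
  | tapp h1 h2 => exact ⟨h1, h2⟩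
  | lam => trivial
  | app => trivial

theorem Conv.type_inv {K : Kind} (h : Conv K .type) : K = .type := by
  have := h.sameShape
  cases K <;> simp_all [SameShape]

theorem Conv.kpi_inv {K K' : Kind} {A : Fam} (h : Conv K (.kpi A K')) :
    ∃ A₁ K₁, K = .kpi A₁ K₁ ∧ Conv A₁ A ∧ Conv K₁ K' := by
  have := h.sameShape
  cases K <;> simp_all [SameShape]

theorem Conv.tpi_inv {B A A' : Fam} (h : Conv B (.tpi A A')) :
    ∃ A₁ B₁, B = .tpi A₁ B₁ ∧ Conv A₁ A ∧ Conv B₁ A' := by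
  have := h.sameShape
  cases B <;> simp_all [SameShape]

/-! Basic metatheory of LF. -/

/-- The named context of a judgment. -/
def Judg.gam : Judg → Ctx
  | .ctx Γ _ => Γ
  | .kind Γ _ _ => Γ
  | .fam Γ _ _ _ => Γ
  | .obj Γ _ _ _ => Γ

/-- The types of the bound variables in scope in a judgment. -/
def Judg.psi : Judg → List Fam
  | .ctx _ Ψ => Ψ
  | .kind _ Ψ _ => Ψ
  | .fam _ Ψ _ _ => Ψ
  | .obj _ Ψ _ _ => Ψ

/-- The judgment with a substitution applied, in a new context. -/
def Judg.sub (θ : Var → Obj) (Γ' : Ctx) (Ψ' : List Fam) : Judg → Judg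
  | .ctx _ _ => .ctx Γ' Ψ'
  | .kind _ _ K => .kind Γ' Ψ' (K.sub θ)
  | .fam _ _ A K => .fam Γ' Ψ' (A.sub θ) (K.sub θ)
  | .obj _ _ M A => .obj Γ' Ψ' (M.sub θ) (A.sub θ)

/-- The LF judgments, with the well-formedness of the type of a bound variable as an additional
premise of the rules for binders. -/
inductive LFd (S : Sig) : Judg → Prop
  | ctx_nil : LFd S (.ctx [] [])
  | ctx_snoc {Γ : Ctx} {x : ℕ} {A : Fam} :
      LFd S (.ctx Γ []) → x ∉ dom Γ → LFd S (.fam Γ [] A .type) → LFd S (.ctx (Γ ++ [(x, A)]) [])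
  | ctx_bind {Γ : Ctx} {Ψ : List Fam} {A : Fam} :
      LFd S (.ctx Γ Ψ) → LFd S (.fam Γ Ψ A .type) → LFd S (.ctx Γ (A :: Ψ))
  | kind_type {Γ : Ctx} {Ψ : List Fam} : LFd S (.ctx Γ Ψ) → LFd S (.kind Γ Ψ .type)
  | kind_pi {Γ : Ctx} {Ψ : List Fam} {A : Fam} {K : Kind} : LFd S (.fam Γ Ψ A .type) →
      LFd S (.kind Γ (A :: Ψ) K) → LFd S (.kind Γ Ψ (.kpi A K))
  | fam_con {Γ : Ctx} {Ψ : List Fam} {a : ℕ} {K : Kind} :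
      Decl.fam a K ∈ S → LFd S (.ctx Γ Ψ) → LFd S (.fam Γ Ψ (.tcon a) K)
  | fam_pi {Γ : Ctx} {Ψ : List Fam} {A B : Fam} : LFd S (.fam Γ Ψ A .type) →
      LFd S (.fam Γ (A :: Ψ) B .type) → LFd S (.fam Γ Ψ (.tpi A B) .type)
  | fam_app {Γ : Ctx} {Ψ : List Fam} {A B : Fam} {K : Kind} {M : Obj} :
      LFd S (.fam Γ Ψ A (.kpi B K)) → LFd S (.obj Γ Ψ M B) →
      LFd S (.fam Γ Ψ (.tapp A M) (K.inst [M]))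
  | fam_conv {Γ : Ctx} {Ψ : List Fam} {A : Fam} {K K' : Kind} :
      LFd S (.fam Γ Ψ A K) → LFd S (.kind Γ Ψ K') → Conv K K' → LFd S (.fam Γ Ψ A K')
  | obj_con {Γ : Ctx} {Ψ : List Fam} {c : ℕ} {A : Fam} :
      Decl.obj c A ∈ S → LFd S (.ctx Γ Ψ) → LFd S (.obj Γ Ψ (.ocon c) A)
  | obj_fvar {Γ : Ctx} {Ψ : List Fam} {x : ℕ} {A : Fam} :
      (x, A) ∈ Γ → LFd S (.ctx Γ Ψ) → LFd S (.obj Γ Ψ (fvar x) A)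
  | obj_bvar {Γ : Ctx} {Ψ : List Fam} {i : ℕ} {A : Fam} :
      Ψ[i]? = some A → LFd S (.ctx Γ Ψ) → LFd S (.obj Γ Ψ (bvar i) (A.lift (i + 1)))
  | obj_lam {Γ : Ctx} {Ψ : List Fam} {A B : Fam} {M : Obj} : LFd S (.fam Γ Ψ A .type) →
      LFd S (.obj Γ (A :: Ψ) M B) → LFd S (.obj Γ Ψ (.lam A M) (.tpi A B))
  | obj_app {Γ : Ctx} {Ψ : List Fam} {A B : Fam} {M N : Obj} :
      LFd S (.obj Γ Ψ M (.tpi A B)) → LFd S (.obj Γ Ψ N A) →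
      LFd S (.obj Γ Ψ (.app M N) (B.inst [N]))
  | obj_conv {Γ : Ctx} {Ψ : List Fam} {M : Obj} {A A' : Fam} :
      LFd S (.obj Γ Ψ M A) → LFd S (.fam Γ Ψ A' .type) → Conv A A' → LFd S (.obj Γ Ψ M A')

variable {S : Sig}

/-- A derivation under a binder contains a derivation of its context, which in turn checks the type
of the bound variable. Carrying this for all suffixes of the bound context supplies the extra
premises of `LFd`. With them, an induction crossing a binder has a hypothesis for the domain and can
extend the target context. -/
theorem LF.toD_aux {J : Judg} (h : LF S J) : LFd S J ∧
    ∀ A Ψ, (A :: Ψ) <:+ J.psi → LFd S (.fam J.gam Ψ A .type) := by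
  have tail : ∀ {B : Fam} {Ψ' : List Fam} {Q : Fam → List Fam → Prop},
      (∀ A Ψ, (A :: Ψ) <:+ (B :: Ψ') → Q A Ψ) → Q B Ψ' ∧ ∀ A Ψ, (A :: Ψ) <:+ Ψ' → Q A Ψ :=
    fun h => ⟨h _ _ (List.suffix_refl _), fun A Ψ hs => h A Ψ (hs.trans (List.suffix_cons _ _))⟩
  induction h with
  | ctx_nil => exact ⟨.ctx_nil, by simp [Judg.psi]⟩
  | ctx_snoc _ hx _ ih1 ih2 => exact ⟨.ctx_snoc ih1.1 hx ih2.1, by simp [Judg.psi]⟩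
  | ctx_bind _ _ ih1 ih2 =>
    refine ⟨.ctx_bind ih1.1 ih2.1, fun A Ψ hs => ?_⟩
    rcases List.suffix_cons_iff.1 hs with h | h
    · cases h; exact ih2.1
    · exact ih1.2 A Ψ h
  | kind_type _ ih => exact ⟨.kind_type ih.1, ih.2⟩
  | kind_pi _ ih => exact ⟨.kind_pi (tail ih.2).1 ih.1, (tail ih.2).2⟩
  | fam_con h _ ih => exact ⟨.fam_con h ih.1, ih.2⟩
  | fam_pi _ ih => exact ⟨.fam_pi (tail ih.2).1 ih.1, (tail ih.2).2⟩
  | fam_app _ _ ih1 ih2 => exact ⟨.fam_app ih1.1 ih2.1, ih1.2⟩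
  | fam_conv _ _ hc ih1 ih2 => exact ⟨.fam_conv ih1.1 ih2.1 hc, ih1.2⟩
  | obj_con h _ ih => exact ⟨.obj_con h ih.1, ih.2⟩
  | obj_fvar h _ ih => exact ⟨.obj_fvar h ih.1, ih.2⟩
  | obj_bvar h _ ih => exact ⟨.obj_bvar h ih.1, ih.2⟩
  | obj_lam _ ih => exact ⟨.obj_lam (tail ih.2).1 ih.1, (tail ih.2).2⟩
  | obj_app _ _ ih1 ih2 => exact ⟨.obj_app ih1.1 ih2.1, ih1.2⟩
  | obj_conv _ _ hc ih1 ih2 => exact ⟨.obj_conv ih1.1 ih2.1 hc, ih1.2⟩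

theorem LF.toD {J : Judg} (h : LF S J) : LFd S J := h.toD_aux.1

theorem LFd.toLF {J : Judg} (h : LFd S J) : LF S J := by
  induction h with
  | ctx_nil => exact .ctx_nil
  | ctx_snoc _ h _ ih1 ih2 => exact .ctx_snoc ih1 h ih2
  | ctx_bind _ _ ih1 ih2 => exact .ctx_bind ih1 ih2
  | kind_type _ ih => exact .kind_type ih
  | kind_pi _ _ _ ih => exact .kind_pi ih
  | fam_con h _ ih => exact .fam_con h ih
  | fam_pi _ _ _ ih => exact .fam_pi ih
  | fam_app _ _ ih1 ih2 => exact .fam_app ih1 ih2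
  | fam_conv _ _ hc ih1 ih2 => exact .fam_conv ih1 ih2 hc
  | obj_con h _ ih => exact .obj_con h ih
  | obj_fvar h _ ih => exact .obj_fvar h ih
  | obj_bvar h _ ih => exact .obj_bvar h ih
  | obj_lam _ _ _ ih => exact .obj_lam ih
  | obj_app _ _ ih1 ih2 => exact .obj_app ih1 ih2
  | obj_conv _ _ hc ih1 ih2 => exact .obj_conv ih1 ih2 hc

theorem LFd.ctx_valid {J : Judg} (h : LFd S J) : LFd S (.ctx J.gam J.psi) := by
  induction h with
  | ctx_nil => exact .ctx_nil
  | ctx_snoc h1 hx h2 => exact .ctx_snoc h1 hx h2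
  | ctx_bind h1 h2 => exact .ctx_bind h1 h2
  | kind_type _ ih => exact ih
  | kind_pi _ _ ih => exact ih
  | fam_con _ _ ih => exact ih
  | fam_pi _ _ ih => exact ih
  | fam_app _ _ ih => exact ih
  | fam_conv _ _ _ ih => exact ih
  | obj_con _ _ ih => exact ih
  | obj_fvar _ _ ih => exact ih
  | obj_bvar _ _ ih => exact ih
  | obj_lam _ _ ih => exact ih
  | obj_app _ _ ih => exact ih
  | obj_conv _ _ _ ih => exact ih

theorem LF.ctx_valid {J : Judg} (h : LF S J) : LF S (.ctx J.gam J.psi) := h.toD.ctx_valid.toLF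

theorem LFd.ctx_gam {J : Judg} (h : LFd S J) : LFd S (.ctx J.gam []) := by
  suffices ∀ J, LFd S J → ∀ Γ Ψ, J = .ctx Γ Ψ → LFd S (.ctx Γ []) from this _ h.ctx_valid _ _ rfl
  intro J h
  induction h with
  | ctx_nil => rintro _ _ ⟨⟩; exact .ctx_nil
  | ctx_snoc h1 hx h2 => rintro _ _ ⟨⟩; exact .ctx_snoc h1 hx h2
  | ctx_bind _ _ ih => rintro _ _ ⟨⟩; exact ih _ _ rfl
  | _ => intros; contradiction

theorem LF.ctx_gam {J : Judg} (h : LF S J) : CtxValid S J.gam := h.toD.ctx_gam.toLF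

/-! Inversion for contexts. -/

theorem CtxValid.snoc_inv {Γ : Ctx} {x : ℕ} {A : Fam} (h : CtxValid S (Γ ++ [(x, A)])) :
    CtxValid S Γ ∧ x ∉ dom Γ ∧ LF S (.fam Γ [] A .type) := by
  unfold CtxValid at h
  generalize hJ : Judg.ctx (Γ ++ [(x, A)]) [] = J at h
  cases h with
  | ctx_nil => simp at hJ
  | ctx_snoc h1 h2 h3 =>
    simp only [Judg.ctx.injEq, List.append_singleton_inj, Prod.mk.injEq, and_true] at hJ
    obtain ⟨rfl, rfl, rfl⟩ := hJ
    exact ⟨h1, h2, h3⟩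
  | _ => simp at hJ

theorem CtxValid.snoc {Γ : Ctx} {x : ℕ} {A : Fam} (hx : x ∉ dom Γ)
    (hA : LF S (.fam Γ [] A .type)) : CtxValid S (Γ ++ [(x, A)]) :=
  .ctx_snoc hA.ctx_gam hx hA

theorem dom_append (Γ Θ : Ctx) : dom (Γ ++ Θ) = dom Γ ++ dom Θ := List.map_append

theorem mem_dom {Γ : Ctx} {x : ℕ} : x ∈ dom Γ ↔ ∃ A, (x, A) ∈ Γ := by simp [dom]

theorem mem_dom_of_mem {Γ : Ctx} {x : ℕ} {A : Fam} (h : (x, A) ∈ Γ) : x ∈ dom Γ :=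
  mem_dom.2 ⟨A, h⟩

theorem CtxValid.nodup {Γ : Ctx} (h : CtxValid S Γ) : (dom Γ).Nodup := by
  induction Γ using List.reverseRecOn with
  | nil => simp [dom]
  | append_singleton Γ p ih =>
    obtain ⟨h1, h2, -⟩ := CtxValid.snoc_inv (x := p.1) (A := p.2) h
    rw [dom_append, List.nodup_append]
    refine ⟨ih h1, by simp [dom], ?_⟩
    rintro a ha b hb rfl
    simp only [dom, List.map_cons, List.map_nil, List.mem_singleton] at hb
    exact h2 (hb ▸ ha)

/-! Scoping. -/

/-- The subject of the judgment is well-scoped. -/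
def Judg.Scoped : Judg → Prop
  | .ctx Γ Ψ => (∀ x A, (x, A) ∈ Γ → A.lc 0 ∧ ∀ y ∈ A.fv, y ∈ dom Γ) ∧
      ∀ A ∈ Ψ, ∀ y ∈ A.fv, y ∈ dom Γ
  | .kind Γ Ψ K => K.lc Ψ.length ∧ ∀ y ∈ K.fv, y ∈ dom Γ
  | .fam Γ Ψ A _ => A.lc Ψ.length ∧ ∀ y ∈ A.fv, y ∈ dom Γ
  | .obj Γ Ψ M _ => M.lc Ψ.length ∧ ∀ y ∈ M.fv, y ∈ dom Γ

theorem LFd.scoped {J : Judg} (h : LFd S J) : J.Scoped := by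
  induction h with
  | ctx_nil => simp [Judg.Scoped]
  | @ctx_snoc Γ x A _ hx _ ih1 ih2 =>
    refine ⟨fun y B hy => ?_, by simp⟩
    rw [dom_append]
    rcases List.mem_append.1 hy with hy | hy
    · exact ⟨(ih1.1 y B hy).1, fun z hz => List.mem_append_left _ ((ih1.1 y B hy).2 z hz)⟩
    · simp only [List.mem_singleton, Prod.mk.injEq] at hy
      obtain ⟨rfl, rfl⟩ := hy
      exact ⟨ih2.1, fun z hz => List.mem_append_left _ (ih2.2 z hz)⟩
  | ctx_bind _ _ ih1 ih2 =>
    exact ⟨ih1.1, List.forall_mem_cons.2 ⟨ih2.2, ih1.2⟩⟩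
  | kind_type _ ih => exact ⟨trivial, by simp [Exp.fv]⟩
  | kind_pi _ _ ih1 ih2 | fam_pi _ _ ih1 ih2 | obj_lam _ _ ih1 ih2 =>
    refine ⟨⟨ih1.1, ih2.1⟩, fun y hy => ?_⟩
    simp only [Exp.fv, Finset.mem_union] at hy
    exact hy.elim (ih1.2 y) (ih2.2 y)
  | fam_con _ _ ih | obj_con _ _ ih => exact ⟨trivial, by simp [Exp.fv]⟩
  | fam_app _ _ ih1 ih2 | obj_app _ _ ih1 ih2 =>
    refine ⟨⟨ih1.1, ih2.1⟩, fun y hy => ?_⟩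
    simp only [Exp.fv, Finset.mem_union] at hy
    exact hy.elim (ih1.2 y) (ih2.2 y)
  | fam_conv _ _ _ ih => exact ih
  | obj_conv _ _ _ ih => exact ih
  | obj_fvar h _ ih => exact ⟨trivial, by simpa [Exp.fv] using mem_dom_of_mem h⟩
  | obj_bvar h _ ih => exact ⟨(List.getElem?_eq_some_iff.1 h).1, by simp [Exp.fv]⟩

theorem LF.scoped {J : Judg} (h : LF S J) : J.Scoped := h.toD.scoped

theorem CtxValid.lc {Γ : Ctx} (h : CtxValid S Γ) {x : ℕ} {A : Fam} (hx : (x, A) ∈ Γ) : A.lc 0 :=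
  ((LF.scoped h).1 x A hx).1

theorem CtxValid.fv {Γ : Ctx} (h : CtxValid S Γ) {x : ℕ} {A : Fam} (hx : (x, A) ∈ Γ) :
    ∀ y ∈ A.fv, y ∈ dom Γ :=
  ((LF.scoped h).1 x A hx).2

/-! ### Declarations of valid signatures. -/

/-- Weakening of the signature. -/
theorem LF.mono {S S' : Sig} (hS : ∀ d ∈ S, d ∈ S') {J : Judg} (h : LF S J) : LF S' J := by
  induction h with
  | ctx_nil => exact .ctx_nil
  | ctx_snoc _ h _ ih1 ih2 => exact .ctx_snoc ih1 h ih2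
  | ctx_bind _ _ ih1 ih2 => exact .ctx_bind ih1 ih2
  | kind_type _ ih => exact .kind_type ih
  | kind_pi _ ih => exact .kind_pi ih
  | fam_con h _ ih => exact .fam_con (hS _ h) ih
  | fam_pi _ ih => exact .fam_pi ih
  | fam_app _ _ ih1 ih2 => exact .fam_app ih1 ih2
  | fam_conv _ _ hc ih1 ih2 => exact .fam_conv ih1 ih2 hc
  | obj_con h _ ih => exact .obj_con (hS _ h) ih
  | obj_fvar h _ ih => exact .obj_fvar h ih
  | obj_bvar h _ ih => exact .obj_bvar h ih
  | obj_lam _ ih => exact .obj_lam ih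
  | obj_app _ _ ih1 ih2 => exact .obj_app ih1 ih2
  | obj_conv _ _ hc ih1 ih2 => exact .obj_conv ih1 ih2 hc

theorem Sig.Valid.fam_wf (hS : S.Valid) {a : ℕ} {K : Kind} (h : Decl.fam a K ∈ S) :
    LF S (.kind [] [] K) := by
  induction hS with
  | nil => simp at h
  | fam _ _ hK ih =>
    rcases List.mem_cons.1 h with h | h
    · cases h; exact hK.mono fun _ => List.mem_cons_of_mem _
    · exact (ih h).mono fun _ => List.mem_cons_of_mem _
  | obj _ _ _ ih =>
    rcases List.mem_cons.1 h with h | h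
    · cases h
    · exact (ih h).mono fun _ => List.mem_cons_of_mem _

theorem Sig.Valid.obj_wf (hS : S.Valid) {c : ℕ} {A : Fam} (h : Decl.obj c A ∈ S) :
    LF S (.fam [] [] A .type) := by
  induction hS with
  | nil => simp at h
  | obj _ _ hK ih =>
    rcases List.mem_cons.1 h with h | h
    · cases h; exact hK.mono fun _ => List.mem_cons_of_mem _
    · exact (ih h).mono fun _ => List.mem_cons_of_mem _
  | fam _ _ _ ih =>
    rcases List.mem_cons.1 h with h | h
    · cases h
    · exact (ih h).mono fun _ => List.mem_cons_of_mem _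

theorem Sig.Valid.fam_unique (hS : S.Valid) {a : ℕ} {K K' : Kind} (h : Decl.fam a K ∈ S)
    (h' : Decl.fam a K' ∈ S) : K = K' := by
  induction hS with
  | nil => simp at h
  | obj _ _ _ ih => exact ih (by simpa using h) (by simpa using h')
  | fam _ hn _ ih =>
    rcases List.mem_cons.1 h with h₁ | h₁ <;> rcases List.mem_cons.1 h' with h₂ | h₂
    · cases h₁; cases h₂; rfl
    · cases h₁; exact absurd h₂ (hn _)
    · cases h₂; exact absurd h₁ (hn _)
    · exact ih h₁ h₂

theorem Sig.Valid.fam_closed (hS : S.Valid) {a : ℕ} {K : Kind} (h : Decl.fam a K ∈ S) :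
    K.lc 0 ∧ K.fv = ∅ := by
  have := (hS.fam_wf h).scoped
  exact ⟨this.1, Finset.eq_empty_of_forall_notMem fun x hx => by simpa [dom] using this.2 x hx⟩

theorem Sig.Valid.obj_closed (hS : S.Valid) {c : ℕ} {A : Fam} (h : Decl.obj c A ∈ S) :
    A.lc 0 ∧ A.fv = ∅ := by
  have := (hS.obj_wf h).scoped
  exact ⟨this.1, Finset.eq_empty_of_forall_notMem fun x hx => by simpa [dom] using this.2 x hx⟩

theorem Exp.sub_closed {k : Cat} {e : Exp k} (h : e.lc 0 ∧ e.fv = ∅) (θ : Var → Obj) :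
    e.sub θ = e :=
  Exp.sub_eq_self h.1 (by simp) (by simp [h.2])

/-! Typed substitutions. -/

/-- The variable `v` has the type `A`. -/
inductive HasVar (Γ : Ctx) (Ψ : List Fam) : Var → Fam → Prop
  | f {x : ℕ} {A : Fam} : (x, A) ∈ Γ → HasVar Γ Ψ (.f x) A
  | b {i : ℕ} {A : Fam} : Ψ[i]? = some A → HasVar Γ Ψ (.b i) (A.lift (i + 1))

theorem HasVar.obj {Γ : Ctx} {Ψ : List Fam} {v : Var} {A : Fam} (h : HasVar Γ Ψ v A)
    (hc : LF S (.ctx Γ Ψ)) : LF S (.obj Γ Ψ (.var v) A) := by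
  cases h with
  | f h => exact .obj_fvar h hc
  | b h => exact .obj_bvar h hc

theorem HasVar.shift {Γ : Ctx} {Ψ : List Fam} {v : Var} {A : Fam} (h : HasVar Γ Ψ v A)
    (hc : CtxValid S Γ) (B : Fam) : HasVar Γ (B :: Ψ) (v.shift 1) (A.lift 1) := by
  cases h with
  | f h => rw [Exp.lift_eq_self (hc.lc h)]; exact .f h
  | b h => rw [Exp.lift_lift]; exact .b (by simpa using h)

/-- A named variable counts as shifted: its type has no loose indices, so lifting leaves it alone.
-/
theorem HasVar.cons_inv {Γ : Ctx} {Ψ : List Fam} {v : Var} {A B : Fam}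
    (h : HasVar Γ (B :: Ψ) v A) (hc : CtxValid S Γ) :
    (v = .b 0 ∧ A = B.lift 1) ∨
      ∃ w C, v = w.shift 1 ∧ A = C.lift 1 ∧ HasVar Γ Ψ w C := by
  cases h with
  | @f x A h => exact Or.inr ⟨.f x, A, rfl, (Exp.lift_eq_self (hc.lc h) 1).symm, .f h⟩
  | @b i A h =>
    cases i with
    | zero => simp only [List.getElem?_cons_zero, Option.some.injEq] at h; subst h; exact Or.inl ⟨rfl, rfl⟩
    | succ i => exact Or.inr ⟨.b i, A.lift (i + 1), rfl, by simp, .b (by simpa using h)⟩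

/-- The renaming `r` is well typed. -/
def RenTy (Γ : Ctx) (Ψ : List Fam) (Γ' : Ctx) (Ψ' : List Fam) (r : Var → Var) : Prop :=
  ∀ v A, HasVar Γ Ψ v A → HasVar Γ' Ψ' (r v) (A.ren r)

theorem RenTy.up {Γ Γ' : Ctx} {Ψ Ψ' : List Fam} {r : Var → Var} (h : RenTy Γ Ψ Γ' Ψ' r)
    (hc : CtxValid S Γ) (hc' : CtxValid S Γ') (A : Fam) :
    RenTy Γ (A :: Ψ) Γ' (A.ren r :: Ψ') (Var.up r) := by
  intro v B hv
  rcases hv.cons_inv hc with ⟨rfl, rfl⟩ | ⟨w, C, rfl, rfl, hw⟩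
  · rw [Exp.lift_ren_up]
    exact .b rfl
  · rw [Exp.lift_ren_up, Var.up_shift]
    exact (h w C hw).shift hc' _

/-- The case of variables for variables comes before general substitution, because pushing a
substitution under a binder requires weakening of its values, which is an instance of renaming. -/
theorem LFd.ren_motive (hS : S.Valid) {J : Judg} (h : LFd S J) : ∀ (Γ' : Ctx) (Ψ' : List Fam)
    (r : Var → Var), LF S (.ctx Γ' Ψ') → RenTy J.gam J.psi Γ' Ψ' r →
      LF S (J.sub (fun v => .var (r v)) Γ' Ψ') := by
  induction h with
  | ctx_nil | ctx_snoc | ctx_bind => intro Γ' Ψ' r hc hr; exact hc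
  | kind_type => intro Γ' Ψ' r hc hr; exact .kind_type hc
  | kind_pi h1 _ ih1 ih2 =>
    intro Γ' Ψ' r hc hr
    have hA := ih1 Γ' Ψ' r hc hr
    have hup := hr.up h1.ctx_gam.toLF hc.ctx_gam
    simp only [Judg.sub, Exp.sub, upSub_var] at hA ⊢
    refine .kind_pi (ih2 _ _ _ (.ctx_bind hc hA) ?_)
    rw [← Exp.ren_eq_sub]
    exact hup _
  | fam_pi h1 _ ih1 ih2 =>
    intro Γ' Ψ' r hc hr
    have hA := ih1 Γ' Ψ' r hc hr
    have hup := hr.up h1.ctx_gam.toLF hc.ctx_gam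
    simp only [Judg.sub, Exp.sub, upSub_var] at hA ⊢
    refine .fam_pi (ih2 _ _ _ (.ctx_bind hc hA) ?_)
    rw [← Exp.ren_eq_sub]
    exact hup _
  | obj_lam h1 _ ih1 ih2 =>
    intro Γ' Ψ' r hc hr
    have hA := ih1 Γ' Ψ' r hc hr
    have hup := hr.up h1.ctx_gam.toLF hc.ctx_gam
    simp only [Judg.sub, Exp.sub, upSub_var] at hA ⊢
    refine .obj_lam (ih2 _ _ _ (.ctx_bind hc hA) ?_)
    rw [← Exp.ren_eq_sub]
    exact hup _
  | fam_con h _ ih =>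
    intro Γ' Ψ' r hc hr
    simp only [Judg.sub, Exp.sub, Exp.sub_closed (hS.fam_closed h)]
    exact .fam_con h hc
  | obj_con h _ ih =>
    intro Γ' Ψ' r hc hr
    simp only [Judg.sub, Exp.sub, Exp.sub_closed (hS.obj_closed h)]
    exact .obj_con h hc
  | fam_app _ _ ih1 ih2 =>
    intro Γ' Ψ' r hc hr
    simp only [Judg.sub, Exp.inst_one_sub]
    exact .fam_app (ih1 Γ' Ψ' r hc hr) (ih2 Γ' Ψ' r hc hr)
  | obj_app _ _ ih1 ih2 =>
    intro Γ' Ψ' r hc hr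
    simp only [Judg.sub, Exp.inst_one_sub]
    exact .obj_app (ih1 Γ' Ψ' r hc hr) (ih2 Γ' Ψ' r hc hr)
  | fam_conv _ _ h ih1 ih2 =>
    intro Γ' Ψ' r hc hr
    exact .fam_conv (ih1 Γ' Ψ' r hc hr) (ih2 Γ' Ψ' r hc hr) (h.sub _)
  | obj_conv _ _ h ih1 ih2 =>
    intro Γ' Ψ' r hc hr
    exact .obj_conv (ih1 Γ' Ψ' r hc hr) (ih2 Γ' Ψ' r hc hr) (h.sub _)
  | obj_fvar h =>
    intro Γ' Ψ' r hc hr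
    have := (hr _ _ (.f h)).obj hc
    rwa [Exp.ren_eq_sub] at this
  | obj_bvar h =>
    intro Γ' Ψ' r hc hr
    have := (hr _ _ (.b h)).obj hc
    rwa [Exp.ren_eq_sub] at this

/-- Weakening by a bound variable. -/
theorem LF.weaken_obj (hS : S.Valid) {Γ : Ctx} {Ψ : List Fam} {M : Obj} {A B : Fam}
    (h : LF S (.obj Γ Ψ M A)) (hB : LF S (.fam Γ Ψ B .type)) :
    LF S (.obj Γ (B :: Ψ) (M.lift 1) (A.lift 1)) := by
  have := h.toD.ren_motive hS Γ (B :: Ψ) (Var.shift 1) (.ctx_bind h.ctx_valid hB)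
    fun v C hv => hv.shift h.ctx_gam B
  simpa only [Judg.sub, Exp.lift, ← Exp.ren_eq_sub] using this

/-- The substitution `θ` is well typed. -/
def SubTy (S : Sig) (Γ : Ctx) (Ψ : List Fam) (Γ' : Ctx) (Ψ' : List Fam) (θ : Var → Obj) : Prop :=
  ∀ v A, HasVar Γ Ψ v A → LF S (.obj Γ' Ψ' (θ v) (A.sub θ))

theorem SubTy.up (hS : S.Valid) {Γ Γ' : Ctx} {Ψ Ψ' : List Fam} {θ : Var → Obj}
    (h : SubTy S Γ Ψ Γ' Ψ' θ) (hc : CtxValid S Γ) {A : Fam}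
    (hA : LF S (.fam Γ' Ψ' (A.sub θ) .type)) :
    SubTy S Γ (A :: Ψ) Γ' (A.sub θ :: Ψ') (upSub θ) := by
  intro v B hv
  rcases hv.cons_inv hc with ⟨rfl, rfl⟩ | ⟨w, C, rfl, rfl, hw⟩
  · rw [Exp.lift_sub_upSub]
    exact .obj_bvar rfl (.ctx_bind hA.ctx_valid hA)
  · rw [Exp.lift_sub_upSub, upSub_shift]
    exact (h w C hw).weaken_obj hS hA

/-- At binders, the hypothesis for the domain validates the extended target context, and `SubTy.up`
lifts the substitution. Constants use that declared types and kinds are closed. -/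
theorem LFd.sub (hS : S.Valid) {J : Judg} (h : LFd S J) : ∀ {Γ' : Ctx} {Ψ' : List Fam}
    {θ : Var → Obj}, LF S (.ctx Γ' Ψ') → SubTy S J.gam J.psi Γ' Ψ' θ →
      LF S (J.sub θ Γ' Ψ') := by
  induction h with
  | ctx_nil | ctx_snoc | ctx_bind => intro Γ' Ψ' θ hc hθ; exact hc
  | kind_type => intro Γ' Ψ' θ hc hθ; exact .kind_type hc
  | kind_pi h1 _ ih1 ih2 =>
    intro Γ' Ψ' θ hc hθ
    have hA := ih1 hc hθ
    exact .kind_pi (ih2 (.ctx_bind hc hA) (hθ.up hS h1.ctx_gam.toLF hA))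
  | fam_pi h1 _ ih1 ih2 =>
    intro Γ' Ψ' θ hc hθ
    have hA := ih1 hc hθ
    exact .fam_pi (ih2 (.ctx_bind hc hA) (hθ.up hS h1.ctx_gam.toLF hA))
  | obj_lam h1 _ ih1 ih2 =>
    intro Γ' Ψ' θ hc hθ
    have hA := ih1 hc hθ
    exact .obj_lam (ih2 (.ctx_bind hc hA) (hθ.up hS h1.ctx_gam.toLF hA))
  | fam_con h _ ih =>
    intro Γ' Ψ' θ hc hθ
    simp only [Judg.sub, Exp.sub, Exp.sub_closed (hS.fam_closed h)]
    exact .fam_con h hc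
  | obj_con h _ ih =>
    intro Γ' Ψ' θ hc hθ
    simp only [Judg.sub, Exp.sub, Exp.sub_closed (hS.obj_closed h)]
    exact .obj_con h hc
  | fam_app _ _ ih1 ih2 =>
    intro Γ' Ψ' θ hc hθ
    simp only [Judg.sub, Exp.inst_one_sub]
    exact .fam_app (ih1 hc hθ) (ih2 hc hθ)
  | obj_app _ _ ih1 ih2 =>
    intro Γ' Ψ' θ hc hθ
    simp only [Judg.sub, Exp.inst_one_sub]
    exact .obj_app (ih1 hc hθ) (ih2 hc hθ)
  | fam_conv _ _ h ih1 ih2 =>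
    intro Γ' Ψ' θ hc hθ
    exact .fam_conv (ih1 hc hθ) (ih2 hc hθ) (h.sub _)
  | obj_conv _ _ h ih1 ih2 =>
    intro Γ' Ψ' θ hc hθ
    exact .obj_conv (ih1 hc hθ) (ih2 hc hθ) (h.sub _)
  | obj_fvar h => intro Γ' Ψ' θ hc hθ; exact hθ _ _ (.f h)
  | obj_bvar h => intro Γ' Ψ' θ hc hθ; exact hθ _ _ (.b h)

/-- The substitution lemma. -/
theorem LF.sub (hS : S.Valid) {J : Judg} (h : LF S J) {Γ' : Ctx} {Ψ' : List Fam}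
    {θ : Var → Obj} (hc : LF S (.ctx Γ' Ψ')) (hθ : SubTy S J.gam J.psi Γ' Ψ' θ) :
    LF S (J.sub θ Γ' Ψ') := h.toD.sub hS hc hθ

theorem SubTy.inst {Γ : Ctx} {Ψ : List Fam} {N : Obj} {A : Fam} (hN : LF S (.obj Γ Ψ N A)) :
    SubTy S Γ (A :: Ψ) Γ Ψ (env [N]) := by
  intro v B hv
  rcases hv.cons_inv hN.ctx_gam with ⟨rfl, rfl⟩ | ⟨w, C, rfl, rfl, hw⟩
  · have : (A.lift 1).sub (env [N]) = A := A.lift_inst [N]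
    rw [this]
    exact hN
  · have : (C.lift 1).sub (env [N]) = C := C.lift_inst [N]
    rw [this, show env [N] (w.shift 1) = .var w from env_shift [N] w]
    exact hw.obj hN.ctx_valid

theorem LF.kind_inst (hS : S.Valid) {Γ : Ctx} {Ψ : List Fam} {A : Fam} {K : Kind} {N : Obj}
    (h : LF S (.kind Γ (A :: Ψ) K)) (hN : LF S (.obj Γ Ψ N A)) :
    LF S (.kind Γ Ψ (K.inst [N])) :=
  h.sub hS hN.ctx_valid (.inst hN)

theorem LF.fam_inst (hS : S.Valid) {Γ : Ctx} {Ψ : List Fam} {A B : Fam} {N : Obj}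
    (h : LF S (.fam Γ (A :: Ψ) B .type)) (hN : LF S (.obj Γ Ψ N A)) :
    LF S (.fam Γ Ψ (B.inst [N]) .type) :=
  h.sub hS hN.ctx_valid (.inst hN)

/-- Substitution for the free variables of a judgment without bound variables. -/
theorem CtxSubst.subTy {Γ Γ' : Ctx} {σ : Subst} (h : CtxSubst S Γ' σ Γ) :
    SubTy S Γ [] Γ' [] σ.toVar := by
  rintro v A (hv | hv)
  · exact h.2 _ _ hv
  · simp at hv

theorem LF.nsub_fam (hS : S.Valid) {Γ Γ' : Ctx} {σ : Subst} {A : Fam} {K : Kind}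
    (h : LF S (.fam Γ [] A K)) (hσ : CtxSubst S Γ' σ Γ) :
    LF S (.fam Γ' [] (A.nsub σ) (K.nsub σ)) := h.sub hS hσ.1 hσ.subTy

theorem LF.nsub_obj (hS : S.Valid) {Γ Γ' : Ctx} {σ : Subst} {M : Obj} {A : Fam}
    (h : LF S (.obj Γ [] M A)) (hσ : CtxSubst S Γ' σ Γ) :
    LF S (.obj Γ' [] (M.nsub σ) (A.nsub σ)) := h.sub hS hσ.1 hσ.subTy

/-- Weakening. -/
theorem LF.weaken (hS : S.Valid) {J : Judg} (h : LF S J) {Γ' : Ctx}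
    (hsub : ∀ p ∈ J.gam, p ∈ Γ') (hc : LF S (.ctx Γ' J.psi)) :
    LF S (J.sub (fun v => .var v) Γ' J.psi) := by
  refine h.sub hS hc ?_
  rintro v A (hv | hv)
  · rw [Exp.sub_id]; exact .obj_fvar (hsub _ hv) hc
  · rw [Exp.sub_id]; exact .obj_bvar hv hc

theorem LF.weaken_fam (hS : S.Valid) {Γ Γ' : Ctx} {A : Fam} {K : Kind} (h : LF S (.fam Γ [] A K))
    (hsub : ∀ p ∈ Γ, p ∈ Γ') (hc : CtxValid S Γ') : LF S (.fam Γ' [] A K) := by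
  simpa [Judg.sub, Judg.psi] using h.weaken hS hsub hc

theorem LF.weaken_named_obj (hS : S.Valid) {Γ Γ' : Ctx} {M : Obj} {A : Fam}
    (h : LF S (.obj Γ [] M A)) (hsub : ∀ p ∈ Γ, p ∈ Γ') (hc : CtxValid S Γ') :
    LF S (.obj Γ' [] M A) := by
  simpa [Judg.sub, Judg.psi] using h.weaken hS hsub hc

/-- Closed types and kinds are well formed in every context. -/
theorem LF.closed_fam (hS : S.Valid) {Γ : Ctx} {Ψ : List Fam} {A : Fam}
    (h : LF S (.fam [] [] A .type)) (hc : LF S (.ctx Γ Ψ)) : LF S (.fam Γ Ψ A .type) := by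
  have := h.sub hS (θ := fun v => .var v) hc
    (by rintro v A (hv | hv) <;> simp [Judg.gam, Judg.psi] at hv)
  simpa [Judg.sub] using this

theorem LF.closed_kind (hS : S.Valid) {Γ : Ctx} {Ψ : List Fam} {K : Kind}
    (h : LF S (.kind [] [] K)) (hc : LF S (.ctx Γ Ψ)) : LF S (.kind Γ Ψ K) := by
  have := h.sub hS (θ := fun v => .var v) hc
    (by rintro v A (hv | hv) <;> simp [Judg.gam, Judg.psi] at hv)
  simpa [Judg.sub] using this

/-! Inversion, regularity, uniqueness of kinds, strengthening. -/

/-- What the inversion of a derivation yields, by the form of the subject. -/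
def Judg.Inv (S : Sig) : Judg → Prop
  | .kind Γ Ψ (.kpi A K) => LF S (.fam Γ Ψ A .type) ∧ LF S (.kind Γ (A :: Ψ) K)
  | .fam _ _ (.tcon a) K => ∃ K', Decl.fam a K' ∈ S ∧ Conv K' K
  | .fam Γ Ψ (.tpi A B) K => LF S (.fam Γ Ψ A .type) ∧ LF S (.fam Γ (A :: Ψ) B .type) ∧
      Conv .type K
  | .fam Γ Ψ (.tapp A M) K => ∃ B K', LF S (.fam Γ Ψ A (.kpi B K')) ∧ LF S (.obj Γ Ψ M B) ∧
      Conv (K'.inst [M]) K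
  | .obj Γ _ (.var (.f x)) A => ∃ A', (x, A') ∈ Γ ∧ Conv A' A
  | _ => True

/-- Conversion rules at the end of a derivation are absorbed into one conversion by transitivity, so
the last structural rule becomes visible. -/
theorem LFd.inv {J : Judg} (h : LFd S J) : J.Inv S := by
  induction h with
  | kind_pi h1 h2 => exact ⟨h1.toLF, h2.toLF⟩
  | fam_con h => exact ⟨_, h, .refl _⟩
  | fam_pi h1 h2 => exact ⟨h1.toLF, h2.toLF, .refl _⟩
  | fam_app h1 h2 => exact ⟨_, _, h1.toLF, h2.toLF, .refl _⟩
  | obj_fvar h => exact ⟨_, h, .refl _⟩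
  | @fam_conv Γ Ψ A K K' _ _ hc ih =>
    cases A with
    | tcon => obtain ⟨K₁, h1, h2⟩ := ih; exact ⟨K₁, h1, h2.trans hc⟩
    | tpi => exact ⟨ih.1, ih.2.1, ih.2.2.trans hc⟩
    | tapp => obtain ⟨B, K₁, h1, h2, h3⟩ := ih; exact ⟨B, K₁, h1, h2, h3.trans hc⟩
  | @obj_conv Γ Ψ M A A' _ _ hc ih =>
    cases M with
    | var v =>
      cases v with
      | f x => obtain ⟨A₁, h1, h2⟩ := ih; exact ⟨A₁, h1, h2.trans hc⟩
      | b i => trivial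
    | _ => trivial
  | _ => trivial

theorem LF.inv {J : Judg} (h : LF S J) : J.Inv S := h.toD.inv

theorem LF.lift_fam (hS : S.Valid) {Γ : Ctx} {Ψ : List Fam} {A B : Fam}
    (h : LF S (.fam Γ Ψ A .type)) (hB : LF S (.fam Γ Ψ B .type)) :
    LF S (.fam Γ (B :: Ψ) (A.lift 1) .type) := by
  have := h.toD.ren_motive hS Γ (B :: Ψ) (Var.shift 1) (.ctx_bind h.ctx_valid hB)
    fun v C hv => hv.shift h.ctx_gam B
  simpa only [Judg.sub, Exp.lift, ← Exp.ren_eq_sub, Exp.ren] using this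

theorem CtxValid.fam_mem (hS : S.Valid) {Γ : Ctx} (h : CtxValid S Γ) {x : ℕ} {A : Fam}
    (hx : (x, A) ∈ Γ) : LF S (.fam Γ [] A .type) := by
  induction Γ using List.reverseRecOn with
  | nil => simp at hx
  | append_singleton Γ p ih =>
    obtain ⟨h1, -, h3⟩ := CtxValid.snoc_inv (x := p.1) (A := p.2) h
    have hsub : ∀ q ∈ Γ, q ∈ Γ ++ [p] := fun q hq => List.mem_append_left _ hq
    rcases List.mem_append.1 hx with hx | hx
    · exact (ih h1 hx).weaken_fam hS hsub h
    · simp only [List.mem_singleton] at hx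
      subst hx
      exact h3.weaken_fam hS hsub h

theorem LF.ctx_bind_inv {Γ : Ctx} {Ψ : List Fam} {A : Fam} (h : LF S (.ctx Γ (A :: Ψ))) :
    LF S (.fam Γ Ψ A .type) :=
  (h.toD_aux.2 A Ψ (List.suffix_refl _)).toLF

/-- The types of variables are well formed. -/
theorem HasVar.fam (hS : S.Valid) {Γ : Ctx} {Ψ : List Fam} {v : Var} {A : Fam}
    (h : HasVar Γ Ψ v A) (hc : LF S (.ctx Γ Ψ)) : LF S (.fam Γ Ψ A .type) := by
  induction Ψ generalizing v A with
  | nil =>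
    cases h with
    | f h => exact CtxValid.fam_mem hS hc h
    | b h => simp at h
  | cons B Ψ ih =>
    have hB := hc.ctx_bind_inv
    rcases h.cons_inv hc.ctx_gam with ⟨rfl, rfl⟩ | ⟨w, C, rfl, rfl, hw⟩
    · exact hB.lift_fam hS hB
    · exact (ih hw hB.ctx_valid).lift_fam hS hB

/-- The classifier of the judgment is well formed. -/
def Judg.Regular (S : Sig) : Judg → Prop
  | .fam Γ Ψ _ K => LF S (.kind Γ Ψ K)
  | .obj Γ Ψ _ A => LF S (.fam Γ Ψ A .type)
  | _ => True

/-- For applications, the classifier of the function is a well-formed product by induction;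
inverting it gives a well-formed body to instantiate. -/
theorem LFd.regular (hS : S.Valid) {J : Judg} (h : LFd S J) : J.Regular S := by
  induction h with
  | fam_con h hc => exact (hS.fam_wf h).closed_kind hS hc.toLF
  | fam_pi h1 => exact .kind_type h1.ctx_valid.toLF
  | fam_app _ h2 ih1 => exact ih1.inv.2.kind_inst hS h2.toLF
  | fam_conv _ h2 => exact h2.toLF
  | obj_con h hc => exact (hS.obj_wf h).closed_fam hS hc.toLF
  | obj_fvar h hc => exact (HasVar.f h).fam hS hc.toLF
  | obj_bvar h hc => exact (HasVar.b h).fam hS hc.toLF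
  | obj_lam _ _ _ ih => exact .fam_pi ih
  | obj_app _ h2 ih1 => exact ih1.inv.2.1.fam_inst hS h2.toLF
  | obj_conv _ h2 => exact h2.toLF
  | _ => trivial

theorem LF.regular (hS : S.Valid) {J : Judg} (h : LF S J) : J.Regular S := h.toD.regular hS

/-- Recursion on the family: declarations are unique, and for applications the product kinds of the
function part are convertible componentwise by injectivity. The argument plays no role, so
uniqueness of types of objects is not required. -/
theorem LF.fam_kind_unique (hS : S.Valid) {Γ : Ctx} {Ψ : List Fam} : ∀ {A : Fam} {K K' : Kind},
    LF S (.fam Γ Ψ A K) → LF S (.fam Γ Ψ A K') → Conv K K'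
  | .tcon a, K, K', h, h' => by
    obtain ⟨K₁, h1, h2⟩ := h.inv
    obtain ⟨K₂, h3, h4⟩ := h'.inv
    rw [hS.fam_unique h3 h1] at h4
    exact h2.symm.trans h4
  | .tpi A B, K, K', h, h' => h.inv.2.2.symm.trans h'.inv.2.2
  | .tapp A M, K, K', h, h' => by
    obtain ⟨B₁, K₁, h1, -, h2⟩ := h.inv
    obtain ⟨B₂, K₂, h3, -, h4⟩ := h'.inv
    have := (LF.fam_kind_unique hS h1 h3).sameShape
    exact h2.symm.trans ((this.2.sub _).trans h4)

/-- What remains of a judgment in a context that declares the free variables of its subject. -/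
def Judg.Strengthened (S : Sig) (Γ' : Ctx) : Judg → Prop
  | .ctx _ _ => True
  | .kind _ Ψ K => (∀ x ∈ K.fv, x ∈ dom Γ') → LF S (.kind Γ' Ψ K)
  | .fam _ Ψ A K => (∀ x ∈ A.fv, x ∈ dom Γ') → ∃ K', LF S (.fam Γ' Ψ A K') ∧ Conv K' K
  | .obj _ Ψ M A => (∀ x ∈ M.fv, x ∈ dom Γ') → ∃ A', LF S (.obj Γ' Ψ M A') ∧ Conv A' A

/-- The new context need not be part of the old one; it has to agree with it on common names. The
classifier is recovered only up to conversion, since a conversion rule may have introduced a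
classifier that mentions dropped variables. -/
theorem LFd.strengthen (hS : S.Valid) {Γ' : Ctx} (hc : CtxValid S Γ') {J : Judg} (h : LFd S J) :
    (∀ p ∈ J.gam, p.1 ∈ dom Γ' → p ∈ Γ') → (∀ A ∈ J.psi, ∀ x ∈ A.fv, x ∈ dom Γ') →
      LF S (.ctx Γ' J.psi) ∧ J.Strengthened S Γ' := by
  have union : ∀ {X Y : Finset ℕ}, (∀ x ∈ X ∪ Y, x ∈ dom Γ') →
      (∀ x ∈ X, x ∈ dom Γ') ∧ ∀ x ∈ Y, x ∈ dom Γ' :=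
    fun h => ⟨fun x hx => h x (Finset.mem_union_left _ hx),
      fun x hx => h x (Finset.mem_union_right _ hx)⟩
  induction h with
  | ctx_nil => intro _ _; exact ⟨hc, trivial⟩
  | ctx_snoc => intro _ _; exact ⟨hc, trivial⟩
  | ctx_bind _ _ ih1 ih2 =>
    intro hΓ hΨ
    have hΨ' := List.forall_mem_cons.1 hΨ
    obtain ⟨hc', hA⟩ := ih2 hΓ hΨ'.2
    obtain ⟨K', hK, hconv⟩ := hA hΨ'.1
    rw [hconv.type_inv] at hK
    exact ⟨.ctx_bind hc' hK, trivial⟩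
  | kind_type _ ih =>
    intro hΓ hΨ
    exact ⟨(ih hΓ hΨ).1, fun _ => .kind_type (ih hΓ hΨ).1⟩
  | kind_pi _ _ ih1 ih2 =>
    intro hΓ hΨ
    refine ⟨(ih1 hΓ hΨ).1, fun hfv => ?_⟩
    exact .kind_pi ((ih2 hΓ (List.forall_mem_cons.2 ⟨(union hfv).1, hΨ⟩)).2 (union hfv).2)
  | fam_con h _ ih =>
    intro hΓ hΨ
    exact ⟨(ih hΓ hΨ).1, fun _ => ⟨_, .fam_con h (ih hΓ hΨ).1, .refl _⟩⟩
  | fam_pi _ _ ih1 ih2 =>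
    intro hΓ hΨ
    refine ⟨(ih1 hΓ hΨ).1, fun hfv => ?_⟩
    obtain ⟨K', hK, hconv⟩ := (ih2 hΓ (List.forall_mem_cons.2 ⟨(union hfv).1, hΨ⟩)).2 (union hfv).2
    rw [hconv.type_inv] at hK
    exact ⟨_, .fam_pi hK, .refl _⟩
  | @fam_app Γ Ψ A B K M _ _ ih1 ih2 =>
    intro hΓ hΨ
    refine ⟨(ih1 hΓ hΨ).1, fun hfv => ?_⟩
    obtain ⟨K₁, hA, hK₁⟩ := (ih1 hΓ hΨ).2 (union hfv).1
    obtain ⟨B₂, hM, hB₂⟩ := (ih2 hΓ hΨ).2 (union hfv).2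
    obtain ⟨B₁, K₂, rfl, hB₁, hK₂⟩ := hK₁.kpi_inv
    -- The domain found for the function and the type found for the argument are merely convertible;
    -- regularity over the new context licenses the conversion rule that reconciles them.
    have hB : LF S (.fam Γ' Ψ B₁ .type) := (hA.regular hS).inv.1
    exact ⟨_, .fam_app hA (.obj_conv hM hB (hB₂.trans hB₁.symm)), hK₂.sub _⟩
  | fam_conv _ _ hconv ih1 _ =>
    intro hΓ hΨ
    refine ⟨(ih1 hΓ hΨ).1, fun hfv => ?_⟩
    obtain ⟨K₁, hA, hK₁⟩ := (ih1 hΓ hΨ).2 hfv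
    exact ⟨K₁, hA, hK₁.trans hconv⟩
  | obj_con h _ ih =>
    intro hΓ hΨ
    exact ⟨(ih hΓ hΨ).1, fun _ => ⟨_, .obj_con h (ih hΓ hΨ).1, .refl _⟩⟩
  | @obj_fvar Γ Ψ x A h _ ih =>
    intro hΓ hΨ
    refine ⟨(ih hΓ hΨ).1, fun hfv => ⟨_, .obj_fvar (hΓ _ h ?_) (ih hΓ hΨ).1, .refl _⟩⟩
    exact hfv x (by simp [Exp.fv])
  | obj_bvar h _ ih =>
    intro hΓ hΨ
    exact ⟨(ih hΓ hΨ).1, fun _ => ⟨_, .obj_bvar h (ih hΓ hΨ).1, .refl _⟩⟩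
  | obj_lam _ _ ih1 ih2 =>
    intro hΓ hΨ
    refine ⟨(ih1 hΓ hΨ).1, fun hfv => ?_⟩
    obtain ⟨B', hM, hB'⟩ := (ih2 hΓ (List.forall_mem_cons.2 ⟨(union hfv).1, hΨ⟩)).2 (union hfv).2
    exact ⟨_, .obj_lam hM, .tpi (.refl _) hB'⟩
  | @obj_app Γ Ψ A B M N _ _ ih1 ih2 =>
    intro hΓ hΨ
    refine ⟨(ih1 hΓ hΨ).1, fun hfv => ?_⟩
    obtain ⟨K₁, hA, hK₁⟩ := (ih1 hΓ hΨ).2 (union hfv).1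
    obtain ⟨B₂, hM, hB₂⟩ := (ih2 hΓ hΨ).2 (union hfv).2
    obtain ⟨B₁, K₂, rfl, hB₁, hK₂⟩ := hK₁.tpi_inv
    have hB : LF S (.fam Γ' Ψ B₁ .type) := (hA.regular hS).inv.1
    exact ⟨_, .obj_app hA (.obj_conv hM hB (hB₂.trans hB₁.symm)), hK₂.sub _⟩
  | obj_conv _ _ hconv ih1 _ =>
    intro hΓ hΨ
    refine ⟨(ih1 hΓ hΨ).1, fun hfv => ?_⟩
    obtain ⟨K₁, hA, hK₁⟩ := (ih1 hΓ hΨ).2 hfv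
    exact ⟨K₁, hA, hK₁.trans hconv⟩

/-- Strengthening for types. -/
theorem LF.strengthen_fam (hS : S.Valid) {Γ Γ' : Ctx} {A : Fam} (h : LF S (.fam Γ [] A .type))
    (hc : CtxValid S Γ') (hΓ : ∀ p ∈ Γ, p.1 ∈ dom Γ' → p ∈ Γ') (hfv : ∀ x ∈ A.fv, x ∈ dom Γ') :
    LF S (.fam Γ' [] A .type) := by
  obtain ⟨K', hK, hconv⟩ := (h.toD.strengthen hS hc hΓ (by simp [Judg.psi])).2 hfv
  rwa [hconv.type_inv] at hK

/-! Permutations of contexts up to conversion. -/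

/-- The context `Γ'` has a declaration for each variable of `Γ`, with a convertible type. -/
def CtxLe (Γ Γ' : Ctx) : Prop := ∀ x A, (x, A) ∈ Γ → ∃ A', (x, A') ∈ Γ' ∧ Conv A' A

/-- Proceeds along the context from the left: the earlier variables already carry the type of the
next one over to the new context, where it is then available for the conversion rule. -/
theorem CtxLe.subTy (hS : S.Valid) {Γ Γ' : Ctx} (h : CtxLe Γ Γ') (hΓ : CtxValid S Γ)
    (hΓ' : CtxValid S Γ') : SubTy S Γ [] Γ' [] (fun v => .var v) := by
  induction Γ using List.reverseRecOn with
  | nil => rintro v A (hv | hv) <;> simp at hv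
  | append_singleton Γ p ih =>
    obtain ⟨h1, -, h3⟩ := CtxValid.snoc_inv (x := p.1) (A := p.2) hΓ
    have ih' := ih (fun x A hx => h x A (List.mem_append_left _ hx)) h1
    rintro v A (hv | hv)
    · rcases List.mem_append.1 hv with hv | hv
      · exact ih' _ _ (.f hv)
      · simp only [List.mem_singleton] at hv
        subst hv
        obtain ⟨A', hA', hconv⟩ := h _ A (List.mem_append_right _ (List.mem_singleton.2 rfl))
        have hA : LF S (.fam Γ' [] A .type) := by simpa [Judg.sub] using h3.sub hS hΓ' ih'
        rw [Exp.sub_id]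
        exact .obj_conv (.obj_fvar hA' hΓ') hA hconv
    · simp at hv

theorem LF.ctxLe_fam (hS : S.Valid) {Γ Γ' : Ctx} {A : Fam} {K : Kind} (h : LF S (.fam Γ [] A K))
    (hle : CtxLe Γ Γ') (hΓ' : CtxValid S Γ') : LF S (.fam Γ' [] A K) := by
  simpa [Judg.sub] using h.sub hS hΓ' (hle.subTy hS h.ctx_gam hΓ')

theorem LF.ctxLe_obj (hS : S.Valid) {Γ Γ' : Ctx} {M : Obj} {A : Fam} (h : LF S (.obj Γ [] M A))
    (hle : CtxLe Γ Γ') (hΓ' : CtxValid S Γ') : LF S (.obj Γ' [] M A) := by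
  simpa [Judg.sub] using h.sub hS hΓ' (hle.subTy hS h.ctx_gam hΓ')

/-- `Γ'` is a permutation of `Γ` up to conversion of the types. -/
def PermConv (Γ Γ' : Ctx) : Prop :=
  ∃ Γ'' : Ctx, Γ.Perm Γ'' ∧ List.Forall₂ (fun p q => p.1 = q.1 ∧ Conv p.2 q.2) Γ'' Γ'

theorem PermConv.trans {Γ Γ' Γ'' : Ctx} (h : PermConv Γ Γ') (h' : PermConv Γ' Γ'') :
    PermConv Γ Γ'' := by
  obtain ⟨Θ, h1, h2⟩ := h
  obtain ⟨Θ', h3, h4⟩ := h'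
  -- Entrywise conversion followed by a permutation can be exchanged for a permutation followed by
  -- entrywise conversion.
  have : Relation.Comp (List.Forall₂ (fun p q : ℕ × Fam => p.1 = q.1 ∧ Conv p.2 q.2)) List.Perm Θ Θ' :=
    ⟨Γ', h2, h3⟩
  rw [List.forall₂_comp_perm_eq_perm_comp_forall₂] at this
  obtain ⟨Ξ, h5, h6⟩ := this
  refine ⟨Ξ, h1.trans h5, ?_⟩
  have ht : ∀ {l₁ l₂ l₃ : Ctx}, List.Forall₂ (fun p q => p.1 = q.1 ∧ Conv p.2 q.2) l₁ l₂ →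
      List.Forall₂ (fun p q => p.1 = q.1 ∧ Conv p.2 q.2) l₂ l₃ →
      List.Forall₂ (fun p q => p.1 = q.1 ∧ Conv p.2 q.2) l₁ l₃ := by
    intro l₁ l₂ l₃ h
    induction h generalizing l₃ with
    | nil => exact id
    | cons h _ ih =>
      rintro (_ | ⟨h', hr⟩)
      exact .cons ⟨h.1.trans h'.1, h.2.trans h'.2⟩ (ih hr)
  exact ht h6 h4

theorem PermConv.refl (Γ : Ctx) : PermConv Γ Γ :=
  ⟨Γ, .refl _, List.forall₂_same.2 fun _ _ => ⟨rfl, .refl _⟩⟩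

theorem PermConv.symm {Γ Γ' : Ctx} (h : PermConv Γ Γ') : PermConv Γ' Γ := by
  obtain ⟨Θ, h1, h2⟩ := h
  have : List.Forall₂ (fun p q : ℕ × Fam => p.1 = q.1 ∧ Conv p.2 q.2) Γ' Θ :=
    (List.Forall₂.imp (fun _ _ h => ⟨h.1.symm, h.2.symm⟩) h2.flip)
  have : Relation.Comp (List.Forall₂ (fun p q : ℕ × Fam => p.1 = q.1 ∧ Conv p.2 q.2)) List.Perm Γ' Γ :=
    ⟨Θ, this, h1.symm⟩
  rwa [List.forall₂_comp_perm_eq_perm_comp_forall₂] at this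

theorem PermConv.append {Γ Γ' : Ctx} (h : PermConv Γ Γ') {Θ Θ' : Ctx}
    (h' : PermConv Θ Θ') : PermConv (Γ ++ Θ) (Γ' ++ Θ') := by
  obtain ⟨Ξ, h1, h2⟩ := h
  obtain ⟨Ξ', h3, h4⟩ := h'
  exact ⟨Ξ ++ Ξ', h1.append h3, List.rel_append h2 h4⟩

theorem PermConv.dom_perm {Γ Γ' : Ctx} (h : PermConv Γ Γ') : (dom Γ).Perm (dom Γ') := by
  obtain ⟨Θ, h1, h2⟩ := h
  refine (h1.map _).trans (.of_eq ?_)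
  clear h1
  induction h2 with
  | nil => rfl
  | cons h _ ih => simp only [dom, List.map_cons, h.1] at ih ⊢; rw [ih]

theorem PermConv.ctxLe {Γ Γ' : Ctx} (h : PermConv Γ Γ') : CtxLe Γ Γ' := by
  obtain ⟨Θ, h1, h2⟩ := h
  intro x A hx
  have hx' := h1.mem_iff.1 hx
  clear h1 hx
  induction h2 with
  | nil => simp at hx'
  | @cons p q l₁ l₂ h _ ih =>
    rcases List.mem_cons.1 hx' with rfl | hx'
    · exact ⟨q.2, by simp [show x = q.1 from h.1], h.2.symm⟩
    · obtain ⟨A', hA', hconv⟩ := ih hx'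
      exact ⟨A', List.mem_cons_of_mem _ hA', hconv⟩

theorem PermConv.of_ctxLe {Γ Γ' : Ctx} (h : CtxLe Γ Γ') (hd : (dom Γ).Perm (dom Γ'))
    (hnd : (dom Γ').Nodup) : PermConv Γ' Γ := by
  have hex : ∀ p ∈ Γ, ∃ q ∈ Γ', q.1 = p.1 ∧ Conv q.2 p.2 := by
    intro p hp
    obtain ⟨A', hA', hconv⟩ := h p.1 p.2 hp
    exact ⟨(p.1, A'), hA', rfl, hconv⟩
  have hΘ : ∃ Θ : Ctx, (∀ q ∈ Θ, q ∈ Γ') ∧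
      List.Forall₂ (fun p q => p.1 = q.1 ∧ Conv p.2 q.2) Θ Γ := by
    clear h hd
    induction Γ with
    | nil => exact ⟨[], by simp, .nil⟩
    | cons p Γ ih =>
      obtain ⟨q, hq, hqp⟩ := hex p (by simp)
      obtain ⟨Θ, h1, h2⟩ := ih fun p' hp' => hex p' (List.mem_cons_of_mem _ hp')
      exact ⟨q :: Θ, List.forall_mem_cons.2 ⟨hq, h1⟩, .cons hqp h2⟩
  obtain ⟨Θ, h1, h2⟩ := hΘ
  have hdom : dom Θ = dom Γ := by
    clear h1 hex hd h
    induction h2 with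
    | nil => rfl
    | cons h _ ih => simp [dom, h.1]; simpa [dom] using ih
  have hndΘ : Θ.Nodup := List.Nodup.of_map Prod.fst (by
    change (dom Θ).Nodup
    rw [hdom]; exact hd.nodup_iff.2 hnd)
  have hlen : Γ'.length ≤ Θ.length := by
    have e1 := congrArg List.length hdom
    have e2 := hd.length_eq
    simp only [dom, List.length_map] at e1 e2
    omega
  -- The matching declarations form a duplicate-free list inside `Γ'` that is at least as long,
  -- hence a permutation of it.
  exact ⟨Θ, ((List.subperm_of_subset hndΘ h1).perm_of_length_le hlen).symm, h2⟩

/-! Renaming along permutations of the names. -/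

/-- The permutation `π` of the names as a substitution. -/
def permSub (π : Equiv.Perm ℕ) : Subst := fun x => fvar (π x)

/-- Renaming in a context. -/
def Ctx.rename (π : Equiv.Perm ℕ) (Γ : Ctx) : Ctx := Γ.map fun p => (π p.1, p.2.rename π)

@[simp] theorem upSub_permSub (π : Equiv.Perm ℕ) :
    upSub (permSub π).toVar = (permSub π).toVar :=
  Var.funext_shift rfl fun v => by cases v <;> rfl

@[simp] theorem upSub_iterate_permSub (π : Equiv.Perm ℕ) (n : ℕ) :
    upSub^[n] (permSub π).toVar = (permSub π).toVar := by
  induction n with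
  | zero => rfl
  | succ n ih => rw [Function.iterate_succ_apply', ih, upSub_permSub]

theorem Exp.rename_eq {k : Cat} (π : Equiv.Perm ℕ) (e : Exp k) :
    e.rename π = e.sub (permSub π).toVar := rfl

theorem toVar_sub (σ τ : Subst) :
    (fun v => (σ.toVar v).sub τ.toVar) = Subst.toVar fun x => (σ x).nsub τ := by
  funext v; cases v <;> rfl

theorem Exp.nsub_nsub {k : Cat} (σ τ : Subst) (e : Exp k) :
    (e.nsub σ).nsub τ = e.nsub fun x => (σ x).nsub τ := by
  simp only [Exp.nsub, Exp.sub_sub, toVar_sub]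

theorem Exp.rename_nsub {k : Cat} (π : Equiv.Perm ℕ) (τ : Subst) (e : Exp k) :
    (e.rename π).nsub τ = e.nsub fun x => τ (π x) :=
  e.nsub_nsub _ _

@[simp] theorem Exp.nsub_fvar {k : Cat} (e : Exp k) : e.nsub fvar = e := by
  have : Subst.toVar fvar = fun v => .var v := by funext v; cases v <;> rfl
  rw [Exp.nsub, this, Exp.sub_id]

@[simp] theorem Exp.rename_symm {k : Cat} (π : Equiv.Perm ℕ) (e : Exp k) :
    (e.rename π).rename π.symm = e := by
  refine (e.rename_nsub π _).trans ?_
  simp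

@[simp] theorem Exp.symm_rename {k : Cat} (π : Equiv.Perm ℕ) (e : Exp k) :
    (e.rename π.symm).rename π = e := by
  refine (e.rename_nsub π.symm _).trans ?_
  simp

/-- Renaming conjugates a substitution: rename back, substitute, rename. This is the form in which
unifiers are transported. -/
theorem Exp.nsub_rename {k : Cat} (π : Equiv.Perm ℕ) (σ : Subst) (e : Exp k) :
    (e.nsub σ).rename π = (e.rename π).nsub fun y => (σ (π.symm y)).rename π := by
  rw [Exp.rename_nsub]
  refine (e.nsub_nsub _ _).trans ?_
  simp [Exp.rename]

theorem Ctx.mem_rename {π : Equiv.Perm ℕ} {Γ : Ctx} {y : ℕ} {B : Fam} :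
    (y, B) ∈ Γ.rename π ↔ (π.symm y, B.rename π.symm) ∈ Γ := by
  simp only [Ctx.rename, List.mem_map, Prod.exists, Prod.mk.injEq]
  constructor
  · rintro ⟨x, A, h, rfl, rfl⟩
    simpa using h
  · intro h
    exact ⟨_, _, h, by simp, by simp⟩

theorem Ctx.mem_rename_of_mem {π : Equiv.Perm ℕ} {Γ : Ctx} {y : ℕ} {B : Fam} (h : (y, B) ∈ Γ) :
    (π y, B.rename π) ∈ Γ.rename π :=
  List.mem_map.2 ⟨_, h, rfl⟩

theorem Ctx.rename_append (π : Equiv.Perm ℕ) (Γ Θ : Ctx) :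
    (Γ ++ Θ).rename π = Γ.rename π ++ Θ.rename π := List.map_append

theorem Ctx.dom_rename (π : Equiv.Perm ℕ) (Γ : Ctx) : dom (Γ.rename π) = (dom Γ).map π := by
  simp [dom, Ctx.rename]

theorem Ctx.nsub_rename (π : Equiv.Perm ℕ) (σ : Subst) (Γ : Ctx) :
    (Γ.nsub σ).rename π = (Γ.rename π).nsub fun y => (σ (π.symm y)).rename π := by
  simp only [Ctx.nsub, Ctx.rename, List.map_map]
  refine List.map_congr_left fun p _ => ?_
  simp [Exp.nsub_rename]

theorem openTele_rename (π : Equiv.Perm ℕ) (xs : List ℕ) (T : Tele) :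
    (openTele xs T).rename π = openTele (xs.map π) (teleSub (permSub π).toVar T) := by
  induction xs generalizing T with
  | nil => cases T <;> rfl
  | cons x xs ih =>
    cases T with
    | nil => rfl
    | cons A T =>
      simp only [openTele, Ctx.rename, List.map_cons, teleSub, upSub_permSub, List.cons.injEq]
      refine ⟨rfl, (ih _).trans ?_⟩
      rw [teleInst_teleSub]
      simp only [List.length_cons, List.length_nil, upSub_iterate_permSub]
      rfl

theorem CtxValid.rename (hS : S.Valid) (π : Equiv.Perm ℕ) {Γ : Ctx} (h : CtxValid S Γ) :
    CtxValid S (Γ.rename π) := by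
  induction Γ using List.reverseRecOn with
  | nil => exact h
  | append_singleton Γ p ih =>
    obtain ⟨h1, h2, h3⟩ := CtxValid.snoc_inv (x := p.1) (A := p.2) h
    rw [Ctx.rename_append]
    refine CtxValid.snoc (by simpa [Ctx.dom_rename] using h2) ?_
    exact h3.nsub_fam hS ⟨ih h1, fun y B hy => .obj_fvar (Ctx.mem_rename_of_mem hy) (ih h1)⟩

theorem CtxSubst.perm (hS : S.Valid) (π : Equiv.Perm ℕ) {Γ : Ctx} (h : CtxValid S Γ) :
    CtxSubst S (Γ.rename π) (permSub π) Γ :=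
  ⟨h.rename hS π, fun _ _ hy => .obj_fvar (Ctx.mem_rename_of_mem hy) (h.rename hS π)⟩

theorem LF.rename_obj (hS : S.Valid) (π : Equiv.Perm ℕ) {Γ : Ctx} {M : Obj} {A : Fam}
    (h : LF S (.obj Γ [] M A)) : LF S (.obj (Γ.rename π) [] (M.rename π) (A.rename π)) :=
  h.nsub_obj hS (.perm hS π h.ctx_gam)

theorem TeleSubst.rename (hS : S.Valid) (π : Equiv.Perm ℕ) {Γ : Ctx} {Ms : List Obj} {T : Tele}
    (h : TeleSubst S Γ Ms T) :
    TeleSubst S (Γ.rename π) (Ms.map (Exp.rename π)) (teleSub (permSub π).toVar T) := by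
  induction h with
  | nil hc => exact .nil (hc.rename hS π)
  | @cons M Ms A T hM _ ih =>
    refine .cons (hM.rename_obj hS π) ?_
    rw [teleInst_teleSub] at ih
    simpa [Exp.rename_eq] using ih

theorem CtxSubst.rename_iff {π : Equiv.Perm ℕ} {Γ Γ' : Ctx} {θ : Subst} :
    CtxSubst S Γ' θ (Γ.rename π) ↔ CtxSubst S Γ' (fun x => θ (π x)) Γ := by
  refine and_congr Iff.rfl ⟨fun h y B hy => ?_, fun h y B hy => ?_⟩
  · have := h _ _ (Ctx.mem_rename_of_mem hy)
    rwa [Exp.rename_nsub] at this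
  · have := h _ _ (Ctx.mem_rename.1 hy)
    rw [← Exp.rename_nsub] at this
    simpa using this

theorem CtxSubst.rename (hS : S.Valid) (π : Equiv.Perm ℕ) {Γ Γ' : Ctx} {θ : Subst}
    (h : CtxSubst S Γ' θ Γ) : CtxSubst S (Γ'.rename π) (fun x => (θ x).rename π) Γ := by
  refine ⟨h.1.rename hS π, fun y B hy => ?_⟩
  have := (h.2 y B hy).rename_obj hS π
  have e : (B.nsub θ).rename π = B.nsub fun x => (θ x).rename π := B.nsub_nsub _ _
  rwa [e] at this

theorem Exp.tele_sub (θ : Var → Obj) : ∀ A : Fam, (A.sub θ).tele = teleSub θ A.tele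
  | .tcon _ => rfl
  | .tapp _ _ => rfl
  | .tpi A B => by simp [Exp.tele, Exp.sub, teleSub, Exp.tele_sub (upSub θ) B]

theorem Exp.target_sub (θ : Var → Obj) :
    ∀ A : Fam, (A.sub θ).target = A.target.sub (upSub^[A.tele.length] θ)
  | .tcon _ => rfl
  | .tapp _ _ => rfl
  | .tpi A B => by
    simpa [Exp.tele, Exp.sub, Exp.target, targetOf] using Exp.target_sub (upSub θ) B

/-! ### Unification problems and dependence under renaming. -/

/-- A closed type. -/
def Exp.Closed {k : Cat} (e : Exp k) : Prop := e.lc 0 ∧ e.fv = ∅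

theorem unification_ctx_rename (π : Equiv.Perm ℕ) (Γ : Ctx) (x : ℕ) (A B : Fam) (zs : List ℕ)
    (hB : B.Closed) :
    (Γ ++ (x, A) :: openTele zs B.tele).rename π =
      Γ.rename π ++ (π x, A.rename π) :: openTele (zs.map π) B.tele := by
  have : teleSub (permSub π).toVar B.tele = B.tele := by
    rw [← Exp.tele_sub, Exp.sub_closed hB]
  have h2 := openTele_rename π zs B.tele
  rw [this] at h2
  rw [Ctx.rename_append, ← h2]
  rfl

/-- Solutions of the renamed problem are solutions of the original one precomposed with the inverse
permutation. The type of the constant is closed, so only the names chosen for its arguments are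
affected. -/
theorem Unifier.rename_iff {π : Equiv.Perm ℕ} {Γ Γ' : Ctx} {x : ℕ} {A : Fam} {d : ℕ × Fam}
    {zs : List ℕ} {θ : Subst} (hd : d.2.Closed) (hz : zs.length = d.2.tele.length) :
    Unifier S (Γ.rename π) (π x) (A.rename π) d (zs.map π) Γ' θ ↔
      Unifier S Γ x A d zs Γ' fun y => θ (π y) := by
  have htgt : (d.2.target.inst (zs.map fvar)).rename π = d.2.target.inst ((zs.map π).map fvar) := by
    have h1 := Exp.target_sub (permSub π).toVar d.2
    rw [Exp.sub_closed hd] at h1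
    rw [Exp.rename_eq, Exp.inst_sub]
    simp only [List.length_map, hz, ← h1, List.map_map]
    rfl
  have happ : (apps (.ocon d.1) (zs.map fvar)).rename π =
      apps (.ocon d.1) ((zs.map π).map fvar) := by
    rw [Exp.rename_eq, apps_sub]
    simp only [List.map_map]
    rfl
  unfold Unifier
  rw [← unification_ctx_rename π Γ x A d.2 zs hd, CtxSubst.rename_iff, ← htgt, ← happ,
    Exp.rename_nsub, Exp.rename_nsub, Exp.rename_nsub]

theorem Unifier.rename (hS : S.Valid) (π : Equiv.Perm ℕ) {Γ Γ' : Ctx} {x : ℕ} {A : Fam}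
    {d : ℕ × Fam} {zs : List ℕ} {θ : Subst} (h : Unifier S Γ x A d zs Γ' θ) :
    Unifier S Γ x A d zs (Γ'.rename π) fun y => (θ y).rename π := by
  have e : ∀ {k : Cat} (B : Exp k), (B.nsub fun x => (θ x).rename π) = (B.nsub θ).rename π :=
    fun B => (B.nsub_nsub _ _).symm
  refine ⟨h.1.rename hS π, ?_, ?_⟩
  · rw [e, e]; exact h.2.1.sub _
  · rw [e]; exact h.2.2.sub _

/-- A competing unifier is pulled back to the original problem, factored there, and the factor is
precomposed with the inverse permutation. -/
theorem IsMGU.rename (hS : S.Valid) (π : Equiv.Perm ℕ) {Γ Γ' : Ctx} {x : ℕ} {A : Fam}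
    {d : ℕ × Fam} {zs : List ℕ} {σ : Subst} (h : IsMGU S Γ x A d zs Γ' σ) (hd : d.2.Closed)
    (hz : zs.length = d.2.tele.length) :
    IsMGU S (Γ.rename π) (π x) (A.rename π) d (zs.map π) (Γ'.rename π)
      fun y => (σ (π.symm y)).rename π := by
  refine ⟨(Unifier.rename_iff hd hz).2 ?_, fun y h1 h2 h3 => ?_, fun Γ'' θ hθ => ?_⟩
  · simpa using h.1.rename hS π
  · have := h.2.1 (π.symm y) (fun hy => h1 ?_) (fun hy => h2 (by rw [← hy]; simp)) fun hy => h3 ?_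
    · simp [this, Exp.rename, Exp.nsub, Exp.sub, Subst.toVar]
    · rw [Ctx.dom_rename]; exact List.mem_map.2 ⟨_, hy, by simp⟩
    · exact List.mem_map.2 ⟨_, hy, by simp⟩
  · obtain ⟨γ, h1, h2⟩ := h.2.2 Γ'' _ ((Unifier.rename_iff hd hz).1 hθ)
    refine ⟨fun y => γ (π.symm y), CtxSubst.rename_iff.2 (by simpa using h1), fun y hy => ?_⟩
    rw [← unification_ctx_rename π Γ x A d.2 zs hd, Ctx.dom_rename] at hy
    obtain ⟨z, hz, rfl⟩ := List.mem_map.1 hy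
    rw [Exp.rename_nsub]
    simpa using h2 z hz

theorem FreshFor.rename (π : Equiv.Perm ℕ) {zs : List ℕ} {B : Fam} {L : List ℕ}
    (h : FreshFor zs B L) : FreshFor (zs.map π) B (L.map π) :=
  ⟨by simpa using h.1, h.2.1.map π.injective, (List.disjoint_map π.injective h.2.2)⟩

theorem NotUnifiable.rename (π : Equiv.Perm ℕ) {Γ : Ctx} {x : ℕ} {A : Fam}
    {d : ℕ × Fam} (h : NotUnifiable S Γ x A d) (hd : d.2.Closed) :
    NotUnifiable S (Γ.rename π) (π x) (A.rename π) d := by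
  intro zs Γ' θ hz hu
  have hz' := hz.rename π.symm
  rw [Ctx.dom_rename] at hz'
  simp only [List.map_cons, List.map_map, Equiv.symm_apply_apply, Equiv.symm_comp_self,
    List.map_id] at hz'
  refine h (zs.map π.symm) Γ' (fun y => θ (π y)) hz' ((Unifier.rename_iff hd hz'.1).1 ?_)
  simpa using hu

/-- Any expression convertible to the renamed type is pulled back to one convertible to the original
type, where the variable cannot be avoided. -/
theorem Essential.rename (π : Equiv.Perm ℕ) {y : ℕ} {A : Fam} (h : Essential y A) :
    Essential (π y) (A.rename π) := by
  intro B hB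
  have hB' : Conv A (B.rename π.symm) := by
    have : Conv ((A.rename π).rename π.symm) (B.rename π.symm) := hB.sub (permSub π.symm).toVar
    rwa [Exp.rename_symm] at this
  have := Exp.mem_fv_sub (θ := (permSub π).toVar) (h _ hB') (y := π y)
    (by simp [Subst.toVar, permSub, Exp.fv])
  rwa [← Exp.rename_eq, Exp.symm_rename] at this

theorem DependsOn.rename (π : Equiv.Perm ℕ) {Γ : Ctx} {y : ℕ} {A : Fam} (h : DependsOn Γ A y) :
    DependsOn (Γ.rename π) (A.rename π) (π y) := by
  induction h with
  | direct h => exact .direct (h.rename π)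
  | trans _ hz h ih => exact .trans ih (Ctx.mem_rename_of_mem hz) (h.rename π)

theorem PermConv.rename (π : Equiv.Perm ℕ) {Γ Γ' : Ctx} (h : PermConv Γ Γ') :
    PermConv (Γ.rename π) (Γ'.rename π) := by
  obtain ⟨Θ, h1, h2⟩ := h
  refine ⟨Θ.rename π, h1.map _, ?_⟩
  simp only [Ctx.rename, List.forall₂_map_left_iff, List.forall₂_map_right_iff]
  exact h2.imp fun p q h => ⟨by rw [h.1], h.2.sub _⟩

/-! ### Formulas and M2 derivations under renaming. -/

theorem upSub_iterate_sub (θ η : Var → Obj) (n : ℕ) :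
    (fun v => (upSub^[n] θ v).sub (upSub^[n] η)) = upSub^[n] fun v => (θ v).sub η := by
  induction n with
  | zero => rfl
  | succ n ih => simp only [Function.iterate_succ_apply', upSub_sub, ih]

theorem Formula.nsub_nsub (σ τ : Subst) (F : Formula) :
    (F.nsub σ).nsub τ = F.nsub fun x => (σ x).nsub τ := by
  simp only [Formula.nsub, teleSub_teleSub, teleSub_length, upSub_iterate_sub, toVar_sub]

/-- Renaming in a formula. -/
def Formula.rename (π : Equiv.Perm ℕ) (F : Formula) : Formula :=
  ⟨teleSub (permSub π).toVar F.all, teleSub (permSub π).toVar F.ex⟩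

theorem Formula.rename_eq (π : Equiv.Perm ℕ) (F : Formula) :
    F.rename π = F.nsub (permSub π) := by
  simp [Formula.rename, Formula.nsub]

theorem Formula.nsub_rename (π : Equiv.Perm ℕ) (σ : Subst) (F : Formula) :
    (F.nsub σ).rename π = (F.rename π).nsub fun y => (σ (π.symm y)).rename π := by
  simp only [Formula.rename_eq, Formula.nsub_nsub]
  congr 1
  funext x
  simp [permSub, Exp.nsub, Exp.sub, Subst.toVar, Exp.rename_eq]

/-- Renaming in a judgment of M2. -/
def M2Judg.rename (π : Equiv.Perm ℕ) : M2Judg → M2Judg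
  | .seq P Q => .seq (P.rename π) ⟨Q.ctx.rename π, Q.hyps.map (Formula.rename π), Q.goal.rename π⟩
  | .cases Γ₁ x Ax Γ₂ Δ ds Ω F => .cases (Γ₁.rename π) (π x) (Ax.rename π) (Γ₂.rename π)
      (Δ.map (Formula.rename π)) ds (Ω.rename π) (F.rename π)

/-- The constants that a judgment of M2 still has to consider have closed types. -/
def M2Judg.ClosedConsts : M2Judg → Prop
  | .seq _ _ => True
  | .cases _ _ _ _ _ ds _ _ => ∀ d ∈ ds, d.2.Closed

theorem teleInst_rename (π : Equiv.Perm ℕ) (Ms : List Obj) (T : Tele) :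
    teleSub (permSub π).toVar (teleInst Ms T) =
      teleInst (Ms.map (Exp.rename π)) (teleSub (permSub π).toVar T) := by
  rw [teleInst_teleSub, upSub_iterate_permSub]
  rfl

theorem Sig.mem_objs {d : ℕ × Fam} (h : d ∈ S.objs) : Decl.obj d.1 d.2 ∈ S := by
  obtain ⟨e, he, hd⟩ := List.mem_filterMap.1 h
  cases e with
  | fam a K => simp at hd
  | obj c A => simp only [Option.some.injEq] at hd; subst hd; exact he

/-- M2 derivations are closed under renaming. -/
theorem M2.rename (hS : S.Valid) (π : Equiv.Perm ℕ) {J : M2Judg} (h : M2 S J)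
    (hJ : J.ClosedConsts) : M2 S (J.rename π) := by
  have disj : ∀ {xs : List ℕ} {Γ : Ctx}, xs.Disjoint (dom Γ) →
      (xs.map π).Disjoint (dom (Γ.rename π)) := by
    intro xs Γ h
    rw [Ctx.dom_rename]
    exact List.disjoint_map π.injective h
  induction h with
  | @all_left Γ Δ F F₁ h σ P hh hσ _ ih =>
    refine .all_left (F₁ := F₁.rename π) (by simp [hh]) (hσ.rename hS π) ?_
    have := ih trivial
    simp only [M2Judg.rename, List.map_append, List.map_cons, List.map_nil] at this
    rw [show (Formula.rename π ⟨[], teleInst σ F₁.ex⟩) =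
      ⟨[], teleInst (σ.map (Exp.rename π)) (F₁.rename π).ex⟩ by
        simp only [Formula.rename, teleInst_rename]; rfl] at this
    exact this
  | @ex_left Γ Δ F T h xs P hh hl hnd hdis _ ih =>
    refine .ex_left (T := teleSub (permSub π).toVar T) (by simp [hh, Formula.rename, teleSub])
      (by simpa using hl) (hnd.map π.injective) (disj hdis) ?_
    have := ih trivial
    simp only [M2Judg.rename, Ctx.rename_append, openTele_rename] at this
    exact this
  | @all_right Γ Δ F xs P hl hnd hdis _ ih =>
    refine .all_right (by simpa [Formula.rename] using hl) (hnd.map π.injective) (disj hdis) ?_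
    have := ih trivial
    simp only [M2Judg.rename, Ctx.rename_append, openTele_rename] at this
    rw [show (Formula.rename π ⟨[], teleInst (xs.map fvar) F.ex⟩) =
      ⟨[], teleInst ((xs.map π).map fvar) (F.rename π).ex⟩ by
        simp only [Formula.rename, teleInst_rename, List.map_map]; rfl] at this
    exact this
  | ex_right hσ => exact .ex_right (hσ.rename hS π)
  | @case Γ Γ₁ Γ₂ x Ax Δ F Ω hperm hat hdep _ ih =>
    -- The list of constants is not renamed. This is harmless because constants of a valid signature
    -- have closed types, which is the side condition of the induction.
    refine .case (Γ₁ := Γ₁.rename π) (Γ₂ := Γ₂.rename π) (Ax := Ax.rename π) ?_ ?_ ?_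
      (ih fun d hd => hS.obj_closed (Sig.mem_objs hd))
    · have h1 := hperm.1.rename hS π
      have h2 := PermConv.rename π hperm.2
      rw [Ctx.rename_append] at h1 h2
      exact ⟨h1, h2⟩
    · rw [Exp.rename_eq, Exp.tele_sub, hat]; rfl
    · intro y hy
      rw [Ctx.dom_rename] at hy
      obtain ⟨z, hz, rfl⟩ := List.mem_map.1 hy
      exact (hdep z hz).rename π
  | sig_empty => exact .sig_empty
  | sig_nonuni hn _ ih =>
    have hJ' := List.forall_mem_cons.1 hJ
    exact .sig_nonuni (hn.rename π hJ'.1) (ih hJ'.2)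
  | @sig_uni Γ₁ Γ₂ Γ' x Ax Δ F d ds Ω zs σ P hfr hmgu hdis _ _ ih1 ih2 =>
    have hJ' := List.forall_mem_cons.1 hJ
    refine .sig_uni ?_ (hmgu.rename hS π hJ'.1 hfr.1) ?_ ?_ (ih2 hJ'.2)
    · simpa [Ctx.dom_rename] using hfr.rename π
    · change (dom (Γ'.rename π)).Disjoint _
      rw [Ctx.dom_rename π Γ']; exact disj hdis
    · have := ih1 trivial
      simp only [M2Judg.rename, Ctx.rename_append, Ctx.nsub_rename, Formula.nsub_rename,
        List.map_map] at this ⊢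
      -- The premise of a branch is first instantiated and then renamed; the rule asks for the
      -- opposite order, with the conjugated unifier.
      have e : Formula.rename π ∘ Formula.nsub σ =
          (Formula.nsub fun y => (σ (π.symm y)).rename π) ∘ Formula.rename π := by
        funext G; exact Formula.nsub_rename π σ G
      rw [e] at this
      exact this

/-! ### M2 derivations under permutation of the context. -/

/-- `Γ'` is a permutation of `Γ` up to conversion, and valid if `Γ` is. -/
def CtxEquiv (S : Sig) (Γ Γ' : Ctx) : Prop := (CtxValid S Γ → CtxValid S Γ') ∧ PermConv Γ Γ'

/-- Validity is transferred conditionally because the rules that introduce variables do not record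
that the enlarged context is valid. In this form the relation passes to any extension. -/
theorem CtxEquiv.append (hS : S.Valid) {Γ Γ' : Ctx} (h : CtxEquiv S Γ Γ') (Θ : Ctx) :
    CtxEquiv S (Γ ++ Θ) (Γ' ++ Θ) := by
  refine ⟨fun hc => ?_, h.2.append (.refl _)⟩
  induction Θ using List.reverseRecOn with
  | nil => simpa using h.1 (by simpa using hc)
  | append_singleton Θ p ih =>
    rw [← List.append_assoc] at hc ⊢
    obtain ⟨h1, h2, h3⟩ := CtxValid.snoc_inv (x := p.1) (A := p.2) hc
    have hp : PermConv (Γ ++ Θ) (Γ' ++ Θ) := h.2.append (.refl _)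
    exact .snoc (fun hx => h2 (hp.dom_perm.mem_iff.2 hx)) (h3.ctxLe_fam hS hp.ctxLe (ih h1))

theorem CtxEquiv.teleSubst (hS : S.Valid) {Γ Γ' : Ctx} (h : CtxEquiv S Γ Γ') {Ms : List Obj}
    {T : Tele} (hM : TeleSubst S Γ Ms T) : TeleSubst S Γ' Ms T := by
  induction hM with
  | nil hc => exact .nil (h.1 hc)
  | cons hM _ ih => exact .cons (hM.ctxLe_obj hS h.2.ctxLe (h.1 hM.ctx_gam)) ih

/-- The judgment still holds in every equivalent context. -/
def M2Judg.CtxInvariant (S : Sig) : M2Judg → Prop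
  | .seq P Q => ∀ Γ', CtxEquiv S Q.ctx Γ' → M2 S (.seq P ⟨Γ', Q.hyps, Q.goal⟩)
  | .cases _ _ _ _ _ _ _ _ => True

/-- The case rule itself permits a permutation up to conversion, so the change of context is
absorbed there and the branches are kept as they are. Elsewhere the context change commutes with the
rule. -/
theorem M2.ctxInvariant (hS : S.Valid) {J : M2Judg} (h : M2 S J) : J.CtxInvariant S := by
  induction h with
  | all_left hh hσ _ ih => exact fun Γ' hΓ => .all_left hh (hΓ.teleSubst hS hσ) (ih Γ' hΓ)
  | ex_left hh hl hnd hdis _ ih =>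
    intro Γ' hΓ
    refine .ex_left hh hl hnd (fun x hx hx' => hdis hx (hΓ.2.dom_perm.mem_iff.2 hx')) ?_
    exact ih _ (hΓ.append hS _)
  | all_right hl hnd hdis _ ih =>
    intro Γ' hΓ
    refine .all_right hl hnd (fun x hx hx' => hdis hx (hΓ.2.dom_perm.mem_iff.2 hx')) ?_
    exact ih _ (hΓ.append hS _)
  | ex_right hσ => exact fun Γ' hΓ => .ex_right (hΓ.teleSubst hS hσ)
  | case hperm hat hdep h _ =>
    intro Γ' hΓ
    exact .case ⟨hperm.1, hΓ.2.symm.trans hperm.2⟩ hat hdep h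
  | _ => trivial

/-! Telescopes and typing. -/

theorem TeleSubst.length {Γ : Ctx} {Ms : List Obj} {T : Tele} (h : TeleSubst S Γ Ms T) :
    Ms.length = T.length := by
  induction h with
  | nil => rfl
  | cons _ _ ih => simpa using ih

theorem TeleSubst.ctx_valid {Γ : Ctx} {Ms : List Obj} {T : Tele} (h : TeleSubst S Γ Ms T) :
    CtxValid S Γ := by
  induction h with
  | nil h => exact h
  | cons _ _ ih => exact ih

theorem TeleSubst.split {Γ : Ctx} {Ms Ns : List Obj} {T U : Tele}
    (h : TeleSubst S Γ (Ms ++ Ns) (T ++ U)) (hl : Ms.length = T.length) :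
    TeleSubst S Γ Ms T ∧ TeleSubst S Γ Ns (teleInst Ms U) := by
  induction Ms generalizing T U with
  | nil =>
    cases T with
    | nil => exact ⟨.nil h.ctx_valid, by simpa using h⟩
    | cons A T => simp at hl
  | cons M Ms ih =>
    cases T with
    | nil => simp at hl
    | cons A T =>
      have hl' : Ms.length = T.length := by simpa using hl
      rcases h with _ | ⟨hM, h⟩
      change TeleSubst S Γ (Ms ++ Ns) (teleSub _ (T ++ U)) at h
      rw [teleSub_append] at h
      obtain ⟨h1, h2⟩ := ih h (by simpa using hl')
      have e := teleInst_append_inst [M] Ms U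
      rw [hl'] at e
      rw [e] at h2
      exact ⟨.cons hM h1, h2⟩

/-- Serves to append the derivation of the head to the output arguments in the final ∃R. -/
theorem TeleSubst.snoc {Γ : Ctx} {Ms : List Obj} {T : Tele} (h : TeleSubst S Γ Ms T) {M : Obj}
    {B : Fam} (hM : LF S (.obj Γ [] M (B.inst Ms))) : TeleSubst S Γ (Ms ++ [M]) (T ++ [B]) := by
  induction h generalizing B with
  | nil hc =>
    rw [Exp.inst_nil] at hM
    exact .cons hM (.nil hc)
  | @cons N Ms A T hN h ih =>
    refine .cons hN ?_
    change TeleSubst S Γ (Ms ++ [M]) (teleSub (env [N]) (T ++ [B]))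
    rw [teleSub_append]
    refine ih ?_
    have e := B.inst_append [N] Ms
    rw [h.length, teleInst_length] at e
    rw [e]
    exact hM

theorem kpis_inst_one (T : Tele) (K : Kind) (M : Obj) :
    (kpis T K).inst [M] = kpis (teleInst [M] T) (K.sub (upSub^[T.length] (env [M]))) :=
  kpis_sub _ _ _

theorem tpis_inst_one (T : Tele) (B : Fam) (M : Obj) :
    (tpis T B).inst [M] = tpis (teleInst [M] T) (B.sub (upSub^[T.length] (env [M]))) :=
  tpis_sub _ _ _

/-- Applying a family to a list of arguments. -/
theorem LF.tapps {Γ : Ctx} {Ms : List Obj} {T : Tele} (h : TeleSubst S Γ Ms T) {A : Fam} {K : Kind}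
    (hA : LF S (.fam Γ [] A (kpis T K))) : LF S (.fam Γ [] (tapps A Ms) (K.inst Ms)) := by
  induction h generalizing A K with
  | nil hc => rw [Exp.inst_nil]; exact hA
  | @cons M Ms B T hM h ih =>
    have h1 : LF S (.fam Γ [] (A.tapp M) ((kpis T K).inst [M])) := .fam_app hA hM
    rw [kpis_inst_one] at h1
    have h2 := ih h1
    have e := K.inst_append [M] Ms
    rw [h.length, teleInst_length] at e
    rw [e] at h2
    exact h2

/-- Applying an object to a list of arguments. -/
theorem LF.apps {Γ : Ctx} {Ms : List Obj} {T : Tele} (h : TeleSubst S Γ Ms T) {N : Obj} {B : Fam}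
    (hA : LF S (.obj Γ [] N (tpis T B))) : LF S (.obj Γ [] (apps N Ms) (B.inst Ms)) := by
  induction h generalizing N B with
  | nil hc => rw [Exp.inst_nil]; exact hA
  | @cons M Ms A T hM h ih =>
    have h1 : LF S (.obj Γ [] (N.app M) ((tpis T B).inst [M])) := .obj_app hA hM
    rw [tpis_inst_one] at h1
    have h2 := ih h1
    have e := B.inst_append [M] Ms
    rw [h.length, teleInst_length] at e
    rw [e] at h2
    exact h2

theorem LF.tapps_head {Γ : Ctx} {Ms : List Obj} {A : Fam} {K : Kind}
    (h : LF S (.fam Γ [] (TwelfM2.tapps A Ms) K)) : ∃ K', LF S (.fam Γ [] A K') := by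
  induction Ms generalizing A with
  | nil => exact ⟨K, h⟩
  | cons M Ms ih =>
    obtain ⟨K', h'⟩ := ih (A := A.tapp M) h
    obtain ⟨B, K'', h1, -, -⟩ := h'.inv
    exact ⟨_, h1⟩

theorem teleSub_take (θ : Var → Obj) (T : Tele) (n : ℕ) :
    teleSub θ (T.take n) = (teleSub θ T).take n := by
  induction T generalizing θ n with
  | nil => simp [teleSub]
  | cons A T ih => cases n <;> simp [teleSub, ih]

/-- The arguments of a well-formed family are well typed. -/
theorem LF.tapps_inv (hS : S.Valid) {Γ : Ctx} {Ms : List Obj} {T : Tele} {A : Fam} {K : Kind}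
    (h : LF S (.fam Γ [] (TwelfM2.tapps A Ms) K)) (hA : LF S (.fam Γ [] A (kpis T .type))) :
    Ms.length ≤ T.length ∧ TeleSubst S Γ Ms (T.take Ms.length) := by
  induction Ms generalizing A T with
  | nil => exact ⟨Nat.zero_le _, by
    have := TeleSubst.nil (Γ := Γ) hA.ctx_gam
    simpa using this⟩
  | cons M Ms ih =>
    obtain ⟨K', h'⟩ := LF.tapps_head (A := A.tapp M) h
    obtain ⟨B, K'', h1, h2, -⟩ := h'.inv
    have hc := h1.fam_kind_unique hS hA
    cases T with
    -- There cannot be more arguments than parameters: a product kind is not convertible to `type`.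
    | nil => exact absurd hc.sameShape (by simp [SameShape, kpis])
    | cons B' T =>
      have hc' : Conv B B' ∧ Conv K'' (kpis T .type) := hc.sameShape
      have hreg : LF S (.kind Γ [] (.kpi B' (kpis T .type))) := hA.regular hS
      have hM : LF S (.obj Γ [] M B') := .obj_conv h2 hreg.inv.1 hc'.1
      have h3 : LF S (.fam Γ [] (A.tapp M) ((kpis T .type).inst [M])) := .fam_app hA hM
      rw [kpis_inst_one] at h3
      obtain ⟨h4, h5⟩ := ih (A := A.tapp M) h h3
      refine ⟨by simpa using h4, .cons hM ?_⟩
      simpa only [teleInst, ← teleSub_take] using h5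

/-- If parameters were left over, the application would have a product kind, which contradicts
uniqueness of kinds. -/
theorem LF.tapps_inv_type (hS : S.Valid) {Γ : Ctx} {Ms : List Obj} {T : Tele} {A : Fam}
    (h : LF S (.fam Γ [] (TwelfM2.tapps A Ms) .type)) (hA : LF S (.fam Γ [] A (kpis T .type))) :
    TeleSubst S Γ Ms T := by
  obtain ⟨h1, h2⟩ := h.tapps_inv hS hA
  have hT : T = T.take Ms.length ++ T.drop Ms.length := (List.take_append_drop _ _).symm
  have hk : kpis T .type = kpis (T.take Ms.length) (kpis (T.drop Ms.length) .type) := by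
    conv_lhs => rw [hT]
    exact List.foldr_append
  rw [hk] at hA
  have h3 := (LF.tapps h2 hA).fam_kind_unique hS h
  have h4 := h3.type_inv
  cases hd : T.drop Ms.length with
  | nil => rw [hd, List.append_nil] at hT; rwa [← hT] at h2
  | cons B U => simp [hd, kpis, Exp.inst, Exp.sub] at h4

theorem LF.weaken_fam_bound (hS : S.Valid) {Γ Γ' : Ctx} {A B : Fam} {K : Kind}
    (h : LF S (.fam Γ [A] B K)) (hsub : ∀ p ∈ Γ, p ∈ Γ') (hA : LF S (.fam Γ' [] A .type)) :
    LF S (.fam Γ' [A] B K) := by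
  simpa [Judg.sub, Judg.psi] using h.weaken hS hsub (.ctx_bind hA.ctx_valid hA)

/-- The names `xs` can be given to the variables of the telescope `T` in the context `Γ`. -/
def NamesFor (xs : List ℕ) (T : Tele) (Γ : Ctx) : Prop :=
  xs.length = T.length ∧ xs.Nodup ∧ xs.Disjoint (dom Γ)

theorem NamesFor.cons {x : ℕ} {xs : List ℕ} {A : Fam} {T : Tele} {Γ : Ctx}
    (h : NamesFor (x :: xs) (A :: T) Γ) :
    x ∉ dom Γ ∧ NamesFor xs (teleInst [fvar x] T) (Γ ++ [(x, A)]) := by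
  obtain ⟨h1, h2, h3⟩ := h
  rw [List.nodup_cons] at h2
  rw [List.disjoint_cons_left] at h3
  refine ⟨h3.1, by simpa using h1, h2.2, ?_⟩
  rw [dom_append, List.disjoint_append_right]
  refine ⟨h3.2, ?_⟩
  simpa [dom] using h2.1

/-- Naming the variables of a dependent product type. -/
theorem LF.open_tpis (hS : S.Valid) {xs : List ℕ} {T : Tele} {Γ : Ctx} {B : Fam}
    (h : LF S (.fam Γ [] (tpis T B) .type)) (hxs : NamesFor xs T Γ) :
    CtxValid S (Γ ++ openTele xs T) ∧
      LF S (.fam (Γ ++ openTele xs T) [] (B.inst (xs.map fvar)) .type) := by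
  induction xs generalizing T Γ B with
  | nil =>
    cases T with
    | nil =>
      simp only [openTele, List.append_nil, List.map_nil, Exp.inst_nil]
      exact ⟨h.ctx_gam, h⟩
    | cons => simp [NamesFor] at hxs
  | cons x xs ih =>
    cases T with
    | nil => simp [NamesFor] at hxs
    | cons A T =>
      obtain ⟨hx, hxs'⟩ := hxs.cons
      obtain ⟨hA, hB, -⟩ := h.inv
      have hΓ : CtxValid S (Γ ++ [(x, A)]) := .snoc hx hA
      have hsub : ∀ p ∈ Γ, p ∈ Γ ++ [(x, A)] := fun p hp => List.mem_append_left _ hp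
      have hA' := hA.weaken_fam hS hsub hΓ
      have hB' : LF S (.fam (Γ ++ [(x, A)]) [A] (tpis T B) .type) :=
        LF.weaken_fam_bound hS hB hsub hA'
      have h1 := hB'.fam_inst hS (N := fvar x) (.obj_fvar (by simp) hΓ)
      rw [tpis_inst_one] at h1
      have h2 := ih h1 hxs'
      have e := B.inst_append [fvar x] (xs.map fvar)
      rw [List.length_map, hxs'.1, teleInst_length] at e
      rw [e, List.append_assoc] at h2
      exact h2

/-- Naming the arguments of a family. -/
theorem LF.open_kpis (hS : S.Valid) {xs : List ℕ} {T : Tele} {Γ : Ctx} {A : Fam}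
    (h : LF S (.fam Γ [] A (kpis T .type))) (hxs : NamesFor xs T Γ) :
    CtxValid S (Γ ++ openTele xs T) ∧
      LF S (.fam (Γ ++ openTele xs T) [] (TwelfM2.tapps A (xs.map fvar)) .type) := by
  induction xs generalizing T Γ A with
  | nil =>
    cases T with
    | nil =>
      simp only [openTele, List.append_nil, List.map_nil]
      exact ⟨h.ctx_gam, h⟩
    | cons => simp [NamesFor] at hxs
  | cons x xs ih =>
    cases T with
    | nil => simp [NamesFor] at hxs
    | cons B T =>
      obtain ⟨hx, hxs'⟩ := hxs.cons
      have hreg : LF S (.kind Γ [] (.kpi B (kpis T .type))) := h.regular hS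
      have hΓ : CtxValid S (Γ ++ [(x, B)]) := .snoc hx hreg.inv.1
      have hsub : ∀ p ∈ Γ, p ∈ Γ ++ [(x, B)] := fun p hp => List.mem_append_left _ hp
      have hA' : LF S (.fam (Γ ++ [(x, B)]) [] A (.kpi B (kpis T .type))) :=
        h.weaken_fam hS hsub hΓ
      have h1 : LF S (.fam (Γ ++ [(x, B)]) [] (A.tapp (fvar x)) ((kpis T .type).inst [fvar x])) :=
        .fam_app hA' (.obj_fvar (by simp) hΓ)
      rw [kpis_inst_one] at h1
      have h2 := ih h1 hxs'
      rw [List.append_assoc] at h2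
      exact h2

/-- The named variables of a telescope form a substitution for it. -/
theorem TeleSubst.vars {xs : List ℕ} {T : Tele} {Γ : Ctx} (hc : CtxValid S Γ)
    (hl : xs.length = T.length) (h : ∀ p ∈ openTele xs T, p ∈ Γ) :
    TeleSubst S Γ (xs.map fvar) T := by
  induction xs generalizing T with
  | nil =>
    cases T with
    | nil => exact .nil hc
    | cons => simp at hl
  | cons x xs ih =>
    cases T with
    | nil => simp at hl
    | cons A T =>
      have h' := List.forall_mem_cons.1 h
      exact .cons (.obj_fvar h'.1 hc) (ih (by simpa using hl) h'.2)

theorem arrow_sub (A B : Fam) (θ : Var → Obj) :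
    (arrow A B).sub θ = arrow (A.sub θ) (B.sub θ) := by
  simp [arrow, Exp.sub, Exp.lift_sub_upSub]

theorem LF.arrow_inv (hS : S.Valid) {Γ : Ctx} {A B : Fam}
    (h : LF S (.fam Γ [] (arrow A B) .type)) :
    LF S (.fam Γ [] A .type) ∧ LF S (.fam Γ [] B .type) := by
  obtain ⟨hA, hB, -⟩ := h.inv
  refine ⟨hA, ?_⟩
  -- `A` may have no inhabitant over `Γ`. A fresh variable of this type is substituted for the bound
  -- one and afterwards removed by strengthening.
  obtain ⟨x, hx⟩ := Infinite.exists_notMem_finset (dom Γ).toFinset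
  rw [List.mem_toFinset] at hx
  have hΓ : CtxValid S (Γ ++ [(x, A)]) := .snoc hx hA
  have hsub : ∀ p ∈ Γ, p ∈ Γ ++ [(x, A)] := fun p hp => List.mem_append_left _ hp
  have hB' : LF S (.fam (Γ ++ [(x, A)]) [A] (B.lift 1) .type) :=
    hB.weaken_fam_bound hS hsub (hA.weaken_fam hS hsub hΓ)
  have h1 := hB'.fam_inst hS (N := fvar x) (.obj_fvar (by simp) hΓ)
  rw [show (B.lift 1).inst [fvar x] = B from B.lift_inst [fvar x]] at h1
  refine h1.strengthen_fam hS h.ctx_gam (fun p hp hpd => ?_) fun y hy => ?_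
  · rcases List.mem_append.1 hp with hp | hp
    · exact hp
    · simp only [List.mem_singleton] at hp
      subst hp
      exact absurd hpd hx
  · exact hB.scoped.2 y (by simpa using hy)

/-- Inversion for an iterated function type. -/
theorem LF.arrows_inv (hS : S.Valid) {Γ : Ctx} {α : Type*} (f : α → Fam) {As : List α} {B : Fam}
    (h : LF S (.fam Γ [] (As.foldl (fun B p => arrow (f p) B) B) .type)) :
    LF S (.fam Γ [] B .type) ∧ ∀ p ∈ As, LF S (.fam Γ [] (f p) .type) := by
  induction As generalizing B with
  | nil => exact ⟨h, by simp⟩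
  | cons A As ih =>
    obtain ⟨h1, h2⟩ := ih h
    obtain ⟨h3, h4⟩ := h1.arrow_inv hS
    exact ⟨h4, List.forall_mem_cons.2 ⟨h3, h2⟩⟩

theorem arrows_sub {α : Type*} (f : α → Fam) (As : List α) (B : Fam) (θ : Var → Obj) :
    (As.foldl (fun B p => arrow (f p) B) B).sub θ =
      As.foldl (fun B p => arrow ((f p).sub θ) B) (B.sub θ) := by
  induction As generalizing B with
  | nil => rfl
  | cons A As ih => simp [ih, arrow_sub]

/-- Application of an object of an iterated function type. -/
theorem LF.apps_arrows {Γ : Ctx} {As : List Fam} {Ds : List Obj} {B : Fam} {N : Obj}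
    (hD : List.Forall₂ (fun D A => LF S (.obj Γ [] D A)) Ds As)
    (hN : LF S (.obj Γ [] N (As.foldl (fun B A => arrow A B) B))) :
    LF S (.obj Γ [] (TwelfM2.apps N Ds.reverse) B) := by
  induction hD generalizing B with
  | nil => exact hN
  | @cons D A Ds As hD _ ih =>
    -- The fold puts the last premise outermost, so the arguments are consumed in reverse order and
    -- the head of the list is applied last.
    have h1 : LF S (.obj Γ [] (TwelfM2.apps N Ds.reverse) (.tpi A (B.lift 1))) := ih hN
    have h2 := LF.obj_app h1 hD
    rw [show (B.lift 1).inst [D] = B from B.lift_inst [D]] at h2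
    rw [List.reverse_cons, apps_append]
    exact h2

/-! Dependency closures. -/

theorem subset_depClosure (Γ : Ctx) (X : Finset ℕ) : X ⊆ depClosure Γ X := by
  induction Γ with
  | nil => exact subset_rfl
  | cons p Γ ih =>
    simp only [depClosure]
    split_ifs
    · exact ih.trans Finset.subset_union_left
    · exact ih

/-- Minimality of the closure, used as an induction principle for its members. -/
theorem depClosure_subset {Γ : Ctx} {X : Finset ℕ} {P : ℕ → Prop} (hX : ∀ x ∈ X, P x)
    (hΓ : ∀ x A, (x, A) ∈ Γ → P x → ∀ y ∈ A.fv, P y) : ∀ x ∈ depClosure Γ X, P x := by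
  induction Γ with
  | nil => exact hX
  | cons p Γ ih =>
    have ih' := ih fun x A hx => hΓ x A (List.mem_cons_of_mem _ hx)
    simp only [depClosure]
    split_ifs with h
    · intro x hx
      rcases Finset.mem_union.1 hx with hx | hx
      · exact ih' x hx
      · exact hΓ p.1 p.2 (by simp) (ih' _ h) x hx
    · exact ih'

/-- A single pass from right to left suffices because types refer only to the left: the names
contributed by an entry never belong to entries already processed. -/
theorem depClosure_closed {Γ : Ctx} {X : Finset ℕ}
    (hΓ : Γ.Pairwise fun p q => q.1 ∉ p.2.fv) (hself : ∀ p ∈ Γ, p.1 ∉ p.2.fv)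
    (hnd : (dom Γ).Nodup)
    {x : ℕ} {A : Fam} (hx : (x, A) ∈ Γ) (hxX : x ∈ depClosure Γ X) :
    A.fv ⊆ depClosure Γ X := by
  induction Γ with
  | nil => simp at hx
  | cons p Γ ih =>
    rw [List.pairwise_cons] at hΓ
    rw [dom, List.map_cons, List.nodup_cons] at hnd
    have hmono : depClosure Γ X ⊆ depClosure (p :: Γ) X := by
      simp only [depClosure]
      split_ifs
      · exact Finset.subset_union_left
      · exact subset_rfl
    rcases List.mem_cons.1 hx with rfl | hx
    · have : x ∈ depClosure Γ X := by
        by_contra hn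
        simp only [depClosure, hn, if_false] at hxX
      simp only [depClosure, this, if_true]
      exact Finset.subset_union_right
    · refine (ih hΓ.2 (fun q hq => hself q (List.mem_cons_of_mem _ hq)) hnd.2 hx ?_).trans hmono
      simp only [depClosure] at hxX
      split_ifs at hxX with h
      · rcases Finset.mem_union.1 hxX with hxX | hxX
        · exact hxX
        · exact absurd hxX (hΓ.1 _ hx)
      · exact hxX

theorem CtxValid.pairwise {Γ : Ctx} (h : CtxValid S Γ) :
    (Γ.Pairwise fun p q => q.1 ∉ p.2.fv) ∧ ∀ p ∈ Γ, p.1 ∉ p.2.fv := by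
  induction Γ using List.reverseRecOn with
  | nil => simp
  | append_singleton Γ p ih =>
    obtain ⟨h1, h2, h3⟩ := CtxValid.snoc_inv (x := p.1) (A := p.2) h
    obtain ⟨ih1, ih2⟩ := ih h1
    refine ⟨List.pairwise_append.2 ⟨ih1, by simp, ?_⟩, ?_⟩
    · intro q hq r hr
      rw [List.mem_singleton] at hr
      subst hr
      exact fun hr => h2 (h1.fv (x := q.1) (A := q.2) hq _ hr)
    · intro q hq
      rcases List.mem_append.1 hq with hq | hq
      · exact ih2 q hq
      · rw [List.mem_singleton] at hq
        subst hq
        exact fun hr => h2 (h3.scoped.2 _ hr)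

theorem CtxValid.depClosure_closed {Γ : Ctx} (h : CtxValid S Γ) {X : Finset ℕ}
    {x : ℕ} {A : Fam} (hx : (x, A) ∈ Γ) (hxX : x ∈ depClosure Γ X) :
    A.fv ⊆ depClosure Γ X :=
  TwelfM2.depClosure_closed h.pairwise.1 h.pairwise.2 h.nodup hx hxX

/-- Extending a context by declarations of another context. -/
theorem CtxValid.append_filter (hS : S.Valid) {Γ Θ : Ctx} (hΓ : CtxValid S Γ) (hΘ : CtxValid S Θ)
    (P : ℕ → Prop) [DecidablePred P] (hΓΘ : ∀ p ∈ Θ, p.1 ∈ dom Γ → p ∈ Γ)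
    (hP : ∀ x, P x → x ∉ dom Γ)
    (hcl : ∀ x A, (x, A) ∈ Θ → P x → ∀ y ∈ A.fv, y ∈ dom Γ ∨ P y) :
    CtxValid S (Γ ++ Θ.filter fun p => P p.1) := by
  induction Θ using List.reverseRecOn with
  | nil => simpa using hΓ
  | append_singleton Θ p ih =>
    obtain ⟨x, A⟩ := p
    obtain ⟨h1, h2, h3⟩ := hΘ.snoc_inv
    have ih' := ih h1 (fun q hq => hΓΘ q (List.mem_append_left _ hq))
      fun y B hy => hcl y B (List.mem_append_left _ hy)
    rw [List.filter_append, ← List.append_assoc]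
    by_cases hx : P x
    · have hdom : ∀ y, y ∈ dom (Γ ++ Θ.filter fun p => P p.1) ↔
          y ∈ dom Γ ∨ (y ∈ dom Θ ∧ P y) := by
        intro y
        rw [dom_append, List.mem_append]
        refine or_congr Iff.rfl ?_
        simp only [mem_dom, List.mem_filter, decide_eq_true_eq]
        exact ⟨fun ⟨B, h1, h2⟩ => ⟨⟨B, h1⟩, h2⟩, fun ⟨⟨B, h1⟩, h2⟩ => ⟨B, h1, h2⟩⟩
      simp only [List.filter_cons, hx, decide_true, if_true, List.filter_nil]
      -- The type is well formed over the prefix of `Θ`; strengthening moves it to the context that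
      -- keeps only the selected entries.
      refine .snoc (fun hxd => ?_) (h3.strengthen_fam hS ih' (fun q hq hqd => ?_) fun y hy => ?_)
      · rcases (hdom x).1 hxd with h | h
        · exact hP x hx h
        · exact h2 h.1
      · rcases (hdom q.1).1 hqd with h | h
        · exact List.mem_append_left _ (hΓΘ q (List.mem_append_left _ hq) h)
        · exact List.mem_append_right _ (List.mem_filter.2 ⟨hq, by simpa using h.2⟩)
      · exact (hdom y).2 ((hcl x A (by simp) hx y hy).imp_right fun h => ⟨h3.scoped.2 y hy, h⟩)
    · simpa [List.filter_cons, hx] using ih'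

/-! The translation of runs of output coverage checking. -/

/-- A substitution for names never moves indices, so any bound on the loose indices will do. -/
theorem Exp.nsub_eq_self {k : Cat} {e : Exp k} {σ : Subst} (h : ∀ x ∈ e.fv, σ x = fvar x) :
    e.nsub σ = e := by
  obtain ⟨n, hn⟩ := e.exists_lc
  exact Exp.sub_eq_self hn (fun _ _ => rfl) h

/-- The formula is not affected by substitutions that fix the names in `I`. -/
def Formula.FixedBy (I : Finset ℕ) (F : Formula) : Prop :=
  ∀ σ : Subst, (∀ y ∈ I, σ y = fvar y) → F.nsub σ = F

theorem Formula.FixedBy.mono {I I' : Finset ℕ} {F : Formula} (h : F.FixedBy I) (hI : I ⊆ I') :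
    F.FixedBy I' :=
  fun σ hσ => h σ fun y hy => hσ y (hI hy)

theorem Formula.FixedBy.map_eq {I : Finset ℕ} {Δ : List Formula} (h : ∀ F ∈ Δ, F.FixedBy I)
    {σ : Subst} (hσ : ∀ y ∈ I, σ y = fvar y) : Δ.map (Formula.nsub σ) = Δ := by
  conv_rhs => rw [← List.map_id Δ]
  exact List.map_congr_left fun F hF => h F hF σ hσ

theorem Ctx.nsub_append (σ : Subst) (Γ Θ : Ctx) :
    Ctx.nsub σ (Γ ++ Θ) = Ctx.nsub σ Γ ++ Ctx.nsub σ Θ :=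
  List.map_append

theorem Ctx.dom_nsub (σ : Subst) (Γ : Ctx) : dom (Ctx.nsub σ Γ) = dom Γ := by
  simp [dom, Ctx.nsub]

/-- Extending a substitution by variables that it does not instantiate. -/
theorem CtxSubst.extend (hS : S.Valid) {Γ Γ' Θ : Ctx} {σ : Subst} (h : CtxSubst S Γ' σ Γ)
    (hc : CtxValid S (Γ ++ Θ)) (hσ : ∀ y ∈ dom Θ, σ y = fvar y)
    (hd : (dom Γ').Disjoint (dom Θ)) :
    CtxSubst S (Γ' ++ Ctx.nsub σ Θ) σ (Γ ++ Θ) := by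
  induction Θ using List.reverseRecOn with
  | nil => simpa [Ctx.nsub] using h
  | append_singleton Θ p ih =>
    obtain ⟨x, A⟩ := p
    rw [← List.append_assoc] at hc
    obtain ⟨h1, h2, h3⟩ := hc.snoc_inv
    rw [dom_append, List.disjoint_append_right] at hd
    simp only [dom_append, List.mem_append] at hσ
    have ih' := ih h1 (fun y hy => hσ y (Or.inl hy)) hd.1
    have hx : σ x = fvar x := hσ x (Or.inr (by simp [dom]))
    rw [Ctx.nsub_append, ← List.append_assoc, ← List.append_assoc]
    have hA := h3.nsub_fam hS ih'
    have hv : CtxValid S (Γ' ++ Ctx.nsub σ Θ ++ Ctx.nsub σ [(x, A)]) := by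
      refine .snoc (fun hxd => ?_) hA
      rw [dom_append, Ctx.dom_nsub, List.mem_append] at hxd
      rcases hxd with hxd | hxd
      · exact hd.2 hxd (by simp [dom])
      · exact h2 (by rw [dom_append]; exact List.mem_append_right _ hxd)
    refine ⟨hv, fun y B hy => ?_⟩
    rcases List.mem_append.1 hy with hy | hy
    · exact (ih'.2 y B hy).weaken_named_obj hS (fun q hq => List.mem_append_left _ hq) hv
    · simp only [List.mem_singleton, Prod.mk.injEq] at hy
      obtain ⟨rfl, rfl⟩ := hy
      rw [hx]
      exact .obj_fvar (by simp [Ctx.nsub]) hv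

/-- What the translation of a run of output coverage checking proves, in the presence of the
variable `D` for a derivation of the goal. -/
def CovJudg.Derives (S : Sig) (I : Finset ℕ) (D : ℕ) (Δ : List Formula) (F : Formula) :
    (J : CovJudg) → Pf J.sort → Prop
  | .goal Γ A, P => D ∉ dom Γ → LF S (.fam Γ [] A .type) →
      M2 S (.seq P ⟨Γ ++ [(D, A)], Δ, F⟩)
  | .splitting Γ₁ x Ax Γ₂ A ds, Ω => D ∉ dom (Γ₁ ++ (x, Ax) :: Γ₂) →
      LF S (.fam (Γ₁ ++ (x, Ax) :: Γ₂) [] A .type) → x ∉ I →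
      M2 S (.cases Γ₁ x Ax (Γ₂ ++ [(D, A)]) Δ ds Ω F)

/-- Inverting the typing of a renamed variable over the pattern shows that the pattern declares it
with a convertible type. Since D is fixed by the renaming, the convertibility of the two atoms says
the same for D; bijectivity on names does the rest. -/
theorem ImmCovered.permConv {I : Finset ℕ} {pΓ Γ : Ctx} {pA A : Fam} {ρ : Equiv.Perm ℕ}
    (h : ImmCovered S I pΓ pA Γ A ρ) {D : ℕ} (hD : D ∈ I) (hΓ : CtxValid S (Γ ++ [(D, A)])) :
    PermConv ((pΓ ++ [(D, pA)]).rename ρ.symm) (Γ ++ [(D, A)]) := by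
  obtain ⟨hI, hdom, hσ, hconv⟩ := h
  have hDs : ρ.symm D = D := by rw [Equiv.symm_apply_eq, hI D hD]
  have hd : (dom (Γ ++ [(D, A)])).Perm (dom ((pΓ ++ [(D, pA)]).rename ρ.symm)) := by
    rw [Ctx.dom_rename, dom_append, dom_append, List.map_append]
    refine List.Perm.append ?_ (by simp [dom, hDs])
    simpa using hdom.map ρ.symm
  refine .of_ctxLe (fun y B hy => ?_) hd (hd.nodup_iff.1 hΓ.nodup)
  have back : ∀ {C B : Fam}, Conv C (B.rename ρ) → Conv (C.rename ρ.symm) B := by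
    intro C B h
    have : Conv (C.rename ρ.symm) ((B.rename ρ).rename ρ.symm) := h.sub _
    rwa [Exp.rename_symm] at this
  rcases List.mem_append.1 hy with hy | hy
  · obtain ⟨B', hB', hc⟩ := (hσ.2 y B hy).inv
    refine ⟨B'.rename ρ.symm, ?_, back hc⟩
    have := Ctx.mem_rename_of_mem (π := ρ.symm) hB'
    rw [Equiv.symm_apply_apply] at this
    rw [Ctx.rename_append]
    exact List.mem_append_left _ this
  · simp only [List.mem_singleton, Prod.mk.injEq] at hy
    obtain ⟨rfl, rfl⟩ := hy
    exact ⟨pA.rename ρ.symm, by simp [Ctx.rename, hDs], back hconv⟩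

/-- Induction on the run, with D : A placed at the end of the context. Keeping D in `I` protects it
from renamings, from unifiers and from the names chosen in splittings, so that the type of D follows
the coverage goal through all instantiations. -/
theorem OutCover.toPf_derives (hS : S.Valid) {I : Finset ℕ} {pΓ : Ctx} {pA : Fam} {D : ℕ}
    (hD : D ∈ I) {Δ : List Formula} {F : Formula} (hΔ : ∀ G ∈ Δ, G.FixedBy I) (hF : F.FixedBy I)
    {P : Pf .term} (hP : M2 S (.seq P ⟨pΓ ++ [(D, pA)], Δ, F⟩)) {J : CovJudg}
    (cov : OutCover S I pΓ pA J) : J.Derives S I D Δ F (cov.toPf P) := by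
  induction cov with
  | @done Γ A ρ h =>
    intro hDΓ hA
    -- The renaming fixes `I`, hence so does its inverse; assumptions and goal formula therefore
    -- survive, and only the context changes.
    have hfix : ∀ y ∈ I, permSub ρ.symm y = fvar y := fun y hy =>
      congrArg fvar ((Equiv.symm_apply_eq ρ).2 (h.1 y hy).symm)
    have h1 := hP.rename hS ρ.symm trivial
    simp only [M2Judg.rename] at h1
    rw [Formula.rename_eq, hF _ hfix, show Formula.rename ρ.symm = Formula.nsub (permSub ρ.symm) from
      funext fun G => Formula.rename_eq _ _, Formula.FixedBy.map_eq hΔ hfix] at h1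
    have hΓ : CtxValid S (Γ ++ [(D, A)]) := .snoc hDΓ hA
    exact h1.ctxInvariant hS _ ⟨fun _ => hΓ, h.permConv hD hΓ⟩
  | @split Γ A Γ₁ x Ax Γ₂ perm output atomic dep sub ih =>
    intro hDΓ hA
    have hp : PermConv Γ (Γ₁ ++ (x, Ax) :: Γ₂) := perm.2
    have hA' := hA.ctxLe_fam hS hp.ctxLe perm.1
    have hD' : D ∉ dom (Γ₁ ++ (x, Ax) :: Γ₂) := fun h => hDΓ (hp.dom_perm.mem_iff.2 h)
    have e : Γ₁ ++ (x, Ax) :: (Γ₂ ++ [(D, A)]) = (Γ₁ ++ (x, Ax) :: Γ₂) ++ [(D, A)] := by simp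
    refine .case (Γ₁ := Γ₁) (Γ₂ := Γ₂ ++ [(D, A)]) (Ax := Ax) ?_ atomic dep (ih hD' hA' output)
    rw [e]
    exact ⟨.snoc hD' hA', hp.append (.refl _)⟩
  | nil => exact fun _ _ _ => .sig_empty
  | skip d clash rest ih => exact fun h1 h2 h3 => .sig_nonuni clash (ih h1 h2 h3)
  | @branch Γ₁ x Ax Γ₂ A ds d zs Γc σ fresh freshc mgu id_on sub rest ih1 ih2 =>
    intro hDΓ hA hx
    have hzI : ∀ y ∈ I, y ∉ zs := fun y hy hyz => fresh.2.2 hyz (by simp [hy])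
    have hz₂ : ∀ y ∈ dom Γ₂, y ∉ zs := fun y hy hyz => fresh.2.2 hyz (by simp [hy])
    have hnd := hA.ctx_gam.nodup
    simp only [Judg.gam, dom_append] at hnd
    have hnd₂ := List.nodup_append.1 hnd
    have hnd₃ : x ∉ dom Γ₂ ∧ (dom Γ₂).Nodup := List.nodup_cons.1 hnd₂.2.1
    have hd₁₂ : ∀ y ∈ dom Γ₂, y ∉ dom Γ₁ := fun y hy hy' =>
      hnd₂.2.2 y hy' y (List.mem_cons_of_mem _ hy) rfl
    -- On `Γ₁` the unifier is the identity by the condition for output splitting; outside the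
    -- unification problem it is so by normalization. What remains is `x`, which is not in `I`, and
    -- the fresh names, which avoid `I`.
    have hσI : ∀ y ∈ I, σ y = fvar y := by
      intro y hy
      by_cases hy₁ : y ∈ dom Γ₁
      · exact id_on y hy₁
      · exact mgu.2.1 y hy₁ (fun h => hx (h ▸ hy)) (hzI y hy)
    have hσ₂ : ∀ y ∈ dom Γ₂, σ y = fvar y := fun y hy =>
      mgu.2.1 y (hd₁₂ y hy) (fun h => hnd₃.1 (h ▸ hy)) (hz₂ y hy)
    have hdis : (dom (Γ₁ ++ Γc)).Disjoint (dom Γ₂) := by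
      rw [dom_append, List.disjoint_append_left]
      exact ⟨fun y h1 h2 => hd₁₂ y h2 h1, fun y h1 h2 => freshc h1 (by simp [h2])⟩
    have hDc : D ∉ dom Γc := fun h => freshc h (by simp [hD])
    simp only [dom_append, List.mem_append, not_or] at hDΓ
    have hDΓ₂ : D ≠ x ∧ D ∉ dom Γ₂ := by simpa [dom] using hDΓ.2
    have hsub₁ : CtxSubst S (Γ₁ ++ Γc) σ (Γ₁ ++ [(x, Ax)]) :=
      ⟨mgu.1.1.1, fun y B hy => mgu.1.1.2 y B (by
        rcases List.mem_append.1 hy with hy | hy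
        · exact List.mem_append_left _ hy
        · rw [List.mem_singleton] at hy
          simp [hy])⟩
    -- The unifier is typed on `Γ₁` and `x`; being the identity on `Γ₂`, it extends to the whole
    -- split context and so types the instantiated subgoal.
    have hsub : CtxSubst S (Γ₁ ++ Γc ++ Ctx.nsub σ Γ₂) σ (Γ₁ ++ (x, Ax) :: Γ₂) := by
      have h := hA.ctx_gam
      simp only [Judg.gam] at h
      rw [List.append_cons] at h
      have := hsub₁.extend hS h hσ₂ hdis
      rwa [← List.append_cons Γ₁] at this
    refine .sig_uni ?_ mgu ?_ ?_ (ih2 (by simpa [dom_append, dom] using And.intro hDΓ.1 hDΓ₂) hA hx)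
    -- In the case rule the names for the arguments of the constant must also avoid D, which has
    -- joined `Γ₂`; this is why freshness is demanded relative to `I`.
    · refine ⟨fresh.1, fresh.2.1, fun y hy hy' => ?_⟩
      simp only [dom_append, List.cons_append, List.mem_cons, List.mem_append] at hy'
      rcases hy' with hy' | hy' | hy' | hy'
      · exact fresh.2.2 hy (by simp [hy'])
      · exact fresh.2.2 hy (by simp [hy'])
      · exact hz₂ y hy' hy
      · simp only [dom, List.map_cons, List.map_nil, List.mem_singleton] at hy'
        exact hzI y (hy' ▸ hD) hy
    · rw [dom_append Γ₂, List.disjoint_append_right]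
      refine ⟨hdis, fun y h1 h2 => ?_⟩
      simp only [dom, List.map_cons, List.map_nil, List.mem_singleton] at h2
      subst h2
      rw [dom_append, List.mem_append] at h1
      exact h1.elim hDΓ.1 hDc
    · have h1 := ih1 (by
        rw [dom_append, dom_append, Ctx.dom_nsub, List.mem_append, List.mem_append]
        rintro ((h | h) | h)
        · exact hDΓ.1 h
        · exact hDc h
        · exact hDΓ₂.2 h) (hA.nsub_fam hS hsub)
      rw [Ctx.nsub_append, ← List.append_assoc, hF σ hσI, Formula.FixedBy.map_eq hΔ hσI]
      exact h1

variable {a : ModedFam} {c : Clause}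

/-! Moded families. -/

theorem kpis_append (T U : Tele) (K : Kind) : kpis (T ++ U) K = kpis T (kpis U K) :=
  List.foldr_append

theorem kpis_inj {T T' : Tele} {K K' : Kind} (hl : T.length = T'.length)
    (h : kpis T K = kpis T' K') : T = T' ∧ K = K' := by
  induction T generalizing T' with
  | nil => cases T' <;> simp_all [kpis]
  | cons A T ih =>
    cases T' with
    | nil => simp at hl
    | cons A' T' =>
      simp only [kpis, List.foldr_cons, Exp.kpi.injEq] at h
      obtain ⟨h1, h2⟩ := ih (by simpa using hl) h.2
      exact ⟨by rw [h.1, h1], h2⟩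

/-- The kind of the family is closed, and iterated products with prefixes of equal length determine
their telescopes. -/
theorem ModedFam.closed (hS : S.Valid) (ha : a.DeclaredIn S) (θ : Var → Obj) :
    teleSub θ a.inp = a.inp ∧ teleSub (upSub^[a.inp.length] θ) a.out = a.out := by
  have h := Exp.sub_closed (hS.fam_closed ha) θ
  rw [kpis_sub] at h
  obtain ⟨h1, h2⟩ := kpis_inj (by simp) h
  rw [kpis_sub] at h2
  exact ⟨h1, (kpis_inj (by simp) h2).1⟩

theorem ModedFam.kind (ha : a.DeclaredIn S) {Γ : Ctx} (hc : CtxValid S Γ) :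
    LF S (.fam Γ [] (.tcon a.name) (kpis (a.inp ++ a.out) .type)) := by
  rw [kpis_append]
  exact .fam_con ha hc

theorem ModedFam.ins_append_outs (a : ModedFam) (Ms : List Obj) : a.ins Ms ++ a.outs Ms = Ms :=
  List.take_append_drop _ _

/-- The full argument list is typed by inversion of the application, then cut at the boundary
between inputs and outputs. -/
theorem ModedFam.args_wf (hS : S.Valid) (ha : a.DeclaredIn S) {Γ : Ctx} {Ms : List Obj}
    (h : LF S (.fam Γ [] (a.atom Ms) .type)) :
    TeleSubst S Γ (a.ins Ms) a.inp ∧ TeleSubst S Γ (a.outs Ms) (teleInst (a.ins Ms) a.out) := by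
  have h1 : TeleSubst S Γ Ms (a.inp ++ a.out) :=
    LF.tapps_inv_type hS h (a.kind ha h.ctx_gam)
  have hl := h1.length
  rw [← a.ins_append_outs Ms] at h1
  refine h1.split ?_
  simp only [ModedFam.ins, List.length_take, List.length_append] at hl ⊢
  omega

theorem ModedFam.ins_kind (ha : a.DeclaredIn S) {Γ : Ctx} {Ms : List Obj}
    (h : TeleSubst S Γ Ms a.inp) :
    LF S (.fam Γ [] (a.atom Ms) (kpis (teleInst Ms a.out) .type)) := by
  have h1 := LF.tapps h (LF.fam_con ha h.ctx_valid)
  rw [Exp.inst, kpis_sub] at h1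
  exact h1

/-- Strengthening for the input arguments of a family. -/
theorem ModedFam.ins_strengthen (hS : S.Valid) (ha : a.DeclaredIn S) {Γ Γ' : Ctx} {Ms : List Obj}
    (h : TeleSubst S Γ Ms a.inp) (hc : CtxValid S Γ') (hΓ : ∀ p ∈ Γ, p.1 ∈ dom Γ' → p ∈ Γ')
    (hfv : ∀ x ∈ fvs Ms, x ∈ dom Γ') : TeleSubst S Γ' Ms a.inp := by
  -- Rather than one argument at a time, the partially applied family is strengthened, and its
  -- arguments are read back by inversion.
  obtain ⟨K', hK, -⟩ := ((a.ins_kind ha h).toD.strengthen hS hc hΓ (by simp [Judg.psi])).2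
    (by rw [ModedFam.atom, fv_tapps]; simpa [Exp.fv] using hfv)
  have h1 := (hK.tapps_inv hS (a.kind ha hc)).2
  rwa [h.length, List.take_left] at h1

/-- Both telescopes come from a closed kind, and the final atom mentions only bound variables. -/
theorem ModedFam.formula_fixed (hS : S.Valid) (ha : a.DeclaredIn S) (I : Finset ℕ) :
    a.formula.FixedBy I := by
  intro σ _
  have h := a.closed hS ha σ.toVar
  simp only [Formula.nsub, ModedFam.formula, teleSub_append, h.1, h.2, teleSub, tapps_sub]
  have : ∀ n m, (bvars n).map (Exp.sub (upSub^[m] σ.toVar)) = bvars n := by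
    intro n m
    conv_rhs => rw [← List.map_id (bvars n)]
    refine List.map_congr_left fun M hM => ?_
    simp only [bvars, List.mem_reverse, List.mem_map] at hM
    obtain ⟨i, -, rfl⟩ := hM
    exact toVar_upSub_b σ m i
  rw [← Function.iterate_add_apply, this]
  rfl

theorem nsub_args {I : Finset ℕ} {Ms : List Obj} (hM : ∀ x ∈ fvs Ms, x ∈ I) {σ : Subst}
    (hσ : ∀ y ∈ I, σ y = fvar y) : Ms.map (Exp.sub σ.toVar) = Ms := by
  conv_rhs => rw [← List.map_id Ms]
  exact List.map_congr_left fun M hM' =>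
    Exp.nsub_eq_self fun x hx => hσ x (hM x (mem_fvs.2 ⟨M, hM', hx⟩))

/-- Instances of the formula of a family depend only on the variables of the arguments. -/
theorem ModedFam.inst_fixed (hS : S.Valid) (ha : a.DeclaredIn S) {I : Finset ℕ} {Ms : List Obj}
    (hl : Ms.length = a.inp.length) (hM : ∀ x ∈ fvs Ms, x ∈ I) :
    Formula.FixedBy I ⟨[], teleInst Ms a.formula.ex⟩ := by
  intro σ hσ
  have h := a.formula_fixed hS ha ∅ σ (by simp)
  have h2 : teleSub (upSub^[a.inp.length] σ.toVar) a.formula.ex = a.formula.ex :=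
    congrArg Formula.ex h
  simp only [Formula.nsub, List.length_nil, Function.iterate_zero, id_eq, teleInst_teleSub, hl, h2,
    nsub_args hM hσ]
  rfl

/-- The atom of the family applied to the input arguments and to the bound output variables. -/
theorem ModedFam.goal_atom_inst (a : ModedFam) {Ms Ns : List Obj} {n : ℕ} (hl : Ns.length = n) :
    (tapps ((a.atom Ms).lift n) (bvars n)).inst Ns = a.atom (Ms ++ Ns) := by
  subst hl
  rw [Exp.inst, tapps_sub]
  rw [show ((a.atom Ms).lift Ns.length).sub (env Ns) = a.atom Ms from Exp.lift_inst _ Ns]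
  rw [show (bvars Ns.length).map (Exp.sub (env Ns)) = Ns from bvars_inst Ns]
  exact (tapps_append _ _ _).symm

/-- The goal formula is the inductive hypothesis instantiated with the inputs of the head, so it
depends on the variables of these inputs alone. -/
theorem goal_fixed (hS : S.Valid) (ha : a.DeclaredIn S) {I : Finset ℕ} {Ms : List Obj}
    (hl : Ms.length = a.inp.length) (hM : ∀ x ∈ fvs Ms, x ∈ I) :
    Formula.FixedBy I ⟨[], teleInst Ms a.out ++
      [tapps ((a.atom Ms).lift (teleInst Ms a.out).length) (bvars (teleInst Ms a.out).length)]⟩ := by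
  have e : teleInst Ms a.formula.ex = teleInst Ms a.out ++
      [tapps ((a.atom Ms).lift (teleInst Ms a.out).length)
        (bvars (teleInst Ms a.out).length)] := by
    rw [teleInst, ModedFam.formula, teleSub_append]
    simp only [teleSub, tapps_sub, teleInst_length]
    congr 2
    have hb : (bvars (a.inp.length + a.out.length)).map (Exp.sub (upSub^[a.out.length] (env Ms))) =
        Ms.map (Exp.lift a.out.length) ++ bvars a.out.length := by
      refine List.ext_getElem (by simp [bvars, hl]) fun i h1 h2 => ?_
      have h1' : i < a.inp.length + a.out.length := by simpa [bvars] using h1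
      simp only [bvars, List.map_reverse, List.getElem_reverse, List.getElem_map,
        List.getElem_range, List.length_map, List.length_range, Exp.sub]
      -- `bvars` lists the outermost variable first: entry i has index n - 1 - i. The leading
      -- entries are the inputs and receive the lifted arguments, while the remaining ones are the
      -- outputs and stay bound.
      by_cases hi : i < a.inp.length
      · rw [List.getElem_append_left (by simpa [hl] using hi)]
        have := upSub_iterate_shift (env Ms) a.out.length (.b (a.inp.length - 1 - i))
        simp only [Var.shift] at this
        rw [show a.inp.length + a.out.length - 1 - i = a.inp.length - 1 - i + a.out.length by omega,
          this, env_lt _ (by omega), List.getElem_map]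
        congr 2
        omega
      · rw [List.getElem_append_right (by simp [hl]; omega), upSub_iterate_lt _ (by omega)]
        simp only [List.getElem_reverse, List.getElem_map, List.getElem_range, List.length_map,
          List.length_range, hl]
        refine congrArg bvar ?_
        omega
    rw [hb, tapps_append]
    congr 1
    simp only [ModedFam.atom, Exp.lift, Exp.ren_eq_sub, tapps_sub]
    exact congrArg (tapps (.tcon a.name)) (List.map_congr_left fun M _ => M.ren_eq_sub _)
  rw [← e]
  exact a.inst_fixed hS ha hl hM

/-! Clauses. -/

theorem Clause.varNames_for (c : Clause) : NamesFor c.varNames c.vars [] :=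
  ⟨by simp [Clause.varNames], List.nodup_range, by simp [dom]⟩

/-- The type of the clause, with names for its variables. -/
theorem Clause.body_inst (c : Clause) (a : ModedFam) :
    (c.prems.foldl (fun B p => arrow (tapps (.tcon a.name) p) B)
      (tapps (.tcon a.name) c.head)).inst (c.varNames.map fvar) =
    ((List.range c.prems.length).map fun i => a.atom (c.premArgs i)).foldl
      (fun B A => arrow A B) (a.atom c.headArgs) := by
  have h1 : ((List.range c.prems.length).map fun i => a.atom (c.premArgs i)) =
      c.prems.map fun p => a.atom (p.map (Exp.inst (c.varNames.map fvar))) := by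
    refine List.ext_getElem (by simp) fun i h1 h2 => ?_
    have h3 : i < c.prems.length := by simpa using h2
    simp [Clause.premArgs, h3]
  rw [h1, List.foldl_map, Exp.inst, arrows_sub]
  simp only [tapps_sub, ModedFam.atom, Clause.headArgs]
  rfl

theorem Clause.wf (hS : S.Valid) (hc : c.IsClauseFor a S) :
    CtxValid S c.ctx ∧ LF S (.fam c.ctx [] (a.atom c.headArgs) .type) ∧
      ∀ i < c.prems.length, LF S (.fam c.ctx [] (a.atom (c.premArgs i)) .type) := by
  obtain ⟨h1, h2⟩ := (hS.obj_wf hc.declared).open_tpis hS c.varNames_for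
  rw [c.body_inst a] at h2
  obtain ⟨h3, h4⟩ := LF.arrows_inv hS (fun A => A) h2
  refine ⟨h1, h3, fun i hi => h4 _ (List.mem_map.2 ⟨i, List.mem_range.2 hi, rfl⟩)⟩

theorem Clause.dom_ctx (c : Clause) : dom c.ctx = List.range c.vars.length :=
  dom_openTele _ _ (by simp [Clause.varNames])

/-! ### The contexts Γ_{c_i} and the invariant for mode checking. -/

/-- The properties of the contexts `Γ_{c_i}`. -/
structure Clause.StepOk (c : Clause) (a : ModedFam) (S : Sig) (i : ℕ) : Prop where
  valid : CtxValid S (c.stepCtx a i)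
  sub : ∀ p ∈ c.ctx, p.1 ∈ dom (c.stepCtx a i) → p ∈ c.stepCtx a i
  names : ∀ x ∈ dom (c.stepCtx a i), x < c.vars.length + i
  mode : ∀ x ∈ c.modeVars a i, x ∈ dom (c.stepCtx a i)

theorem mem_dom_filter {Γ : Ctx} {P : ℕ → Prop} [DecidablePred P] {x : ℕ} :
    x ∈ dom (Γ.filter fun p => P p.1) ↔ x ∈ dom Γ ∧ P x := by
  simp only [mem_dom, List.mem_filter, decide_eq_true_eq]
  exact ⟨fun ⟨B, h1, h2⟩ => ⟨⟨B, h1⟩, h2⟩, fun ⟨⟨B, h1⟩, h2⟩ => ⟨B, h1, h2⟩⟩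

theorem fvs_append (Ms Ns : List Obj) : fvs (Ms ++ Ns) = fvs Ms ∪ fvs Ns := by
  ext x
  simp only [mem_fvs, List.mem_append, Finset.mem_union, or_and_right, exists_or]

theorem fvs_atom {Γ : Ctx} {Ms : List Obj} (h : LF S (.fam Γ [] (a.atom Ms) .type)) :
    ∀ x ∈ fvs Ms, x ∈ dom Γ := by
  intro x hx
  refine h.scoped.2 x ?_
  rw [ModedFam.atom, fv_tapps]
  exact Finset.mem_union_right _ hx

theorem ModedFam.mem_fvs_iff (a : ModedFam) {Ms : List Obj} {x : ℕ} :
    x ∈ fvs Ms ↔ x ∈ fvs (a.ins Ms) ∨ x ∈ fvs (a.outs Ms) := by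
  conv_lhs => rw [← a.ins_append_outs Ms, fvs_append, Finset.mem_union]

/-- Restricting the context of the clause to a set closed under dependence leaves a valid context.
-/
theorem Clause.stepOk_zero (hS : S.Valid) (hc : c.IsClauseFor a S) : c.StepOk a S 0 := by
  obtain ⟨h1, h2, -⟩ := Clause.wf hS hc
  have hdom : ∀ x, x ∈ dom (c.stepCtx a 0) ↔
      x ∈ dom c.ctx ∧ x ∈ depClosure c.ctx (fvs (a.ins c.headArgs)) := fun x => mem_dom_filter
  refine ⟨?_, fun p hp hpd => ?_, fun x hx => ?_, fun x hx => ?_⟩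
  · have := CtxValid.append_filter hS (Γ := []) .ctx_nil h1
      (fun x => x ∈ depClosure c.ctx (fvs (a.ins c.headArgs))) (by simp [dom]) (by simp [dom])
      fun x A hx hxX y hy => Or.inr (h1.depClosure_closed hx hxX hy)
    exact this
  · exact List.mem_filter.2 ⟨hp, by simpa using ((hdom _).1 hpd).2⟩
  · have := ((hdom x).1 hx).1
    rw [c.dom_ctx, List.mem_range] at this
    omega
  · exact (hdom x).2 ⟨fvs_atom h2 x (a.mem_fvs_iff.2 (Or.inl hx.1)), subset_depClosure _ _ hx.1⟩

/-- The context `Γ_{c_i}` together with the output variables of the premise. -/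
theorem Clause.newCtx_ok (hS : S.Valid) (hc : c.IsClauseFor a S) {i : ℕ}
    (hi : i < c.prems.length) (hmode : c.ModeConsistent a) (h : c.StepOk a S i) :
    LF S (.fam (c.stepCtx a i ++ c.newCtx a i (c.stepCtx a i)) [] (a.atom (c.premArgs i)) .type) ∧
      (∀ p ∈ c.ctx, p.1 ∈ dom (c.stepCtx a i ++ c.newCtx a i (c.stepCtx a i)) →
        p ∈ c.stepCtx a i ++ c.newCtx a i (c.stepCtx a i)) ∧
      (∀ x ∈ dom (c.stepCtx a i ++ c.newCtx a i (c.stepCtx a i)), x < c.vars.length + i) ∧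
      ∀ x ∈ fvs (c.premArgs i), x ∈ dom (c.stepCtx a i ++ c.newCtx a i (c.stepCtx a i)) := by
  obtain ⟨h1, -, h3⟩ := Clause.wf hS hc
  have hp := h3 i hi
  have hdom : ∀ x, x ∈ dom (c.newCtx a i (c.stepCtx a i)) ↔ x ∈ dom c.ctx ∧
      (x ∈ depClosure c.ctx (fvs (a.outs (c.premArgs i))) ∧ x ∉ dom (c.stepCtx a i)) :=
    fun x => mem_dom_filter (P := fun x => x ∈ depClosure c.ctx (fvs (a.outs (c.premArgs i))) ∧
      x ∉ dom (c.stepCtx a i))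
  have hv : CtxValid S (c.stepCtx a i ++ c.newCtx a i (c.stepCtx a i)) := by
    refine h.valid.append_filter hS h1 (fun x => x ∈ depClosure c.ctx (fvs (a.outs (c.premArgs i))) ∧
      x ∉ dom (c.stepCtx a i)) h.sub (fun x hx => hx.2) fun x A hx hxX y hy => ?_
    -- A variable on which a new variable depends is already declared or, by closedness, new as
    -- well.
    by_cases hyd : y ∈ dom (c.stepCtx a i)
    · exact Or.inl hyd
    · exact Or.inr ⟨h1.depClosure_closed hx hxX.1 hy, hyd⟩
  have hsub : ∀ p ∈ c.ctx, p.1 ∈ dom (c.stepCtx a i ++ c.newCtx a i (c.stepCtx a i)) →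
      p ∈ c.stepCtx a i ++ c.newCtx a i (c.stepCtx a i) := by
    intro p hp hpd
    rw [dom_append, List.mem_append] at hpd
    rcases hpd with hpd | hpd
    · exact List.mem_append_left _ (h.sub p hp hpd)
    · exact List.mem_append_right _ (List.mem_filter.2 ⟨hp, by simpa using ((hdom _).1 hpd).2⟩)
  have hfv : ∀ x ∈ fvs (c.premArgs i),
      x ∈ dom (c.stepCtx a i ++ c.newCtx a i (c.stepCtx a i)) := by
    intro x hx
    rw [dom_append, List.mem_append]
    by_cases hxd : x ∈ dom (c.stepCtx a i)
    · exact Or.inl hxd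
    -- Mode consistency excludes an undeclared variable in an input argument; one in an output
    -- argument belongs to the new context.
    · rcases a.mem_fvs_iff.1 hx with hx' | hx'
      · exact absurd (h.mode x (hmode.1 i hi x hx')) hxd
      · exact Or.inr ((hdom x).2 ⟨fvs_atom hp x hx, subset_depClosure _ _ hx', hxd⟩)
  refine ⟨hp.strengthen_fam hS hv hsub ?_, hsub, fun x hx => ?_, hfv⟩
  · rw [ModedFam.atom, fv_tapps]
    simpa [Exp.fv] using hfv
  · rw [dom_append, List.mem_append] at hx
    rcases hx with hx | hx
    · exact h.names x hx
    · have := ((hdom x).1 hx).1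
      rw [c.dom_ctx, List.mem_range] at this
      omega

/-- The bound on names does the bookkeeping: before this step all names lie strictly below
`c.vars.length + i`, which is the name of the new derivation variable. -/
theorem Clause.stepOk_succ (hS : S.Valid) (hc : c.IsClauseFor a S) {i : ℕ}
    (hi : i < c.prems.length) (hmode : c.ModeConsistent a) (h : c.StepOk a S i) :
    c.StepOk a S (i + 1) := by
  obtain ⟨h1, h2, h3, h4⟩ := Clause.newCtx_ok hS hc hi hmode h
  have hdom : ∀ x, x ∈ dom (c.stepCtx a (i + 1)) ↔
      x ∈ dom (c.stepCtx a i ++ c.newCtx a i (c.stepCtx a i)) ∨ x = c.vars.length + i := by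
    intro x
    simp only [Clause.stepCtx, dom_append (c.stepCtx a i ++ _), List.mem_append]
    simp [dom, Clause.derivName]
  refine ⟨.snoc (fun hx => ?_) h1, fun p hp hpd => ?_, fun x hx => ?_, fun x hx => ?_⟩
  · exact absurd (h3 _ hx) (lt_irrefl _)
  · rcases (hdom _).1 hpd with hpd | hpd
    · exact List.mem_append_left _ (h2 p hp hpd)
    · have := mem_dom_of_mem (x := p.1) (A := p.2) hp
      rw [c.dom_ctx, List.mem_range] at this
      omega
  · rcases (hdom x).1 hx with hx | hx
    · have := h3 x hx
      omega
    · omega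
  · refine (hdom x).2 (Or.inl ?_)
    rcases hx with hx | hx
    · rw [dom_append]
      exact List.mem_append_left _ (h.mode x hx)
    · exact h4 x (a.mem_fvs_iff.2 (Or.inr hx.1))

theorem Clause.stepOk (hS : S.Valid) (hc : c.IsClauseFor a S) (hmode : c.ModeConsistent a) {i : ℕ}
    (hi : i ≤ c.prems.length) : c.StepOk a S i := by
  induction i with
  | zero => exact Clause.stepOk_zero hS hc
  | succ i ih => exact Clause.stepOk_succ hS hc hi hmode (ih (by omega))

theorem Clause.stepCtx_mono (c : Clause) (a : ModedFam) {i j : ℕ} (h : i ≤ j) :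
    ∀ p ∈ c.stepCtx a i, p ∈ c.stepCtx a j := by
  induction j, h using Nat.le_induction with
  | base => exact fun _ h => h
  | succ j _ ih =>
    intro p hp
    simp only [Clause.stepCtx, List.mem_append]
    exact Or.inl (Or.inl (ih p hp))

theorem dom_mono {Γ Γ' : Ctx} (h : ∀ p ∈ Γ, p ∈ Γ') : ∀ x ∈ dom Γ, x ∈ dom Γ' := by
  intro x hx
  obtain ⟨A, hA⟩ := mem_dom.1 hx
  exact mem_dom_of_mem (h _ hA)

theorem Clause.derivName_mem (c : Clause) (a : ModedFam) {i j : ℕ} (h : i < j) :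
    (c.derivName i, a.atom (c.premArgs i)) ∈ c.stepCtx a j :=
  c.stepCtx_mono a (Nat.succ_le_of_lt h) _ (by simp [Clause.stepCtx])

theorem Clause.mem_inCtx (hS : S.Valid) (hc : c.IsClauseFor a S) :
    ∀ x ∈ fvs (a.ins c.headArgs), x ∈ dom (c.inCtx a) := by
  intro x hx
  refine (mem_dom_filter (P := fun x => x ∈ depClosure c.ctx (fvs (a.ins c.headArgs)))).2
    ⟨?_, subset_depClosure _ _ hx⟩
  exact fvs_atom (Clause.wf hS hc).2.1 x (a.mem_fvs_iff.2 (Or.inl hx))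

/-- In the end all variables of the clause are declared. -/
theorem Clause.ctx_sub (hS : S.Valid) (hc : c.IsClauseFor a S) (hmode : c.ModeConsistent a) :
    ∀ p ∈ c.ctx, p ∈ c.stepCtx a c.prems.length := by
  have hok := Clause.stepOk hS hc hmode le_rfl
  intro p hp
  refine hok.sub p hp ?_
  have hp' : p.1 ∈ c.varNames := by
    rw [Clause.varNames, ← c.dom_ctx]; exact mem_dom_of_mem (A := p.2) hp
  -- The clause has no variables beyond the dependency closure of those in its atoms. Head inputs
  -- are declared initially, head outputs are known by mode consistency, premise variables are added
  -- on the way, and validity of the final context handles dependencies.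
  refine depClosure_subset (fun x hx => ?_) (fun x A hx hxd y hy => ?_) _
    (hc.vars_occur p.1 hp')
  · rw [fvs_append, Finset.mem_union] at hx
    rcases hx with hx | hx
    · rcases a.mem_fvs_iff.1 hx with hx | hx
      · exact dom_mono (c.stepCtx_mono a (Nat.zero_le _)) x (Clause.mem_inCtx hS hc x hx)
      · exact hok.mode x (hmode.2 x hx)
    · obtain ⟨M, hM, hx⟩ := mem_fvs.1 hx
      obtain ⟨i, hi, hM⟩ := List.mem_flatMap.1 hM
      rw [List.mem_range] at hi
      have h := (Clause.newCtx_ok hS hc hi hmode (Clause.stepOk hS hc hmode hi.le)).2.2.2 x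
        (mem_fvs.2 ⟨M, hM, hx⟩)
      refine dom_mono (fun q hq => ?_) x h
      refine c.stepCtx_mono a (Nat.succ_le_of_lt hi) q ?_
      exact List.mem_append_left _ hq
  · exact hok.valid.fv (hok.sub _ hx hxd) y hy

/-! ### Validity of the constructed proof. -/

/-- The base step is valid. -/
theorem Clause.baseStep_valid (hS : S.Valid) (ha : a.DeclaredIn S) (hc : c.IsClauseFor a S)
    (hmode : c.ModeConsistent a) (Δ : List Formula) :
    M2 S (.seq (c.baseStep a) ⟨c.stepCtx a c.prems.length, Δ,
      ⟨[], teleInst (a.ins c.headArgs) a.out ++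
        [tapps ((a.atom (a.ins c.headArgs)).lift (teleInst (a.ins c.headArgs) a.out).length)
          (bvars (teleInst (a.ins c.headArgs) a.out).length)]⟩⟩) := by
  have hok := Clause.stepOk hS hc hmode le_rfl
  have hsub := Clause.ctx_sub hS hc hmode
  have hhead := (Clause.wf hS hc).2.1.weaken_fam hS hsub hok.valid
  obtain ⟨-, houts⟩ := a.args_wf hS ha hhead
  refine .ex_right (houts.snoc ?_)
  rw [a.goal_atom_inst houts.length, a.ins_append_outs, apps_append]
  have hvars : TeleSubst S (c.stepCtx a c.prems.length) (c.varNames.map fvar) c.vars :=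
    .vars hok.valid c.varNames_for.1 hsub
  have h1 := LF.apps hvars (LF.obj_con hc.declared hok.valid)
  rw [c.body_inst a] at h1
  refine LF.apps_arrows ?_ h1
  -- Derivation variables and premises are enumerated by the same index, and each variable is
  -- declared with exactly its premise as type.
  rw [List.forall₂_map_left_iff, List.forall₂_map_right_iff, List.forall₂_same]
  exact fun i hi => .obj_fvar (c.derivName_mem a (List.mem_range.1 hi)) hok.valid

/-- These names start above all clause variables and all derivation variables, hence they are fresh
for each Γ_{c_i} and can be reused for every premise. -/
theorem Clause.outNames_for (c : Clause) (a : ModedFam) {i : ℕ} (hi : i < c.prems.length) :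
    (c.outNames a).length = a.out.length ∧ (c.outNames a ++ [c.derivName i]).Nodup ∧
      ∀ x ∈ c.outNames a, c.vars.length + c.prems.length ≤ x := by
  have h : ∀ x ∈ c.outNames a, c.vars.length + c.prems.length ≤ x := by
    intro x hx
    obtain ⟨j, -, rfl⟩ := List.mem_map.1 hx
    omega
  refine ⟨by simp [Clause.outNames], ?_, h⟩
  rw [List.nodup_append]
  refine ⟨List.nodup_range.map fun j k h => by simpa using h, by simp, ?_⟩
  intro x hx y hy
  rw [List.mem_singleton] at hy
  have := h x hx
  simp only [Clause.derivName] at hy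
  omega

/-- The context that results from the application of the inductive hypothesis. -/
theorem ModedFam.openTele_formula (a : ModedFam) {Ms : List Obj} {xs : List ℕ} {D : ℕ}
    (hMs : Ms.length = a.inp.length) (hxs : xs.length = a.out.length) :
    openTele (xs ++ [D]) (teleInst Ms a.formula.ex) =
      openTele xs (teleInst Ms a.out) ++ [(D, a.atom (Ms ++ xs.map fvar))] := by
  rw [teleInst, ModedFam.formula, teleSub_append, openTele_append _ _ _ _ (by simpa using hxs)]
  congr 1
  have h1 := (tapps (.tcon a.name) (bvars (a.inp.length + a.out.length))).inst_append Ms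
    (xs.map fvar)
  rw [List.length_map, hxs] at h1
  have h2 : (tapps (.tcon a.name) (bvars (a.inp.length + a.out.length))).inst
      (Ms ++ xs.map fvar) = a.atom (Ms ++ xs.map fvar) := by
    have hl : (Ms ++ xs.map fvar).length = a.inp.length + a.out.length := by simp [hMs, hxs]
    rw [← hl, Exp.inst, tapps_sub]
    rw [show (bvars (Ms ++ xs.map fvar).length).map (Exp.sub (env (Ms ++ xs.map fvar))) = _ from
      bvars_inst (Ms ++ xs.map fvar)]
    rfl
  rw [h2] at h1
  simp only [teleInst, teleSub, openTele]
  rw [← h1]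
  rfl

/-- Each treated premise adds one assumption, so there are i + 1 of them, with the inductive
hypothesis still in position 0. That all assumptions are insensitive to variables outside Γ_{c_i} is
what carries them through the splittings for the next premise. -/
theorem Clause.steps_valid (hS : S.Valid) (ha : a.DeclaredIn S) (hc : c.IsClauseFor a S)
    (hmode : c.ModeConsistent a) (cov : c.OutputCoverage a S) (j i : ℕ)
    (hij : i + j = c.prems.length) (Δ : List Formula) (hlen : Δ.length = i + 1)
    (hΔ₀ : Δ[0]? = some a.formula)
    (hΔ : ∀ G ∈ Δ, G.FixedBy (dom (c.stepCtx a i)).toFinset) :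
    M2 S (.seq (c.steps a cov j i hij) ⟨c.stepCtx a i, Δ,
      ⟨[], teleInst (a.ins c.headArgs) a.out ++
        [tapps ((a.atom (a.ins c.headArgs)).lift (teleInst (a.ins c.headArgs) a.out).length)
          (bvars (teleInst (a.ins c.headArgs) a.out).length)]⟩⟩) := by
  induction j generalizing i Δ with
  | zero =>
    obtain rfl : i = c.prems.length := by omega
    exact Clause.baseStep_valid hS ha hc hmode Δ
  | succ j ih =>
    have hi : i < c.prems.length := by omega
    obtain ⟨hwf, hhead, hprem⟩ := Clause.wf hS hc
    have hok := Clause.stepOk hS hc hmode hi.le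
    have hinfv : ∀ x ∈ fvs (a.ins (c.premArgs i)), x ∈ dom (c.stepCtx a i) :=
      fun x hx => hok.mode x (hmode.1 i hi x hx)
    have hins : TeleSubst S (c.stepCtx a i) (a.ins (c.premArgs i)) a.inp :=
      a.ins_strengthen hS ha (a.args_wf hS ha (hprem i hi)).1 hok.valid hok.sub hinfv
    obtain ⟨hxl, hxnd, hxge⟩ := c.outNames_for a hi
    have hdis : (c.outNames a).Disjoint (dom (c.stepCtx a i)) := fun x hx hx' => by
      have h1 := hxge x hx
      have h2 := hok.names x hx'
      omega
    have hD : c.derivName i ∉ dom (c.stepCtx a i) := fun h => absurd (hok.names _ h) (lt_irrefl _)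
    -- The coverage goal is a well-formed type: the family applied to typed inputs expects exactly
    -- the outputs that are being named.
    obtain ⟨-, hgoal⟩ := (a.ins_kind ha hins).open_kpis hS (xs := c.outNames a)
      ⟨by simpa using hxl, (List.nodup_append.1 hxnd).1, hdis⟩
    have hgoal' : LF S (.fam (c.stepCtx a i ++
        openTele (c.outNames a) (teleInst (a.ins (c.premArgs i)) a.out)) []
        (a.atom (a.ins (c.premArgs i) ++ (c.outNames a).map fvar)) .type) := by
      rw [ModedFam.atom, tapps_append]; exact hgoal
    have hsub : dom (c.stepCtx a i) ⊆ dom (c.stepCtx a (i + 1)) :=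
      fun x hx => dom_mono (c.stepCtx_mono a (Nat.le_succ i)) x hx
    have hΔ' : ∀ G ∈ Δ ++ [⟨[], teleInst (a.ins (c.premArgs i)) a.formula.ex⟩],
        G.FixedBy (dom (c.stepCtx a i)).toFinset := by
      intro G hG
      rcases List.mem_append.1 hG with hG | hG
      · exact hΔ G hG
      · rw [List.mem_singleton] at hG
        subst hG
        exact a.inst_fixed hS ha hins.length (by simpa using hinfv)
    have hF := goal_fixed hS ha (I := (dom (c.stepCtx a i)).toFinset)
      (a.args_wf hS ha hhead).1.length fun x hx => by
        simpa using dom_mono (c.stepCtx_mono a (Nat.zero_le i)) x (Clause.mem_inCtx hS hc x hx)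
    refine .all_left (F₁ := a.formula) hΔ₀ hins ?_
    -- Position i + 1 is the end of the extended list, that is, the assumption just added.
    refine .ex_left (T := teleInst (a.ins (c.premArgs i)) a.formula.ex) ?_ ?_ hxnd ?_ ?_
    · rw [List.getElem?_append_right (by omega)]
      simp [hlen]
    · simp [ModedFam.formula, hxl]
    · rw [List.disjoint_append_left]
      exact ⟨hdis, by simpa using hD⟩
    · rw [a.openTele_formula hins.length hxl, ← List.append_assoc]
      have hDg : c.derivName i ∉ dom (c.stepCtx a i ++
          openTele (c.outNames a) (teleInst (a.ins (c.premArgs i)) a.out)) := by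
        rw [dom_append, dom_openTele _ _ (by simpa using hxl), List.mem_append]
        rintro (h | h)
        · exact hD h
        · exact (List.nodup_append.1 hxnd).2.2 _ h _ (by simp) rfl
      have hI := Finset.subset_insert (c.derivName i) (dom (c.stepCtx a i)).toFinset
      -- The pattern's context extended by its derivation variable is Γ_{c_{i+1}} by definition, so
      -- the induction hypothesis for the remaining premises is the proof to be placed at the
      -- leaves.
      refine OutCover.toPf_derives hS (Finset.mem_insert_self _ _)
        (fun G hG => (hΔ' G hG).mono hI) (hF.mono hI) (ih (i + 1) (by omega) _ (by simp [hlen]) ?_ ?_)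
        (cov ⟨i, hi⟩ : c.PremCover a S i) hDg hgoal'
      · rw [List.getElem?_append_left (by omega)]
        exact hΔ₀
      · exact fun G hG => (hΔ' G hG).mono fun x hx => by
          simpa using hsub (by simpa using hx)

end TwelfM2

theorem mainTheorem3 (S : Sig) (hS : S.Valid)
    (a : ModedFam) (ha : a.DeclaredIn S)
    (c : Clause) (hc : c.IsClauseFor a S)
    (hmode : c.ModeConsistent a) (cov : c.OutputCoverage a S)
    (G : InGoal) (hG : G = c.inputPattern a)
    (Q : Sequent) (hQ : InRelated a G Q) :
    M2 S (.seq (c.translate a cov) Q) := by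
  subst hG
  obtain ⟨Γ, Δ, F⟩ := Q
  obtain ⟨rfl, rfl, rfl⟩ := hQ
  -- At the start the only assumption is the formula of the family, which is closed and hence fixed
  -- by every substitution.
  refine Clause.steps_valid hS ha hc hmode cov _ 0 _ _ rfl rfl fun G hG => ?_
  rw [List.mem_singleton] at hG
  exact hG ▸ a.formula_fixed hS ha _
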